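/- Let $d\ge 3$ and $\mathbb T^d=\mathbb R^d/2\pi\mathbb Z^d$; all functions are real-valued. Consider the control system $$\partial_t^2 w(t,x)=\Big(\Delta-1+u_0(t)+\sum_{j=1}^{d}\big(u_{2j-1}(t)\sin x_j+u_{2j}(t)\cos x_j\big)\Big)w(t,x),\qquad x\in\mathbb T^d,$$ with state $W=(w,\partial_t w)\in H^1\times L^2(\mathbb T^d)$ and piecewise constant control $u=(u_0,\dots,u_{2d})$ with values in $\mathbb R^{2d+1}$; $W(t;u,W_0)\in H^1\times L^2(\mathbb T^d)$ denotes the solution at time $t$ with $W(0)=W_0$. For $T\ge 0$ the system is called approximately controllable in time $T^+$ from $W_0$ if for every $W_f\in H^1\times L^2(\mathbb T^d)$ and every $\varepsilon>0$ there are $T_1\in[T,T+\varepsilon]$ and a piecewise constant $u:[0,T_1]\to\mathbb R^{2d+1}$ with $\|W(T_1;u,W_0)-W_f\|_{H^1\times L^2}<\varepsilon$. Let $\mathcal T(W_0)\in[0,\infty]$ be the infimum of the $T\ge 0$ such that the system is approximately controllable in time $T^+$ from $W_0$ ($+\infty$ if there are none). For a (possibly vector-valued) $f\in L^2(\mathbb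 T^d)$ let $Z(f)=f^{-1}(\{0\})$. Write $Z(f)=Z(g)$ if $f=0$ a.e. on $Z(g)$ and $g=0$ a.e. on $Z(f)$, and say that $Z(f)$ is closed if some function equal to $f$ a.e. has a closed zero set. Then $\mathcal T(W_0)<\infty$ for every nonzero $W_0=(w_0,\dot w_0)$ of one of the following kinds: 1. $W_0=(0,\dot w_0)$ where $\dot w_0\in H^{s}(\mathbb T^d)$ for some $s>\frac d2-1$, and either $\dot w_0\ge 0$ a.e. on $\mathbb T^d$ or $\dot w_0\le 0$ a.e. on $\mathbb T^d$; 2. $W_0\in H^1\times L^2(\mathbb T^d)$ with $Z(w_0)=Z(W_0)$ and $Z(W_0)$ closed; 3. $W_0\in H^1\times H^1(\mathbb T^d)$ with $Z(W_0)$ closed. When $d=3$, statements 2 and 3 hold without the assumption that $Z(W_0)$ is closed. -/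

import Mathlib

open MeasureTheory Filter Topology Set
open scoped ENNReal NNReal

namespace KleinGordon

instance factTwoPiPos : Fact (0 < 2 * Real.pi) := ⟨Real.two_pi_pos⟩

/-- The torus `ℝ^d / 2πℤ^d`, with its Lebesgue measure `volume` of total mass `(2π)^d`. -/
abbrev Torus (d : ℕ) : Type := Fin d → AddCircle (2 * Real.pi)

/-- The real Hilbert space `L²(𝕋^d)` of real-valued functions modulo a.e. equality. -/
abbrev L2 (d : ℕ) : Type := Lp ℝ 2 (volume : Measure (Torus d))

/-! ### Fourier coefficients and Sobolev spaces -/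

/-- `c_n(f) = (2π)^{-d} ∫ f(x) e^{-i n·x} dx`; here `fourier k y = e^{iky}` on `ℝ/2πℤ`. -/
noncomputable def fourierCoef {d : ℕ} (f : Torus d → ℝ) (n : Fin d → ℤ) : ℂ :=
  ((2 * Real.pi : ℝ) ^ d : ℂ)⁻¹ *
    ∫ x : Torus d, (f x : ℂ) * ∏ i, (fourier (-(n i)) (x i) : ℂ)

/-- The symbol `⟨n⟩² = 1 + |n|²` of `1 - Δ`. -/
noncomputable def japaneseSq {d : ℕ} (n : Fin d → ℤ) : ℝ := 1 + ∑ i, (n i : ℝ) ^ 2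

/-- The `H^s(𝕋^d)` norm, `s ∈ ℝ`, of the distribution with Fourier coefficients `a`
(possibly infinite): `‖a‖_{H^s}² = (2π)^d ∑_n ⟨n⟩^{2s} |a_n|²`. By Parseval the square of the
`H^1` norm is `∫ (|∇f|² + |f|²)` and the square of the `H^0` norm is `∫ |f|²`. -/
noncomputable def sobolevENorm {d : ℕ} (s : ℝ) (a : (Fin d → ℤ) → ℂ) : ℝ≥0∞ :=
  (ENNReal.ofReal ((2 * Real.pi) ^ d) *
    ∑' n, ENNReal.ofReal (japaneseSq n ^ s * ‖a n‖ ^ 2)) ^ (1 / 2 : ℝ)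

/-- `f ∈ H^s(𝕋^d)` (used for `s ≥ 0`, for functions in `L²`). -/
def MemSobolev {d : ℕ} (s : ℝ) (f : L2 d) : Prop := sobolevENorm s (fourierCoef f) < ∞

/-- `W = (w, ẇ)` belongs to `H^1 × L²(𝕋^d)`. -/
def IsState {d : ℕ} (W : L2 d × L2 d) : Prop := MemSobolev 1 W.1

/-- The norm of `H^1 × L²(𝕋^d)`: `‖W‖² = ∫ (|∇w|² + |w|² + |ẇ|²)`. -/
noncomputable def energyENorm {d : ℕ} (W : L2 d × L2 d) : ℝ≥0∞ :=
  (sobolevENorm 1 (fourierCoef W.1) ^ 2 + ‖W.2‖ₑ ^ 2) ^ (1 / 2 : ℝ)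

/-! ### The control system -/

/-- `∑_{j=0}^{2d} u_j V_j(x) = u_0 + ∑_j (u_{2j-1} sin x_j + u_{2j} cos x_j)`; the coordinates
are indexed by `j = 0, …, d-1` here. -/
noncomputable def potential {d : ℕ} (u : Fin (2 * d + 1) → ℝ) (x : Torus d) : ℝ :=
  u 0 + ∑ j : Fin d,
    (u ⟨2 * j.1 + 1, by omega⟩ * Real.Angle.sin (x j)
      + u ⟨2 * j.1 + 2, by omega⟩ * Real.Angle.cos (x j))

/-- `u` is piecewise constant on `[0, T]`. -/
def IsPiecewiseConstant {E : Type*} (T : ℝ) (u : ℝ → E) : Prop :=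
  ∃ (m : ℕ) (τ : Fin (m + 1) → ℝ), Monotone τ ∧ τ 0 = 0 ∧ τ (Fin.last m) = T ∧
    ∀ i : Fin m, ∃ v : E, ∀ t ∈ Ioo (τ i.castSucc) (τ i.succ), u t = v

/-- Fourier coefficients of `(Δ - 1 + ∑_j u_j V_j) w ∈ H^{-1}(𝕋^d)`. -/
noncomputable def forceCoef {d : ℕ} (u : Fin (2 * d + 1) → ℝ) (w : L2 d) (n : Fin d → ℤ) : ℂ :=
  -(japaneseSq n : ℂ) * fourierCoef w n + fourierCoef (fun x => potential u x * w x) n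

/-- `W = (w, ẇ) ∈ C⁰([0,T], H^1 × L²)` solves
`w' = ẇ` in `L²` and `ẇ' = (Δ - 1 + ∑_j u_j(t) V_j) w` in `H^{-1}`
on `(0,T)` outside a finite set of times, with `W(0) = W₀`. -/
structure IsSolution {d : ℕ} (T : ℝ) (u : ℝ → Fin (2 * d + 1) → ℝ) (W₀ : L2 d × L2 d)
    (W : ℝ → L2 d × L2 d) : Prop where
  initial : W 0 = W₀
  mem : ∀ t ∈ Icc 0 T, IsState (W t)
  continuous : ∀ t ∈ Icc 0 T,
    Tendsto (fun s => energyENorm (W s - W t)) (𝓝[Icc 0 T] t) (𝓝 0)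
  equation : ∃ S : Set ℝ, S.Finite ∧ ∀ t ∈ Ioo 0 T \ S,
    HasDerivAt (fun s => (W s).1) (W t).2 t ∧
    Tendsto (fun h : ℝ => sobolevENorm (-1) (fun n =>
        (h : ℂ)⁻¹ * (fourierCoef (W (t + h)).2 n - fourierCoef (W t).2 n)
          - forceCoef (u t) (W t).1 n))
      (𝓝[≠] 0) (𝓝 0)

/-- The target `Wf` is `H^1 × L²`-approximately reachable in time `T⁺` from `W₀`. -/
def ApproxReachable {d : ℕ} (T : ℝ) (W₀ Wf : L2 d × L2 d) : Prop :=
  ∀ ε : ℝ, 0 < ε → ∃ T₁ ∈ Icc T (T + ε), ∃ u : ℝ → Fin (2 * d + 1) → ℝ,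
    IsPiecewiseConstant T₁ u ∧ ∃ W : ℝ → L2 d × L2 d, IsSolution T₁ u W₀ W ∧
      energyENorm (W T₁ - Wf) < ENNReal.ofReal ε

/-- The system is `H^1 × L²`-approximately controllable in time `T⁺` from `W₀`. -/
def ApproxControllable {d : ℕ} (T : ℝ) (W₀ : L2 d × L2 d) : Prop :=
  ∀ Wf : L2 d × L2 d, IsState Wf → ApproxReachable T W₀ Wf

/-- The minimum time for `H^1 × L²`-approximate controllability from `W₀`: the infimum of the
`T ∈ [0,∞)` for which the system is approximately controllable in time `T⁺` from `W₀`
(`∞` if there are none). -/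
noncomputable def minTime {d : ℕ} (W₀ : L2 d × L2 d) : ℝ≥0∞ :=
  ⨅ (T : ℝ≥0) (_ : ApproxControllable (T : ℝ) W₀), (T : ℝ≥0∞)

/-! ### Zero sets, up to null sets -/

/-- `Z(f) = Z(g)`: `f = 0` a.e. on `Z(g)` and `g = 0` a.e. on `Z(f)`. -/
def SameZeroSet {d : ℕ} {E F : Type*} [Zero E] [Zero F] (f : Torus d → E) (g : Torus d → F) :
    Prop :=
  (∀ᵐ x : Torus d, g x = 0 → f x = 0) ∧ (∀ᵐ x : Torus d, f x = 0 → g x = 0)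

/-- `Z(f)` is closed: some function equal to `f` a.e. has a closed set of zeros. -/
def HasClosedZeroSet {d : ℕ} {E : Type*} [Zero E] (f : Torus d → E) : Prop :=
  ∃ g : Torus d → E, g =ᵐ[volume] f ∧ IsClosed (g ⁻¹' {0})

/-- The `ℝ²`-valued function `x ↦ (w(x), ẇ(x))` of `W = (w, ẇ)`. -/
noncomputable def pairFun {d : ℕ} (W : L2 d × L2 d) (x : Torus d) : ℝ × ℝ := (W.1 x, W.2 x)

end KleinGordon

/-!
The proof works in the energy coordinates `z = ((1 - Δ)^{1/2} w, ẇ) ∈ L² × L²`, where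
the evolution under a constant potential is a Fourier multiplier (`evo`), and studies the relation
`ApproxSteer T z₀ z₁`: controls steer `z₀` arbitrarily close to `z₁` in times arbitrarily close to
`T` from above. It is transitive and closed under limits; `Reach` is the case `T = 0`.

*Kicks.* The control `u / δ` during a time `δ → 0` acts as the kick `(w, ẇ) ↦ (w, ẇ + φ w)`, where
`φ` is the potential of `u` (`reach_kick_of_small`). Conjugating the free evolution during a time
`s²` by the kicks of size `± 1 / s` gives the kick by `-φ²` (`tendsto_conj_evo`). Polarization and
`cos² + sin² = 1` then provide all trigonometric modes, and by density all continuous functions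
(`isKick_continuous`). Hence in arbitrarily small time the velocity can be changed by any `g ∈ L²`
that vanishes where `w` does (`reach_add_snd`).

*States with `w ≠ 0` a.e.* From these every state is reachable in arbitrarily small time: choose the
velocity that moves `w` close to its target, shifted by a small generic constant so that the new `w`
is again nonzero a.e., and correct the velocity (`reach_of_ae_ne`). Genericity comes from the fact
that the sets `{a + s b = 0, b ≠ 0}`, `s ∈ ℝ`, are pairwise disjoint, so that only countably many of
them have positive measure (`dense_generic`).

*Making `w` nonzero a.e.* Under the constant potential `1` the zero mode of the equation grows
linearly in time, whereas the other modes are bounded. For a velocity `g` of nonzero mean with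
`∑ |c_n(g)| / ⟨n⟩ < ∞`, the contribution of `g` to `w` is therefore bounded away from zero after a
long time (`exists_ae_ne_smoothing_symS`). This settles the first kind of initial state. If `w` is
not zero, such a `g` is available among the functions vanishing where `w` does: a trigonometric mode
times `w` if `d = 3`, a bump if the zero set is closed. A generic multiple of `g` makes `w` nonzero
a.e. (`minTime_lt_top_of_bump`), which settles the second kind.

*Rotation.* For the third kind, with `ẇ ∈ H¹`, a squeeze `(w, ẇ) ↦ (r w, ẇ / r)` obtained from
high-frequency oscillations (`reach_squeeze`), followed by the free evolution during a time `r` and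
the kick `-1 / r`, exchanges position and velocity as `r → 0` (`reach_rotate`). Applied after a
generic kick `ẇ ↦ ẇ + μ w`, it produces a state whose position vanishes only where both `w` and `ẇ`
do, as for the second kind.
-/

namespace KleinGordon

open scoped ComplexConjugate

variable {d : ℕ}

/-! ### Fourier series on the torus -/

/-- The exponential `x ↦ e^{i n·x}`. -/
noncomputable def expMode (n : Fin d → ℤ) : C(Torus d, ℂ) where
  toFun x := ∏ i, fourier (n i) (x i)
  continuous_toFun := by fun_prop

lemma expMode_apply (n : Fin d → ℤ) (x : Torus d) : expMode n x = ∏ i, fourier (n i) (x i) := rfl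

lemma expMode_neg (n : Fin d → ℤ) (x : Torus d) : expMode (-n) x = conj (expMode n x) := by
  simp [expMode_apply, map_prod]

lemma expMode_add (m n : Fin d → ℤ) (x : Torus d) :
    expMode (m + n) x = expMode m x * expMode n x := by
  simp only [expMode_apply, Pi.add_apply, fourier_add, Finset.prod_mul_distrib]

lemma expMode_zero (x : Torus d) : expMode (0 : Fin d → ℤ) x = 1 := by
  simp [expMode_apply]

lemma norm_expMode_apply (n : Fin d → ℤ) (x : Torus d) : ‖expMode n x‖ = 1 := by
  rw [expMode_apply, norm_prod]
  exact Finset.prod_eq_one fun i _ => Circle.norm_coe _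

lemma expMode_add_right (n : Fin d → ℤ) (x y : Torus d) :
    expMode n (x + y) = expMode n x * expMode n y := by
  simp [expMode_apply, fourier_apply, smul_add, AddCircle.toCircle_add, Finset.prod_mul_distrib]

lemma expMode_single (z : Torus d) (i : Fin d) :
    expMode (Pi.single i 1) z = fourier 1 (z i) := by
  rw [expMode_apply, Finset.prod_eq_single i]
  · simp
  · intro j _ hj
    simp [Pi.single_eq_of_ne hj]
  · simp

lemma integral_fourier_circle (k : ℤ) :
    ∫ x : AddCircle (2 * Real.pi), (fourier k x : ℂ) =
      if k = 0 then ((2 * Real.pi : ℝ) : ℂ) else 0 := by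
  rw [AddCircle.volume_eq_smul_haarAddCircle, integral_smul_measure]
  split_ifs with h
  · subst h
    simp [Real.pi_pos.le]
  · have := orthonormal_iff_ite.mp (orthonormal_fourier (T := 2 * Real.pi)) 0 k
    simp only [ContinuousMap.inner_toLp, fourier_zero, map_one, mul_one] at this
    rw [if_neg (Ne.symm h)] at this
    rw [this, smul_zero]

lemma integral_expMode (n : Fin d → ℤ) :
    ∫ x : Torus d, expMode n x = if n = 0 then ((2 * Real.pi : ℝ) : ℂ) ^ d else 0 := by
  simp only [expMode_apply]
  rw [integral_fintype_prod_volume_eq_prod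
    (fun i (y : AddCircle (2 * Real.pi)) => (fourier (n i) y : ℂ))]
  simp only [integral_fourier_circle]
  split_ifs with h
  · subst h; simp
  · obtain ⟨i, hi⟩ := Function.ne_iff.mp h
    exact Finset.prod_eq_zero (Finset.mem_univ i) (by simpa using hi)

/-- The exponentials are closed under conjugation and multiplication and separate points, so their
span is dense in `C(𝕋^d, ℂ)` by Stone–Weierstrass. -/
lemma span_expMode_closure_eq_top :
    (Submodule.span ℂ (range (expMode (d := d)))).topologicalClosure = ⊤ := by
  classical
  let A : StarSubalgebra ℂ C(Torus d, ℂ) :=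
    { toSubalgebra := Algebra.adjoin ℂ (range expMode)
      star_mem' := by
        change Algebra.adjoin ℂ (range expMode) ≤ star (Algebra.adjoin ℂ (range expMode))
        refine Algebra.adjoin_le ?_
        rintro _ ⟨n, rfl⟩
        refine Algebra.subset_adjoin ⟨-n, ?_⟩
        ext1 x
        simp only [expMode_neg, starRingEnd_apply, ContinuousMap.star_apply] }
  have hA : A.toSubalgebra.toSubmodule = Submodule.span ℂ (range expMode) := by
    apply Algebra.adjoin_eq_span_of_subset
    refine .trans (fun x ↦ Submonoid.closure_induction (fun _ ↦ id) ⟨0, ?_⟩ ?_)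
      Submodule.subset_span
    · ext z; simp [expMode_zero]
    · rintro _ _ _ _ ⟨m, rfl⟩ ⟨n, rfl⟩
      exact ⟨m + n, by ext z; simp [expMode_add]⟩
  have hsep : A.SeparatesPoints := by
    intro x y hxy
    rw [Ne, funext_iff, not_forall] at hxy
    obtain ⟨i, hi⟩ := hxy
    refine ⟨_, ⟨expMode (Pi.single i 1), Algebra.subset_adjoin ⟨Pi.single i 1, rfl⟩, rfl⟩, ?_⟩
    dsimp only
    rw [expMode_single, expMode_single, fourier_one, fourier_one]
    contrapose hi
    exact AddCircle.injective_toCircle Real.two_pi_pos.ne' (Circle.coe_injective hi)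
  rw [← hA]
  exact congr_arg (Subalgebra.toSubmodule <| StarSubalgebra.toSubalgebra ·)
    (ContinuousMap.starSubalgebra_topologicalClosure_eq_top_of_separatesPoints A hsep)

/-- The mass `(2π)^d` of the torus. -/
noncomputable def mass (d : ℕ) : ℝ := (2 * Real.pi) ^ d

lemma mass_pos (d : ℕ) : 0 < mass d := pow_pos Real.two_pi_pos d

/-- The complex Hilbert space `L²(𝕋^d; ℂ)`. -/
abbrev CL2 (d : ℕ) : Type := Lp ℂ 2 (volume : Measure (Torus d))

/-- `e^{i n·x}` as an element of `L²(𝕋^d; ℂ)`, normalized. -/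
noncomputable def expLp (n : Fin d → ℤ) : CL2 d :=
  ((Real.sqrt (mass d))⁻¹ : ℂ) • ContinuousMap.toLp (E := ℂ) 2 volume ℂ (expMode n)

lemma orthonormal_expLp : Orthonormal ℂ (expLp (d := d)) := by
  rw [orthonormal_iff_ite]
  intro m n
  rw [expLp, expLp, inner_smul_left, inner_smul_right, ContinuousMap.inner_toLp]
  simp only [← expMode_neg, ← expMode_add]
  rw [integral_expMode]
  have h1 : ((Real.sqrt (mass d) : ℝ) : ℂ) * (Real.sqrt (mass d) : ℝ) = (2 * Real.pi : ℝ) ^ d := by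
    rw [← Complex.ofReal_mul, Real.mul_self_sqrt (mass_pos d).le]
    simp [mass]
  have h2 : ((Real.sqrt (mass d) : ℝ) : ℂ) ≠ 0 := by
    simpa using (Real.sqrt_pos.2 (mass_pos d)).ne'
  by_cases h : m = n
  · subst h
    simp only [add_neg_cancel, if_true]
    rw [← h1]
    simp
    field_simp
  · rw [if_neg h, if_neg (fun h' => h (by rw [add_neg_eq_zero] at h'; exact h'.symm))]
    simp

/-- The Hilbert basis of `L²(𝕋^d; ℂ)` formed by the normalized exponentials. -/
noncomputable def expBasis (d : ℕ) : HilbertBasis (Fin d → ℤ) ℂ (CL2 d) :=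
  HilbertBasis.mk orthonormal_expLp (by
    have h : (Submodule.span ℂ (range fun n : Fin d → ℤ =>
        ContinuousMap.toLp (E := ℂ) 2 volume ℂ (expMode n))).topologicalClosure = ⊤ := by
      simpa only [Submodule.map_span, ContinuousLinearMap.coe_coe, ← range_comp,
        Function.comp_def] using
        (ContinuousMap.toLp_denseRange ℂ (volume : Measure (Torus d)) ℂ
          (p := 2) (by simp)).topologicalClosure_map_submodule
          span_expMode_closure_eq_top
    rw [← h]
    refine Submodule.topologicalClosure_mono (Submodule.span_le.2 ?_)
    rintro _ ⟨n, rfl⟩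
    have h2 : ((Real.sqrt (mass d) : ℝ) : ℂ) ≠ 0 := by
      simpa using (Real.sqrt_pos.2 (mass_pos d)).ne'
    have : ContinuousMap.toLp (E := ℂ) 2 volume ℂ (expMode n) =
        ((Real.sqrt (mass d) : ℝ) : ℂ) • expLp n := by
      rw [expLp, smul_smul, mul_inv_cancel₀ h2, one_smul]
    simp only [this]
    exact Submodule.smul_mem _ _ (Submodule.subset_span ⟨n, rfl⟩))

lemma coe_expBasis : ⇑(expBasis d) = expLp := HilbertBasis.coe_mk _ _

/-- A real function regarded as a complex one. -/
noncomputable def toComplex (d : ℕ) : L2 d →L[ℝ] CL2 d :=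
  Complex.ofRealCLM.compLpL 2 volume

lemma coeFn_toComplex (f : L2 d) : toComplex d f =ᵐ[volume] fun x => (f x : ℂ) :=
  ContinuousLinearMap.coeFn_compLpL _ f

/-- The Fourier coefficient `c_n`, as a continuous linear functional. -/
noncomputable def coef (n : Fin d → ℤ) : L2 d →L[ℝ] ℂ :=
  ((Real.sqrt (mass d))⁻¹ : ℂ) • ((innerSL ℂ (expLp n)).restrictScalars ℝ ∘L toComplex d)

lemma coef_eq_repr (n : Fin d → ℤ) (f : L2 d) :
    coef n f = ((Real.sqrt (mass d))⁻¹ : ℂ) * (expBasis d).repr (toComplex d f) n := by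
  rw [HilbertBasis.repr_apply_apply, coe_expBasis]
  rfl

lemma fourierCoef_congr {f g : Torus d → ℝ} (h : f =ᵐ[volume] g) : fourierCoef f = fourierCoef g := by
  funext n
  unfold fourierCoef
  congr 1
  refine integral_congr_ae ?_
  filter_upwards [h] with x hx
  rw [hx]

lemma fourierCoef_eq (f : L2 d) (n : Fin d → ℤ) : fourierCoef f n = coef n f := by
  have h1 : ((Real.sqrt (mass d) : ℝ) : ℂ) * (Real.sqrt (mass d) : ℝ) = (2 * Real.pi : ℝ) ^ d := by
    rw [← Complex.ofReal_mul, Real.mul_self_sqrt (mass_pos d).le]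
    simp [mass]
  change _ = ((Real.sqrt (mass d))⁻¹ : ℂ) * inner ℂ (expLp n) (toComplex d f)
  rw [expLp, inner_smul_left, ← mul_assoc, fourierCoef, ← h1, MeasureTheory.L2.inner_def]
  congr 1
  · simp
  · refine integral_congr_ae ?_
    filter_upwards [coeFn_toComplex f,
      ContinuousMap.coeFn_toLp (p := 2) (𝕜 := ℂ) volume (expMode n)] with x h1 h2
    rw [h1, h2, RCLike.inner_apply, ← expMode_neg]
    rfl

lemma coef_zero_eq_integral (f : L2 d) : coef 0 f = ((mass d)⁻¹ * ∫ x, f x : ℝ) := by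
  rw [← fourierCoef_eq, fourierCoef]
  push_cast [mass]
  simp [integral_complex_ofReal]

lemma coef_neg (n : Fin d → ℤ) (f : L2 d) : coef (-n) f = conj (coef n f) := by
  rw [← fourierCoef_eq, ← fourierCoef_eq, fourierCoef, fourierCoef, map_mul, ← integral_conj]
  congr 1
  · rw [map_inv₀, map_pow, Complex.conj_ofReal]
  · congr 1
    funext x
    simp

/-- Parseval's identity for inner products. -/
lemma hasSum_coef_mul_coef (f g : L2 d) :
    HasSum (fun n => conj (coef n f) * coef n g) (((mass d)⁻¹ * ∫ x, f x * g x : ℝ) : ℂ) := by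
  have h := ((expBasis d).hasSum_inner_mul_inner (toComplex d f) (toComplex d g)).mul_left
    ((mass d : ℂ)⁻¹)
  have h1 : ((Real.sqrt (mass d) : ℝ) : ℂ) * (Real.sqrt (mass d) : ℝ) = mass d := by
    rw [← Complex.ofReal_mul, Real.mul_self_sqrt (mass_pos d).le]
  convert! h using 1
  · funext n
    rw [coef_eq_repr, coef_eq_repr, HilbertBasis.repr_apply_apply, HilbertBasis.repr_apply_apply,
      map_mul, inner_conj_symm, ← h1]
    simp only [map_inv₀, Complex.conj_ofReal, mul_inv]
    ring
  · push_cast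
    congr 1
    rw [MeasureTheory.L2.inner_def, ← integral_complex_ofReal]
    refine integral_congr_ae ?_
    filter_upwards [coeFn_toComplex f, coeFn_toComplex g] with x h1 h2
    rw [h1, h2, RCLike.inner_apply]
    simp [mul_comm]

/-- Parseval's identity. -/
lemma hasSum_sq_coef (f : L2 d) : HasSum (fun n => ‖coef n f‖ ^ 2) ((mass d)⁻¹ * ‖f‖ ^ 2) := by
  have h := hasSum_coef_mul_coef f f
  have h2 := Complex.hasSum_re h
  convert! h2 using 1
  · funext n
    rw [← Complex.normSq_eq_conj_mul_self, Complex.ofReal_re, Complex.normSq_eq_norm_sq]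
  · rw [Complex.ofReal_re, ← real_inner_self_eq_norm_sq, MeasureTheory.L2.inner_def]
    simp [sq]

lemma summable_sq_coef (f : L2 d) : Summable fun n => ‖coef n f‖ ^ 2 :=
  (hasSum_sq_coef f).summable

lemma norm_sq_eq_tsum (f : L2 d) : ‖f‖ ^ 2 = mass d * ∑' n, ‖coef n f‖ ^ 2 := by
  rw [(hasSum_sq_coef f).tsum_eq, mul_inv_cancel_left₀ (mass_pos d).ne']

lemma norm_le_of_coef_le {f g : L2 d} {K : ℝ} (hK : 0 ≤ K)
    (h : ∀ n, ‖coef n f‖ ≤ K * ‖coef n g‖) : ‖f‖ ≤ K * ‖g‖ := by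
  refine le_of_sq_le_sq ?_ (by positivity)
  rw [mul_pow, norm_sq_eq_tsum, norm_sq_eq_tsum, mul_left_comm]
  refine mul_le_mul_of_nonneg_left ?_ (mass_pos d).le
  rw [← tsum_mul_left]
  refine (summable_sq_coef f).tsum_le_tsum (fun n => ?_) ((summable_sq_coef g).mul_left _)
  rw [← mul_pow]
  exact pow_le_pow_left₀ (norm_nonneg _) (h n) 2

lemma ext_coef {f g : L2 d} (h : ∀ n, coef n f = coef n g) : f = g := by
  rw [← sub_eq_zero, ← norm_le_zero_iff]
  have := norm_le_of_coef_le (f := f - g) (g := 0) le_rfl (fun n => by simp [h n])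
  simpa using this

/-- A square summable sequence with `a_{-n} = conj a_n` is the sequence of Fourier coefficients of
a real function. -/
lemma exists_coef_eq (a : (Fin d → ℤ) → ℂ) (hsym : ∀ n, a (-n) = conj (a n))
    (ha : Summable fun n => ‖a n‖ ^ 2) : ∃ f : L2 d, ∀ n, coef n f = a n := by
  have hm : Memℓp (fun n => ((Real.sqrt (mass d) : ℝ) : ℂ) * a n) 2 := by
    rw [memℓp_gen_iff (by norm_num)]
    simp only [norm_mul, ENNReal.toReal_ofNat, Real.rpow_ofNat, mul_pow]
    exact ha.mul_left _
  set F : CL2 d := (expBasis d).repr.symm ⟨_, hm⟩ with hF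
  have hs : ((Real.sqrt (mass d) : ℝ) : ℂ) ≠ 0 := by
    simpa using (Real.sqrt_pos.2 (mass_pos d)).ne'
  have hint : ∀ n, (mass d : ℂ)⁻¹ * ∫ x, F x * expMode (-n) x = a n := by
    intro n
    have h1 : (expBasis d).repr F n = ((Real.sqrt (mass d) : ℝ) : ℂ) * a n := by
      rw [hF, LinearIsometryEquiv.apply_symm_apply]
    rw [HilbertBasis.repr_apply_apply, coe_expBasis, expLp, inner_smul_left,
      MeasureTheory.L2.inner_def] at h1
    have h2 : ∫ x, inner ℂ ((ContinuousMap.toLp (E := ℂ) 2 volume ℂ (expMode n)) x) (F x)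
        = ∫ x, F x * expMode (-n) x := by
      refine integral_congr_ae ?_
      filter_upwards [ContinuousMap.coeFn_toLp (p := 2) (𝕜 := ℂ) volume (expMode n)] with x h2
      rw [h2, RCLike.inner_apply, ← expMode_neg]
    rw [h2] at h1
    have h3 : ((Real.sqrt (mass d) : ℝ) : ℂ) * (Real.sqrt (mass d) : ℝ) = mass d := by
      rw [← Complex.ofReal_mul, Real.mul_self_sqrt (mass_pos d).le]
    simp only [map_inv₀, Complex.conj_ofReal] at h1
    rw [← h3, mul_inv, mul_assoc, h1, inv_mul_cancel_left₀ hs]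
  set f : L2 d := Complex.reCLM.compLpL 2 volume F with hf
  have hfF : ∀ᵐ x, f x = (F x).re := ContinuousLinearMap.coeFn_compLpL _ F
  have hFi : Integrable F := (Lp.memLp F).integrable (by norm_num)
  have hi : ∀ n : Fin d → ℤ, Integrable fun x => F x * expMode n x := fun n =>
    hFi.mul_bdd (c := 1) (expMode n).continuous.aestronglyMeasurable
      (Eventually.of_forall fun x => (norm_expMode_apply n x).le)
  have hi' : ∀ n : Fin d → ℤ, Integrable fun x => conj (F x) * expMode n x := by
    intro n
    have := (Complex.conjLIE.toContinuousLinearEquiv.toContinuousLinearMap).integrable_comp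
      (hi (-n))
    refine this.congr (Eventually.of_forall fun x => ?_)
    simp [expMode_neg]
  refine ⟨f, fun n => ?_⟩
  rw [← fourierCoef_eq]
  -- `c_n(Re F)` is the mean of `a_n` and of `conj a_{-n}`
  have h1 : fourierCoef f n = (mass d : ℂ)⁻¹ *
      ∫ x, (1 / 2 : ℂ) * (F x * expMode (-n) x + conj (F x) * expMode (-n) x) := by
    rw [fourierCoef]
    congr 1
    · simp [mass]
    · refine integral_congr_ae ?_
      filter_upwards [hfF] with x hx
      rw [hx, ← add_mul, Complex.add_conj]
      change _ * expMode (-n) x = _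
      push_cast
      ring
  have h2 : ∫ x, conj (F x) * expMode (-n) x = conj (∫ x, F x * expMode (- -n) x) := by
    rw [← integral_conj]
    simp [expMode_neg]
  rw [h1, integral_const_mul, integral_add (hi _) (hi' _), h2]
  have h3 := hint n
  have h4 := congrArg conj (hint (-n))
  rw [hsym, Complex.conj_conj, map_mul, map_inv₀, Complex.conj_ofReal] at h4
  linear_combination (1 / 2) * h3 + (1 / 2) * h4

/-- Convergence in `L²` from convergence of each Fourier coefficient, under a square summable
bound. -/
lemma tendsto_of_coef {ι : Type*} {l : Filter ι} {F : ι → L2 d} {f : L2 d} (b : (Fin d → ℤ) → ℝ)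
    (hb : Summable fun n => b n ^ 2) (hF : ∀ᶠ i in l, ∀ n, ‖coef n (F i)‖ ≤ b n)
    (hf : ∀ n, ‖coef n f‖ ≤ b n)
    (h : ∀ n, Tendsto (fun i => coef n (F i)) l (𝓝 (coef n f))) : Tendsto F l (𝓝 f) := by
  rw [tendsto_iff_norm_sub_tendsto_zero]
  have h1 : Tendsto (fun i => ∑' n, ‖coef n (F i - f)‖ ^ 2) l (𝓝 (∑' _ : Fin d → ℤ, 0)) := by
    refine tendsto_tsum_of_dominated_convergence (bound := fun n => 4 * b n ^ 2)
      (hb.mul_left _) (fun n => ?_) ?_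
    · have := ((h n).sub_const (coef n f)).norm.pow 2
      simpa using this
    · filter_upwards [hF] with i hi n
      have h2 : ‖coef n (F i - f)‖ ≤ 2 * b n := by
        rw [map_sub]
        exact (norm_sub_le _ _).trans (by linarith [hi n, hf n])
      rw [norm_pow, norm_norm]
      calc _ ≤ (2 * b n) ^ 2 := pow_le_pow_left₀ (norm_nonneg _) h2 2
        _ = _ := by ring
  have h2 : Tendsto (fun i => ‖F i - f‖ ^ 2) l (𝓝 0) := by
    simp_rw [norm_sq_eq_tsum]
    simpa using h1.const_mul (mass d)
  have h3 := (Real.continuous_sqrt.tendsto 0).comp h2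
  simpa [Function.comp_def, Real.sqrt_sq (norm_nonneg _)] using h3

/-- The Fourier series converges uniformly if its coefficients are summable. -/
lemma ae_eq_tsum_coef (f : L2 d) (hf : Summable fun n => ‖coef n f‖) :
    ∀ᵐ x, (f x : ℂ) = ∑' n, coef n f • expMode n x := by
  have hs : Summable fun n => coef n f • expMode n := by
    refine Summable.of_norm_bounded hf fun n => ?_
    refine (norm_smul_le _ _).trans (mul_le_of_le_one_right (norm_nonneg _) ?_)
    exact (ContinuousMap.norm_le _ zero_le_one).2 fun x => (norm_expMode_apply n x).le
  have h1 := (expBasis d).hasSum_repr (toComplex d f)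
  have h2 : HasSum (fun n => ContinuousMap.toLp (E := ℂ) 2 (volume : Measure (Torus d)) ℂ
      (coef n f • expMode n)) (toComplex d f) := by
    convert! h1 using 1
    funext n
    rw [coe_expBasis, expLp, map_smul, coef_eq_repr, smul_smul]
    congr 1
    exact mul_comm _ _
  have h3 := (ContinuousMap.toLp (E := ℂ) 2 (volume : Measure (Torus d)) ℂ).hasSum hs.hasSum
  have h4 := h2.unique h3
  filter_upwards [coeFn_toComplex f, ContinuousMap.coeFn_toLp (p := 2) (𝕜 := ℂ)
    (volume : Measure (Torus d)) (∑' n, coef n f • expMode n)] with x h5 h6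
  rw [← h5, h4, h6]
  exact (ContinuousMap.tsum_apply hs x).symm

/-- A function is bounded by the `ℓ¹` norm of its Fourier coefficients. -/
lemma abs_le_tsum_coef (f : L2 d) (hf : Summable fun n => ‖coef n f‖) :
    ∀ᵐ x, |f x| ≤ ∑' n, ‖coef n f‖ := by
  filter_upwards [ae_eq_tsum_coef f hf] with x h7
  have h8 : ∀ n : Fin d → ℤ, ‖coef n f • expMode n x‖ = ‖coef n f‖ := fun n => by
    rw [norm_smul, norm_expMode_apply, mul_one]
  calc |f x| = ‖(f x : ℂ)‖ := by simp
    _ ≤ ∑' n, ‖coef n f • expMode n x‖ := by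
        rw [h7]
        exact norm_tsum_le_tsum_norm (by simpa only [h8] using hf)
    _ = _ := by simp only [h8]

/-! ### Multiplication by continuous functions -/

/-- Multiplication of `L²` functions by a continuous function. -/
noncomputable def mulL (φ : C(Torus d, ℝ)) : L2 d →L[ℝ] L2 d :=
  (ContinuousLinearMap.mul ℝ ℝ).holderL volume ∞ 2 2 (ContinuousMap.toLp (E := ℝ) ∞ volume ℝ φ)

lemma coeFn_mulL (φ : C(Torus d, ℝ)) (f : L2 d) : ∀ᵐ x, mulL φ f x = φ x * f x := by
  filter_upwards [ContinuousLinearMap.coeFn_holder (r := 2) (ContinuousLinearMap.mul ℝ ℝ)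
    (ContinuousMap.toLp (E := ℝ) ∞ volume ℝ φ) f, ContinuousMap.coeFn_toLp (p := ∞) (𝕜 := ℝ)
    (volume : Measure (Torus d)) φ] with x h1 h2
  rw [← h2]
  exact h1

lemma mulL_add (φ ψ : C(Torus d, ℝ)) (f : L2 d) : mulL (φ + ψ) f = mulL φ f + mulL ψ f := by
  simp [mulL]

lemma mulL_smul (r : ℝ) (φ : C(Torus d, ℝ)) (f : L2 d) : mulL (r • φ) f = r • mulL φ f := by
  simp [mulL]

lemma mulL_mul (φ ψ : C(Torus d, ℝ)) (f : L2 d) : mulL (φ * ψ) f = mulL φ (mulL ψ f) := by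
  refine Lp.ext ?_
  filter_upwards [coeFn_mulL (φ * ψ) f, coeFn_mulL φ (mulL ψ f), coeFn_mulL ψ f] with x h1 h2 h3
  rw [h1, h2, h3, ContinuousMap.mul_apply, mul_assoc]

lemma mulL_one (f : L2 d) : mulL 1 f = f := by
  refine Lp.ext ?_
  filter_upwards [coeFn_mulL 1 f] with x h1
  simp [h1]

/-- `cos (n·x)`, the real part of `e^{i n·x}`. -/
noncomputable def cosMode (n : Fin d → ℤ) : C(Torus d, ℝ) where
  toFun x := (expMode n x).re

/-- `sin (n·x)`, the imaginary part of `e^{i n·x}`. -/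
noncomputable def sinMode (n : Fin d → ℤ) : C(Torus d, ℝ) where
  toFun x := (expMode n x).im

lemma coef_mulL (φ : C(Torus d, ℝ)) (f : L2 d) (n : Fin d → ℤ) :
    coef n (mulL φ f) = (mass d : ℂ)⁻¹ * ∫ x, (φ x * f x : ℂ) * expMode (-n) x := by
  rw [← fourierCoef_eq, fourierCoef]
  congr 1
  · simp [mass]
  · refine integral_congr_ae ?_
    filter_upwards [coeFn_mulL φ f] with x h1
    rw [h1]
    push_cast
    rfl

lemma integrable_mul_expMode (f : L2 d) (n : Fin d → ℤ) :
    Integrable fun x => (f x : ℂ) * expMode n x :=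
  (((Lp.memLp f).integrable (by norm_num)).ofReal).mul_bdd (c := 1)
    (expMode n).continuous.aestronglyMeasurable
    (Eventually.of_forall fun x => (norm_expMode_apply n x).le)

lemma coef_eq_integral (f : L2 d) (n : Fin d → ℤ) :
    coef n f = (mass d : ℂ)⁻¹ * ∫ x, (f x : ℂ) * expMode (-n) x := by
  rw [← fourierCoef_eq, fourierCoef]
  congr 1
  simp [mass]

lemma coef_cosMode (m n : Fin d → ℤ) (f : L2 d) :
    coef n (mulL (cosMode m) f) = (coef (n - m) f + coef (n + m) f) / 2 := by
  rw [coef_mulL, coef_eq_integral, coef_eq_integral, ← mul_add, ← integral_add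
    (integrable_mul_expMode _ _) (integrable_mul_expMode _ _), mul_div_assoc, ← integral_div]
  congr 1
  congr 1
  funext x
  have h : ((cosMode m x : ℝ) : ℂ) = (expMode m x + expMode (-m) x) / 2 := by
    rw [expMode_neg, Complex.add_conj]
    simp [cosMode]
  rw [h, show -(n - m) = m + -n by abel, show -(n + m) = -m + -n by abel, expMode_add m,
    expMode_add (-m)]
  ring

lemma coef_sinMode (m n : Fin d → ℤ) (f : L2 d) :
    coef n (mulL (sinMode m) f) = (coef (n - m) f - coef (n + m) f) / (2 * Complex.I) := by
  rw [coef_mulL, coef_eq_integral, coef_eq_integral, ← mul_sub, ← integral_sub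
    (integrable_mul_expMode _ _) (integrable_mul_expMode _ _), mul_div_assoc, ← integral_div]
  congr 1
  congr 1
  funext x
  have h : ((sinMode m x : ℝ) : ℂ) = (expMode m x - expMode (-m) x) / (2 * Complex.I) := by
    rw [expMode_neg, Complex.sub_conj]
    simp only [sinMode, ContinuousMap.coe_mk]
    push_cast
    field_simp
  rw [h, show -(n - m) = m + -n by abel, show -(n + m) = -m + -n by abel, expMode_add m,
    expMode_add (-m)]
  ring

lemma cosMode_add (m n : Fin d → ℤ) :
    cosMode (m + n) = cosMode m * cosMode n - sinMode m * sinMode n := by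
  ext x
  simp [cosMode, sinMode, expMode_add, Complex.mul_re]

lemma sinMode_add (m n : Fin d → ℤ) :
    sinMode (m + n) = cosMode m * sinMode n + sinMode m * cosMode n := by
  ext x
  simp [cosMode, sinMode, expMode_add, Complex.mul_im]

lemma cosMode_neg (n : Fin d → ℤ) : cosMode (-n) = cosMode n := by
  ext x
  simp [cosMode, expMode_neg]

lemma sinMode_neg (n : Fin d → ℤ) : sinMode (-n) = -sinMode n := by
  ext x
  simp [sinMode, expMode_neg]

lemma cosMode_zero : cosMode (0 : Fin d → ℤ) = 1 := by
  ext x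
  simp [cosMode, expMode_zero]

lemma sinMode_zero : sinMode (0 : Fin d → ℤ) = 0 := by
  ext x
  simp [sinMode, expMode_zero]

lemma cosMode_sq_add_sinMode_sq (n : Fin d → ℤ) :
    cosMode n * cosMode n + sinMode n * sinMode n = 1 := by
  ext x
  have h := norm_expMode_apply n x
  rw [← sq_eq_sq₀ (norm_nonneg _) zero_le_one, ← Complex.normSq_eq_norm_sq,
    Complex.normSq_apply] at h
  simpa [cosMode, sinMode] using h

lemma angle_cos_sin_eq (y : AddCircle (2 * Real.pi)) :
    Real.Angle.cos y = (fourier 1 y : ℂ).re ∧ Real.Angle.sin y = (fourier 1 y : ℂ).im := by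
  induction y using QuotientAddGroup.induction_on with
  | H z =>
    have h : (fourier 1 ((z : ℝ) : AddCircle (2 * Real.pi)) : ℂ) = Complex.exp (z * Complex.I) := by
      rw [fourier_coe_apply]
      congr 1
      have : (Real.pi : ℂ) ≠ 0 := by simp [Real.pi_ne_zero]
      push_cast
      field_simp
    constructor
    · refine (Real.Angle.cos_coe z).trans ?_
      rw [h, Complex.exp_ofReal_mul_I_re]
    · refine (Real.Angle.sin_coe z).trans ?_
      rw [h, Complex.exp_ofReal_mul_I_im]

lemma cosMode_single (j : Fin d) (x : Torus d) :
    cosMode (Pi.single j 1) x = Real.Angle.cos (x j) := by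
  rw [(angle_cos_sin_eq (x j)).1, ← expMode_single]
  rfl

lemma sinMode_single (j : Fin d) (x : Torus d) :
    sinMode (Pi.single j 1) x = Real.Angle.sin (x j) := by
  rw [(angle_cos_sin_eq (x j)).2, ← expMode_single]
  rfl

/-! ### Fourier multipliers -/

/-- A bounded even real symbol; evenness makes the multiplier preserve real functions. -/
def IsSymbol (m : (Fin d → ℤ) → ℝ) : Prop := (∀ n, m (-n) = m n) ∧ ∃ K, ∀ n, |m n| ≤ K

lemma exists_mult {m : (Fin d → ℤ) → ℝ} (hm : IsSymbol m) (f : L2 d) :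
    ∃ g : L2 d, ∀ n, coef n g = m n * coef n f := by
  obtain ⟨heven, K, hK⟩ := hm
  refine exists_coef_eq _ (fun n => ?_) ?_
  · rw [coef_neg, heven, map_mul, Complex.conj_ofReal]
  · refine Summable.of_nonneg_of_le (fun n => by positivity) (fun n => ?_)
      ((summable_sq_coef f).mul_left (K ^ 2))
    rw [norm_mul, mul_pow, Complex.norm_real, Real.norm_eq_abs]
    exact mul_le_mul_of_nonneg_right (pow_le_pow_left₀ (abs_nonneg _) (hK n) 2) (by positivity)

open Classical in
/-- The Fourier multiplier with symbol `m`, for `m` bounded and even; zero for other `m`. -/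
noncomputable def mult (m : (Fin d → ℤ) → ℝ) : L2 d →L[ℝ] L2 d :=
  if hm : IsSymbol m then
    LinearMap.mkContinuous
      { toFun := fun f => (exists_mult hm f).choose
        map_add' := fun f g => ext_coef fun n => by
          rw [map_add, (exists_mult hm _).choose_spec, (exists_mult hm _).choose_spec,
            (exists_mult hm _).choose_spec, map_add, mul_add]
        map_smul' := fun r f => ext_coef fun n => by
          rw [RingHom.id_apply, map_smul, (exists_mult hm _).choose_spec,
            (exists_mult hm _).choose_spec, map_smul, Complex.real_smul, Complex.real_smul]
          ring }
      hm.2.choose (fun f => norm_le_of_coef_le ((abs_nonneg _).trans (hm.2.choose_spec 0))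
        fun n => by
          change ‖coef n (exists_mult hm f).choose‖ ≤ _
          rw [(exists_mult hm _).choose_spec, norm_mul, Complex.norm_real, Real.norm_eq_abs]
          exact mul_le_mul_of_nonneg_right (hm.2.choose_spec n) (norm_nonneg _))
  else 0

lemma coef_mult {m : (Fin d → ℤ) → ℝ} (hm : IsSymbol m) (f : L2 d) (n : Fin d → ℤ) :
    coef n (mult m f) = m n * coef n f := by
  rw [mult, dif_pos hm]
  exact (exists_mult hm f).choose_spec n

lemma norm_mult_le {m : (Fin d → ℤ) → ℝ} (hm : IsSymbol m) {K : ℝ} (hK : ∀ n, |m n| ≤ K)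
    (f : L2 d) : ‖mult m f‖ ≤ K * ‖f‖ :=
  norm_le_of_coef_le ((abs_nonneg _).trans (hK 0)) fun n => by
    rw [coef_mult hm, norm_mul, Complex.norm_real, Real.norm_eq_abs]
    exact mul_le_mul_of_nonneg_right (hK n) (norm_nonneg _)

/-- A curve in `L²` is differentiable if its Fourier coefficients are, with derivatives dominated
by a square summable sequence. -/
lemma hasDerivAt_of_coef {F F' : ℝ → L2 d} {t₀ : ℝ} (b : (Fin d → ℤ) → ℝ)
    (hb : Summable fun n => b n ^ 2)
    (hF : ∀ n t, HasDerivAt (fun t => coef n (F t)) (coef n (F' t)) t)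
    (hF' : ∀ t ∈ Metric.ball t₀ 1, ∀ n, ‖coef n (F' t)‖ ≤ b n) :
    HasDerivAt F (F' t₀) t₀ := by
  rw [hasDerivAt_iff_tendsto_slope]
  refine tendsto_of_coef b hb ?_ (hF' t₀ (Metric.mem_ball_self one_pos)) (fun n => ?_)
  · have : ∀ᶠ t in 𝓝[≠] t₀, t ∈ Metric.ball t₀ 1 :=
      mem_nhdsWithin_of_mem_nhds (Metric.ball_mem_nhds _ one_pos)
    filter_upwards [this, self_mem_nhdsWithin] with t ht hne n
    have h1 := (convex_ball t₀ 1).norm_image_sub_le_of_norm_hasDerivWithin_le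
      (f := fun t => coef n (F t)) (fun x _ => (hF n x).hasDerivWithinAt)
      (fun x hx => hF' x hx n) (Metric.mem_ball_self one_pos) ht
    have h2 : 0 < ‖t - t₀‖ := norm_pos_iff.2 (sub_ne_zero.2 hne)
    rw [slope_def_module, map_smul, map_sub, norm_smul, norm_inv]
    rw [inv_mul_le_iff₀ h2]
    exact h1.trans_eq (mul_comm _ _)
  · have := hasDerivAt_iff_tendsto_slope.1 (hF n t₀)
    refine this.congr fun t => ?_
    rw [slope_def_module, slope_def_module, map_smul, map_sub]

/-! ### Sobolev norms -/

lemma one_le_japaneseSq (n : Fin d → ℤ) : 1 ≤ japaneseSq n := by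
  have : 0 ≤ ∑ i, (n i : ℝ) ^ 2 := Finset.sum_nonneg fun i _ => sq_nonneg _
  simp only [japaneseSq]
  linarith

lemma japaneseSq_neg (n : Fin d → ℤ) : japaneseSq (-n) = japaneseSq n := by
  simp [japaneseSq]

/-- `⟨n⟩ = (1 + |n|²)^{1/2}`. -/
noncomputable def jap (n : Fin d → ℤ) : ℝ := Real.sqrt (japaneseSq n)

lemma one_le_jap (n : Fin d → ℤ) : 1 ≤ jap n := Real.one_le_sqrt.2 (one_le_japaneseSq n)

lemma jap_pos (n : Fin d → ℤ) : 0 < jap n := one_pos.trans_le (one_le_jap n)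

lemma jap_ne_zero (n : Fin d → ℤ) : (jap n : ℂ) ≠ 0 := by exact_mod_cast (jap_pos n).ne'

lemma jap_sq (n : Fin d → ℤ) : jap n ^ 2 = japaneseSq n :=
  Real.sq_sqrt (zero_le_one.trans (one_le_japaneseSq n))

lemma jap_neg (n : Fin d → ℤ) : jap (-n) = jap n := by rw [jap, jap, japaneseSq_neg]

lemma isSymbol_inv_jap : IsSymbol fun n : Fin d → ℤ => (jap n)⁻¹ :=
  ⟨fun n => by simp only [jap_neg], 1, fun n => by
    rw [abs_of_pos (inv_pos.2 (jap_pos n))]; exact inv_le_one_of_one_le₀ (one_le_jap n)⟩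

/-- The operator `(1 - Δ)^{-1/2}`, an isometry of `L²` onto `H^1`. -/
noncomputable def smoothing (d : ℕ) : L2 d →L[ℝ] L2 d := mult fun n => (jap n)⁻¹

lemma coef_smoothing (f : L2 d) (n : Fin d → ℤ) :
    coef n (smoothing d f) = (jap n : ℂ)⁻¹ * coef n f := by
  rw [smoothing, coef_mult isSymbol_inv_jap, Complex.ofReal_inv]

lemma sobolevENorm_eq {s : ℝ} {q : (Fin d → ℤ) → ℂ} {f : L2 d}
    (h : ∀ n, japaneseSq n ^ s * ‖q n‖ ^ 2 = ‖coef n f‖ ^ 2) : sobolevENorm s q = ‖f‖ₑ := by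
  rw [sobolevENorm]
  simp_rw [h]
  rw [← ENNReal.ofReal_tsum_of_nonneg (fun n => by positivity) (summable_sq_coef f),
    ← mass, ← ENNReal.ofReal_mul (mass_pos d).le, ← norm_sq_eq_tsum,
    ENNReal.ofReal_rpow_of_nonneg (by positivity) (by norm_num), ← Real.sqrt_eq_rpow, Real.sqrt_sq (norm_nonneg _), ofReal_norm]

lemma sobolevENorm_one_smoothing (f : L2 d) :
    sobolevENorm 1 (fourierCoef (smoothing d f)) = ‖f‖ₑ := by
  refine sobolevENorm_eq fun n => ?_
  rw [fourierCoef_eq, coef_smoothing, Real.rpow_one, ← jap_sq, norm_mul, norm_inv,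
    Complex.norm_real, Real.norm_of_nonneg (jap_pos n).le]
  have := (jap_pos n).ne'
  field_simp

lemma memSobolev_smoothing (f : L2 d) : MemSobolev 1 (smoothing d f) := by
  rw [MemSobolev, sobolevENorm_one_smoothing]
  exact enorm_lt_top

lemma summable_of_memSobolev {s : ℝ} {f : L2 d} (h : MemSobolev s f) :
    Summable fun n => japaneseSq n ^ s * ‖coef n f‖ ^ 2 := by
  rw [MemSobolev, sobolevENorm] at h
  have h1 := (ENNReal.rpow_lt_top_iff_of_pos (by norm_num : (0 : ℝ) < 1 / 2)).1 h
  have h2 := ENNReal.lt_top_of_mul_ne_top_right h1.ne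
    (by simpa using pow_pos Real.two_pi_pos d)
  have h3 := ENNReal.summable_toReal h2.ne
  refine h3.congr fun n => ?_
  rw [ENNReal.toReal_ofReal, fourierCoef_eq]
  exact mul_nonneg (Real.rpow_nonneg (zero_le_one.trans (one_le_japaneseSq n)) _) (by positivity)

lemma exists_smoothing_eq {w : L2 d} (hw : MemSobolev 1 w) : ∃ a, smoothing d a = w := by
  have h := summable_of_memSobolev hw
  obtain ⟨a, ha⟩ := exists_coef_eq (fun n => (jap n : ℂ) * coef n w) (fun n => by
    rw [coef_neg, jap_neg, map_mul, Complex.conj_ofReal]) (h.congr fun n => by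
      rw [norm_mul, mul_pow, Complex.norm_real, Real.norm_eq_abs, sq_abs, jap_sq, Real.rpow_one])
  refine ⟨a, ext_coef fun n => ?_⟩
  rw [coef_smoothing, ha, inv_mul_cancel_left₀ (jap_ne_zero n)]

/-! ### Energy coordinates -/

/-- The space of the energy coordinates `((1 - Δ)^{1/2} w, ẇ)` of states `(w, ẇ)`; these are
arbitrary elements of `L² × L²`. -/
abbrev Phase (d : ℕ) : Type := L2 d × L2 d

/-- The state with energy coordinates `z`. -/
noncomputable def toState (z : Phase d) : L2 d × L2 d := (smoothing d z.1, z.2)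

lemma isState_toState (z : Phase d) : IsState (toState z) := memSobolev_smoothing z.1

lemma exists_toState_eq {W : L2 d × L2 d} (hW : IsState W) : ∃ z, toState z = W := by
  obtain ⟨a, ha⟩ := exists_smoothing_eq hW
  exact ⟨(a, W.2), by rw [toState, ha]⟩

lemma toState_sub (z z' : Phase d) : toState (z - z') = toState z - toState z' := by
  simp [toState]

lemma energyENorm_toState_le (z : Phase d) :
    energyENorm (toState z) ≤ ENNReal.ofReal (2 * ‖z‖) := by
  have h1 : ‖z.1‖ₑ ≤ ENNReal.ofReal ‖z‖ := by
    rw [← ofReal_norm]; exact ENNReal.ofReal_le_ofReal (norm_fst_le z)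
  have h2 : ‖z.2‖ₑ ≤ ENNReal.ofReal ‖z‖ := by
    rw [← ofReal_norm]; exact ENNReal.ofReal_le_ofReal (norm_snd_le z)
  rw [energyENorm, toState, sobolevENorm_one_smoothing]
  calc (‖z.1‖ₑ ^ 2 + ‖z.2‖ₑ ^ 2) ^ (1 / 2 : ℝ)
      ≤ (ENNReal.ofReal ((2 * ‖z‖) ^ 2)) ^ (1 / 2 : ℝ) := by
        refine ENNReal.rpow_le_rpow ?_ (by norm_num)
        calc ‖z.1‖ₑ ^ 2 + ‖z.2‖ₑ ^ 2 ≤ ENNReal.ofReal ‖z‖ ^ 2 + ENNReal.ofReal ‖z‖ ^ 2 := by gcongr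
          _ = ENNReal.ofReal (‖z‖ ^ 2 + ‖z‖ ^ 2) := by
            rw [ENNReal.ofReal_add (by positivity) (by positivity),
              ENNReal.ofReal_pow (norm_nonneg _)]
          _ ≤ _ := ENNReal.ofReal_le_ofReal (by nlinarith [norm_nonneg z])
    _ = _ := by
      rw [ENNReal.ofReal_rpow_of_nonneg (by positivity) (by norm_num), ← Real.sqrt_eq_rpow,
        Real.sqrt_sq (by positivity)]

/-- The potential as a continuous function. -/
noncomputable def pot (u : Fin (2 * d + 1) → ℝ) : C(Torus d, ℝ) :=
  u 0 • 1 + ∑ j : Fin d, (u ⟨2 * j.1 + 1, by omega⟩ • sinMode (Pi.single j 1)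
    + u ⟨2 * j.1 + 2, by omega⟩ • cosMode (Pi.single j 1))

lemma pot_apply (u : Fin (2 * d + 1) → ℝ) (x : Torus d) : pot u x = potential u x := by
  simp [pot, potential, ContinuousMap.sum_apply, cosMode_single, sinMode_single]

/-- `z` solves the control system on `[0, T]` in energy coordinates; both equations are smoothed by
`(1 - Δ)^{-1/2}`, so that they hold in `L²`. -/
def IsTraj (T : ℝ) (u : ℝ → Fin (2 * d + 1) → ℝ) (z : ℝ → Phase d) : Prop :=
  ContinuousOn z (Icc 0 T) ∧ ∃ S : Set ℝ, S.Finite ∧ ∀ t ∈ Ioo 0 T \ S,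
    HasDerivAt (fun s => smoothing d (z s).1) (z t).2 t ∧
    HasDerivAt (fun s => smoothing d (z s).2)
      (-(z t).1 + smoothing d (mulL (pot (u t)) (smoothing d (z t).1))) t

/-- Since `(1 - Δ)^{-1/2}` maps `H^{-1}` isometrically onto `L²`, the smoothed equations are the
original ones. -/
lemma IsTraj.isSolution {T : ℝ} {u : ℝ → Fin (2 * d + 1) → ℝ} {z : ℝ → Phase d}
    (h : IsTraj T u z) : IsSolution T u (toState (z 0)) (fun t => toState (z t)) where
  initial := rfl
  mem t _ := isState_toState _
  continuous t ht := by
    simp_rw [← toState_sub]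
    have h1 : Tendsto (fun s => ENNReal.ofReal (2 * ‖z s - z t‖)) (𝓝[Icc 0 T] t) (𝓝 0) := by
      have h2 : Tendsto (fun s => 2 * ‖z s - z t‖) (𝓝[Icc 0 T] t) (𝓝 0) := by
        simpa using ((tendsto_iff_norm_sub_tendsto_zero.1 (h.1 t ht)).const_mul 2)
      simpa using ENNReal.tendsto_ofReal h2
    exact tendsto_of_tendsto_of_tendsto_of_le_of_le tendsto_const_nhds h1 (fun _ => zero_le)
      (fun _ => energyENorm_toState_le _)
  equation := by
    obtain ⟨S, hS, hd⟩ := h.2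
    refine ⟨S, hS, fun t ht => ⟨(hd t ht).1, ?_⟩⟩
    have h1 := hasDerivAt_iff_tendsto_slope_zero.1 (hd t ht).2
    have h2 := tendsto_iff_norm_sub_tendsto_zero.1 h1
    have h3 := ENNReal.tendsto_ofReal h2
    rw [ENNReal.ofReal_zero] at h3
    refine h3.congr fun r => ?_
    rw [ofReal_norm]
    refine (sobolevENorm_eq fun n => ?_).symm
    have h4 : fourierCoef (fun x => potential (u t) x * (toState (z t)).1 x) n =
        coef n (mulL (pot (u t)) (smoothing d (z t).1)) := by
      rw [← fourierCoef_eq]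
      refine congrFun (fourierCoef_congr ?_) n
      filter_upwards [coeFn_mulL (pot (u t)) (smoothing d (z t).1)] with x hx
      rw [hx, pot_apply]
      rfl
    rw [forceCoef, h4, Real.rpow_neg_one, ← jap_sq]
    simp only [toState, fourierCoef_eq, map_sub, map_smul, map_add, map_neg, coef_smoothing,
      Complex.real_smul]
    have h5 : ((r⁻¹ : ℝ) : ℂ) * ((jap n : ℂ)⁻¹ * coef n (z (t + r)).2
        - (jap n : ℂ)⁻¹ * coef n (z t).2) - (-coef n (z t).1
          + (jap n : ℂ)⁻¹ * coef n (mulL (pot (u t)) (smoothing d (z t).1))) =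
        (jap n : ℂ)⁻¹ * ((r : ℂ)⁻¹ * (coef n (z (t + r)).2 - coef n (z t).2)
          - (-((jap n ^ 2 : ℝ) : ℂ) * ((jap n : ℂ)⁻¹ * coef n (z t).1)
            + coef n (mulL (pot (u t)) (smoothing d (z t).1)))) := by
      have := jap_ne_zero n
      push_cast
      field_simp
    rw [h5, norm_mul _ (_ - _), mul_pow, norm_inv, Complex.norm_real, Real.norm_eq_abs, inv_pow,
      sq_abs]

/-! ### Concatenation of controls and approximate steering -/

lemma isPiecewiseConstant_iff {E : Type*} {T : ℝ} {u : ℝ → E} :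
    IsPiecewiseConstant T u ↔ ∃ (m : ℕ) (τ : ℕ → ℝ), Monotone τ ∧ τ 0 = 0 ∧ τ m = T ∧
      ∀ i < m, ∃ v : E, ∀ t ∈ Ioo (τ i) (τ (i + 1)), u t = v := by
  constructor
  · rintro ⟨m, τ, hmono, h0, hT, h⟩
    refine ⟨m, fun i => τ ⟨min i m, by omega⟩, fun i j hij => hmono ?_, ?_, ?_, fun i hi => ?_⟩
    · exact Fin.mk_le_mk.2 (min_le_min_right m hij)
    · rw [← h0]; simp
    · rw [← hT]; simp [Fin.last]
    · obtain ⟨v, hv⟩ := h ⟨i, hi⟩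
      refine ⟨v, fun t ht => hv t ?_⟩
      convert! ht using 2
      · congr 1; ext; simp [hi.le]
      · congr 1; ext; simp; omega
  · rintro ⟨m, τ, hmono, h0, hT, h⟩
    exact ⟨m, fun i => τ i, fun i j hij => hmono hij, by simpa using h0, by simpa using hT,
      fun i => by simpa using h i i.2⟩

/-- The control equal to `u₁` up to time `T₁` and to `u₂`, started afresh, from then on. -/
noncomputable def concat {E : Type*} (T₁ : ℝ) (u₁ u₂ : ℝ → E) (t : ℝ) : E :=
  if t ≤ T₁ then u₁ t else u₂ (t - T₁)

lemma IsPiecewiseConstant.concat {E : Type*} {T₁ T₂ : ℝ} {u₁ u₂ : ℝ → E}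
    (h₁ : IsPiecewiseConstant T₁ u₁) (h₂ : IsPiecewiseConstant T₂ u₂) :
    IsPiecewiseConstant (T₁ + T₂) (concat T₁ u₁ u₂) := by
  rw [isPiecewiseConstant_iff] at *
  obtain ⟨m₁, τ₁, hm₁, h0₁, hT₁, hv₁⟩ := h₁
  obtain ⟨m₂, τ₂, hm₂, h0₂, hT₂, hv₂⟩ := h₂
  set τ : ℕ → ℝ := fun i => if i ≤ m₁ then τ₁ i else T₁ + τ₂ (i - m₁) with hτ
  have hge : ∀ i, m₁ ≤ i → τ i = T₁ + τ₂ (i - m₁) := by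
    intro i hi
    rcases hi.eq_or_lt with rfl | hi
    · simp [hτ, h0₂, hT₁]
    · simp [hτ, hi.not_ge]
  refine ⟨m₁ + m₂, τ, monotone_nat_of_le_succ fun i => ?_, by simp [hτ, h0₁], ?_, fun i hi => ?_⟩
  · rcases lt_or_ge i m₁ with h | h
    · simp only [hτ, h.le, Nat.succ_le_of_lt h, if_true]
      exact hm₁ (Nat.le_succ i)
    · rw [hge i h, hge (i + 1) (by omega)]
      gcongr
      exact hm₂ (by omega)
  · rw [hge _ (by omega), Nat.add_sub_cancel_left, hT₂]
  · rcases lt_or_ge i m₁ with h | h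
    · obtain ⟨v, hv⟩ := hv₁ i h
      refine ⟨v, fun t ht => ?_⟩
      simp only [hτ, h.le, Nat.succ_le_of_lt h, if_true] at ht
      have : t ≤ T₁ := ht.2.le.trans (hT₁ ▸ hm₁ h)
      rw [KleinGordon.concat, if_pos this]
      exact hv t ht
    · obtain ⟨v, hv⟩ := hv₂ (i - m₁) (by omega)
      refine ⟨v, fun t ht => ?_⟩
      rw [hge i h, hge (i + 1) (by omega), show i + 1 - m₁ = i - m₁ + 1 by omega] at ht
      have h0 : 0 ≤ τ₂ (i - m₁) := h0₂ ▸ hm₂ (Nat.zero_le _)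
      rw [KleinGordon.concat, if_neg (by linarith [ht.1])]
      exact hv _ ⟨by linarith [ht.1], by linarith [ht.2]⟩

lemma IsTraj.concat {T₁ T₂ : ℝ} (hT₁ : 0 ≤ T₁) (hT₂ : 0 ≤ T₂)
    {u₁ u₂ : ℝ → Fin (2 * d + 1) → ℝ} {z₁ z₂ : ℝ → Phase d} (h₁ : IsTraj T₁ u₁ z₁)
    (h₂ : IsTraj T₂ u₂ z₂) (h : z₂ 0 = z₁ T₁) :
    IsTraj (T₁ + T₂) (concat T₁ u₁ u₂) (concat T₁ z₁ z₂) := by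
  obtain ⟨hc₁, S₁, hS₁, hd₁⟩ := h₁
  obtain ⟨hc₂, S₂, hS₂, hd₂⟩ := h₂
  refine ⟨?_, S₁ ∪ ((fun t => T₁ + t) '' S₂ ∪ {T₁}), hS₁.union ((hS₂.image _).union
    (finite_singleton _)), ?_⟩
  · have e : Icc 0 (T₁ + T₂) = Icc 0 T₁ ∪ Icc T₁ (T₁ + T₂) :=
      (Icc_union_Icc_eq_Icc hT₁ (by linarith)).symm
    rw [e]
    refine ContinuousOn.union_of_isClosed ?_ ?_ isClosed_Icc isClosed_Icc
    · refine hc₁.congr fun t ht => ?_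
      rw [KleinGordon.concat, if_pos ht.2]
    · have h3 : ContinuousOn (fun t => z₂ (t - T₁)) (Icc T₁ (T₁ + T₂)) :=
        hc₂.comp (by fun_prop) (fun t ht => ⟨by linarith [ht.1], by linarith [ht.2]⟩)
      refine h3.congr fun t ht => ?_
      rw [KleinGordon.concat]
      split_ifs with h4
      · have : t = T₁ := le_antisymm h4 ht.1
        simp [this, h]
      · rfl
  · rintro t ⟨ht, hS⟩
    simp only [mem_union, mem_image, mem_singleton_iff, not_or, not_exists, not_and] at hS
    rcases lt_or_gt_of_ne hS.2.2 with hlt | hgt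
    · have hz : ∀ᶠ s in 𝓝 t, KleinGordon.concat T₁ z₁ z₂ s = z₁ s := by
        filter_upwards [Iio_mem_nhds hlt] with s hs
        rw [KleinGordon.concat, if_pos (le_of_lt hs)]
      obtain ⟨ha, hb⟩ := hd₁ t ⟨⟨ht.1, hlt⟩, hS.1⟩
      rw [hz.self_of_nhds, KleinGordon.concat, if_pos hlt.le]
      exact ⟨ha.congr_of_eventuallyEq (by filter_upwards [hz] with s hs; rw [hs]),
        hb.congr_of_eventuallyEq (by filter_upwards [hz] with s hs; rw [hs])⟩
    · have hz : ∀ᶠ s in 𝓝 t, KleinGordon.concat T₁ z₁ z₂ s = z₂ (s - T₁) := by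
        filter_upwards [Ioi_mem_nhds hgt] with s hs
        rw [KleinGordon.concat, if_neg (not_le.2 hs)]
      obtain ⟨ha, hb⟩ := hd₂ (t - T₁) ⟨⟨by linarith, by linarith [ht.2]⟩, fun hmem =>
        hS.2.1 _ hmem (by ring)⟩
      rw [hz.self_of_nhds, KleinGordon.concat, if_neg (not_le.2 hgt)]
      exact ⟨(ha.comp_sub_const t T₁).congr_of_eventuallyEq
          (by filter_upwards [hz] with s hs; rw [hs]),
        (hb.comp_sub_const t T₁).congr_of_eventuallyEq
          (by filter_upwards [hz] with s hs; rw [hs])⟩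

/-- `Φ` is the time-`T` map of the system for some piecewise constant control. -/
def IsFlow (T : ℝ) (Φ : Phase d → Phase d) : Prop :=
  ∃ u : ℝ → Fin (2 * d + 1) → ℝ, IsPiecewiseConstant T u ∧
    ∀ z₀, ∃ z : ℝ → Phase d, z 0 = z₀ ∧ z T = Φ z₀ ∧ IsTraj T u z

lemma IsFlow.comp {T₁ T₂ : ℝ} (hT₁ : 0 ≤ T₁) (hT₂ : 0 ≤ T₂) {Φ₁ Φ₂ : Phase d → Phase d}
    (h₁ : IsFlow T₁ Φ₁) (h₂ : IsFlow T₂ Φ₂) : IsFlow (T₁ + T₂) (Φ₂ ∘ Φ₁) := by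
  obtain ⟨u₁, hu₁, h₁⟩ := h₁
  obtain ⟨u₂, hu₂, h₂⟩ := h₂
  refine ⟨concat T₁ u₁ u₂, hu₁.concat hu₂, fun z₀ => ?_⟩
  obtain ⟨z₁, h01, hT1, ht1⟩ := h₁ z₀
  obtain ⟨z₂, h02, hT2, ht2⟩ := h₂ (Φ₁ z₀)
  refine ⟨concat T₁ z₁ z₂, ?_, ?_, ht1.concat hT₁ hT₂ ht2 (by rw [h02, hT1])⟩
  · rw [KleinGordon.concat, if_pos hT₁, h01]
  · rw [KleinGordon.concat]
    split_ifs with h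
    · have : T₂ = 0 := by linarith
      subst this
      rw [add_zero, hT1, Function.comp_apply, ← hT2, h02]
    · rw [add_sub_cancel_left, hT2, Function.comp_apply]

/-- In times arbitrarily close to `T` from above, the system can be steered from `z₀` arbitrarily
close to `z₁`, by a control whose flow is continuous in the initial state; the continuity makes the
relation transitive. -/
def ApproxSteer (T : ℝ) (z₀ z₁ : Phase d) : Prop :=
  ∀ ε : ℝ, 0 < ε → ∃ T₁ ∈ Icc T (T + ε), ∃ Φ : Phase d → Phase d, Continuous Φ ∧ IsFlow T₁ Φ ∧
    ‖Φ z₀ - z₁‖ < ε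

/-- Approximate steering in arbitrarily small time. -/
abbrev Reach (z₀ z₁ : Phase d) : Prop := ApproxSteer 0 z₀ z₁

lemma ApproxSteer.of_isFlow {T : ℝ} {Φ : Phase d → Phase d} (hΦ : Continuous Φ)
    (h : IsFlow T Φ) (z : Phase d) : ApproxSteer T z (Φ z) :=
  fun ε hε => ⟨T, ⟨le_rfl, by linarith⟩, Φ, hΦ, h, by simpa using hε⟩

lemma ApproxSteer.trans {T₁ T₂ : ℝ} (hT₁ : 0 ≤ T₁) (hT₂ : 0 ≤ T₂) {z₀ z₁ z₂ : Phase d}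
    (h₁ : ApproxSteer T₁ z₀ z₁) (h₂ : ApproxSteer T₂ z₁ z₂) : ApproxSteer (T₁ + T₂) z₀ z₂ := by
  intro ε hε
  obtain ⟨S₂, hS₂, Φ₂, hc₂, hf₂, hn₂⟩ := h₂ (ε / 2) (by positivity)
  obtain ⟨δ, hδ, hδ'⟩ := Metric.continuousAt_iff.1 (hc₂.continuousAt (x := z₁)) (ε / 2)
    (by positivity)
  obtain ⟨S₁, hS₁, Φ₁, hc₁, hf₁, hn₁⟩ := h₁ (min δ (ε / 2)) (by positivity)
  have h3 := min_le_right δ (ε / 2)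
  refine ⟨S₁ + S₂, ⟨by linarith [hS₁.1, hS₂.1], by linarith [hS₁.2, hS₂.2]⟩, Φ₂ ∘ Φ₁,
    hc₂.comp hc₁, hf₁.comp (hT₁.trans hS₁.1) (hT₂.trans hS₂.1) hf₂, ?_⟩
  have h4 : dist (Φ₂ (Φ₁ z₀)) (Φ₂ z₁) < ε / 2 :=
    hδ' (by rw [dist_eq_norm]; exact hn₁.trans_le (min_le_left _ _))
  rw [dist_eq_norm] at h4
  calc ‖Φ₂ (Φ₁ z₀) - z₂‖ = ‖(Φ₂ (Φ₁ z₀) - Φ₂ z₁) + (Φ₂ z₁ - z₂)‖ := by rw [sub_add_sub_cancel]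
    _ ≤ _ := norm_add_le _ _
    _ < ε := by linarith

lemma Reach.trans {z₀ z₁ z₂ : Phase d} (h₁ : Reach z₀ z₁) (h₂ : Reach z₁ z₂) : Reach z₀ z₂ := by
  simpa using ApproxSteer.trans le_rfl le_rfl h₁ h₂

lemma ApproxSteer.trans_reach {T : ℝ} (hT : 0 ≤ T) {z₀ z₁ z₂ : Phase d}
    (h₁ : ApproxSteer T z₀ z₁) (h₂ : Reach z₁ z₂) : ApproxSteer T z₀ z₂ := by
  simpa using h₁.trans hT le_rfl h₂

lemma Reach.trans_steer {T : ℝ} (hT : 0 ≤ T) {z₀ z₁ z₂ : Phase d}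
    (h₁ : Reach z₀ z₁) (h₂ : ApproxSteer T z₁ z₂) : ApproxSteer T z₀ z₂ := by
  simpa using ApproxSteer.trans le_rfl hT h₁ h₂

lemma ApproxSteer.of_tendsto {ι : Type*} {l : Filter ι} [l.NeBot] {T : ℝ} {t : ι → ℝ}
    {Z : ι → Phase d} {z₀ z₁ : Phase d} (ht : Tendsto t l (𝓝 T)) (hT : ∀ᶠ i in l, T ≤ t i)
    (h : ∀ᶠ i in l, ApproxSteer (t i) z₀ (Z i)) (hZ : Tendsto Z l (𝓝 z₁)) :
    ApproxSteer T z₀ z₁ := by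
  intro ε hε
  have h1 : ∀ᶠ i in l, t i < T + ε / 2 := ht.eventually_lt_const (by linarith)
  have h2 : ∀ᶠ i in l, ‖Z i - z₁‖ < ε / 2 :=
    (tendsto_iff_norm_sub_tendsto_zero.1 hZ).eventually_lt_const (by positivity)
  obtain ⟨i, hi, hTi, h1i, h2i⟩ := (h.and (hT.and (h1.and h2))).exists
  obtain ⟨S, hS, Φ, hc, hf, hn⟩ := hi (ε / 2) (by positivity)
  refine ⟨S, ⟨hTi.trans hS.1, by linarith [hS.2]⟩, Φ, hc, hf, ?_⟩
  calc ‖Φ z₀ - z₁‖ = ‖(Φ z₀ - Z i) + (Z i - z₁)‖ := by rw [sub_add_sub_cancel]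
    _ ≤ _ := norm_add_le _ _
    _ < ε := by linarith

lemma Reach.of_tendsto {ι : Type*} {l : Filter ι} [l.NeBot] {Z : ι → Phase d} {z₀ z₁ : Phase d}
    (h : ∀ᶠ i in l, Reach z₀ (Z i)) (hZ : Tendsto Z l (𝓝 z₁)) : Reach z₀ z₁ :=
  ApproxSteer.of_tendsto (t := fun _ => 0) tendsto_const_nhds
    (Eventually.of_forall fun _ => le_rfl) h hZ

lemma minTime_lt_top_of_approxSteer {T : ℝ} (hT : 0 ≤ T) {z₀ : Phase d}
    (h : ∀ z₁, ApproxSteer T z₀ z₁) : minTime (toState z₀) < ∞ := by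
  have hc : ApproxControllable T (toState z₀) := by
    intro Wf hWf ε hε
    obtain ⟨z₁, rfl⟩ := exists_toState_eq hWf
    obtain ⟨T₁, hT₁, Φ, -, ⟨u, hu, hz⟩, hn⟩ := h z₁ (ε / 2) (by positivity)
    obtain ⟨z, h0, h1, htraj⟩ := hz z₀
    refine ⟨T₁, ⟨hT₁.1, by linarith [hT₁.2]⟩, u, hu, fun t => toState (z t), ?_, ?_⟩
    · rw [← h0]
      exact htraj.isSolution
    · change energyENorm (toState (z T₁) - _) < _
      rw [h1, ← toState_sub]
      exact (energyENorm_toState_le _).trans_lt ((ENNReal.ofReal_lt_ofReal_iff hε).2 (by linarith))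
  refine lt_of_le_of_lt (iInf₂_le (⟨T, hT⟩ : ℝ≥0) hc) ENNReal.coe_lt_top

/-! ### Evolution under a constant potential -/

/-- The frequency `(⟨n⟩² - c)^{1/2}` of the mode `n` under the constant potential `c ≤ 1`. -/
noncomputable def freq (c : ℝ) (n : Fin d → ℤ) : ℝ := Real.sqrt (japaneseSq n - c)

/-- `sin (tω) / ω`, extended by `t` to `ω = 0`. -/
noncomputable def sinOver (t ω : ℝ) : ℝ := t * Real.sinc (t * ω)

lemma mul_sinOver (t ω : ℝ) : ω * sinOver t ω = Real.sin (t * ω) := by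
  rw [sinOver]
  by_cases h : t * ω = 0
  · rw [← mul_assoc, mul_comm ω t, h]; simp
  · rw [Real.sinc_of_ne_zero h, ← mul_assoc, mul_comm ω t, mul_div_cancel₀ _ h]

lemma hasDerivAt_sinOver (t ω : ℝ) : HasDerivAt (fun t => sinOver t ω) (Real.cos (t * ω)) t := by
  by_cases h : ω = 0
  · subst h
    simpa [sinOver] using hasDerivAt_id' t
  · have h1 : (fun t => sinOver t ω) = fun t => Real.sin (t * ω) / ω := by
      funext t
      rw [← mul_sinOver, mul_div_cancel_left₀ _ h]
    rw [h1]
    have h2 := (((hasDerivAt_id t).mul_const ω).sin).div_const ω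
    simpa [h] using h2

lemma abs_sinOver_le (t ω : ℝ) : |sinOver t ω| ≤ |t| := by
  rw [sinOver, abs_mul]
  exact mul_le_of_le_one_right (abs_nonneg _) (Real.abs_sinc_le_one _)

lemma freq_nonneg (c : ℝ) (n : Fin d → ℤ) : 0 ≤ freq c n := Real.sqrt_nonneg _

lemma freq_sq {c : ℝ} (hc : c ≤ 1) (n : Fin d → ℤ) : freq c n ^ 2 = jap n ^ 2 - c := by
  rw [freq, Real.sq_sqrt (by linarith [one_le_japaneseSq n]), jap_sq]

lemma freq_neg (c : ℝ) (n : Fin d → ℤ) : freq c (-n) = freq c n := by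
  rw [freq, freq, japaneseSq_neg]

lemma freq_zero (n : Fin d → ℤ) : freq 0 n = jap n := by rw [freq, jap, sub_zero]

lemma jap_mul_abs_sinOver_le {c : ℝ} (hc : c ≤ 1) (t : ℝ) (n : Fin d → ℤ) :
    jap n * |sinOver t (freq c n)| ≤ |t| + 1 := by
  have h1 : jap n ≤ 1 + freq c n := by
    refine le_of_sq_le_sq ?_ (by linarith [freq_nonneg c n])
    nlinarith [freq_sq hc n, freq_nonneg c n]
  have h2 : freq c n * |sinOver t (freq c n)| ≤ 1 := by
    rw [← abs_of_nonneg (freq_nonneg c n), ← abs_mul, abs_of_nonneg (freq_nonneg c n),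
      mul_sinOver]
    exact Real.abs_sin_le_one _
  nlinarith [abs_sinOver_le t (freq c n), abs_nonneg (sinOver t (freq c n))]

/-- The symbol of the diagonal entries of the propagator `evo`. -/
noncomputable def symC (c t : ℝ) (n : Fin d → ℤ) : ℝ := Real.cos (t * freq c n)

/-- The symbol of the entry of the propagator that sends the velocity to the position. -/
noncomputable def symS (c t : ℝ) (n : Fin d → ℤ) : ℝ := jap n * sinOver t (freq c n)

/-- The symbol of the entry of the propagator that sends the position to the velocity. -/
noncomputable def symD (c t : ℝ) (n : Fin d → ℤ) : ℝ :=
  -(freq c n ^ 2 * sinOver t (freq c n)) / jap n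

lemma symC_zero (t : ℝ) (n : Fin d → ℤ) : symC 0 t n = Real.cos (t * jap n) := by
  rw [symC, freq_zero]

lemma symS_zero (t : ℝ) (n : Fin d → ℤ) : symS 0 t n = Real.sin (t * jap n) := by
  rw [symS, freq_zero, mul_sinOver]

lemma symD_zero (t : ℝ) (n : Fin d → ℤ) : symD 0 t n = -Real.sin (t * jap n) := by
  rw [symD, freq_zero, ← mul_sinOver]
  have := (jap_pos n).ne'
  field_simp

lemma abs_symC_le (c t : ℝ) (n : Fin d → ℤ) : |symC c t n| ≤ 1 := Real.abs_cos_le_one _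

lemma abs_symS_le {c : ℝ} (hc : c ≤ 1) (t : ℝ) (n : Fin d → ℤ) : |symS c t n| ≤ |t| + 1 := by
  rw [symS, abs_mul, abs_of_pos (jap_pos n)]
  exact jap_mul_abs_sinOver_le hc t n

lemma freq_sq_le {c : ℝ} (hc : c ≤ 1) (n : Fin d → ℤ) :
    freq c n ^ 2 ≤ (1 + |c|) * jap n ^ 2 := by
  rw [freq_sq hc]
  have h1 : 1 ≤ jap n ^ 2 := one_le_pow₀ (one_le_jap n)
  nlinarith [neg_abs_le c, mul_nonneg (abs_nonneg c) (sub_nonneg.2 h1)]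

lemma abs_symD_le {c : ℝ} (hc : c ≤ 1) (t : ℝ) (n : Fin d → ℤ) :
    |symD c t n| ≤ (1 + |c|) * (|t| + 1) := by
  rw [symD, abs_div, abs_neg, abs_mul, abs_of_pos (jap_pos n), abs_of_nonneg (sq_nonneg _),
    div_le_iff₀ (jap_pos n)]
  calc freq c n ^ 2 * |sinOver t (freq c n)|
      ≤ (1 + |c|) * jap n ^ 2 * |sinOver t (freq c n)| := by
        gcongr
        exact freq_sq_le hc n
    _ = (1 + |c|) * (jap n * |sinOver t (freq c n)|) * jap n := by ring
    _ ≤ _ := by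
        have := (jap_pos n).le
        gcongr
        exact jap_mul_abs_sinOver_le hc t n

lemma isSymbol_symC (c t : ℝ) : IsSymbol (symC (d := d) c t) :=
  ⟨fun n => by rw [symC, symC, freq_neg], 1, abs_symC_le c t⟩

lemma isSymbol_symS {c : ℝ} (hc : c ≤ 1) (t : ℝ) : IsSymbol (symS (d := d) c t) :=
  ⟨fun n => by rw [symS, symS, freq_neg, jap_neg], _, abs_symS_le hc t⟩

lemma isSymbol_symD {c : ℝ} (hc : c ≤ 1) (t : ℝ) : IsSymbol (symD (d := d) c t) :=
  ⟨fun n => by rw [symD, symD, freq_neg, jap_neg], _, abs_symD_le hc t⟩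

/-- The propagator of `∂_t² w = (Δ - 1 + c) w`, for `c ≤ 1`, in energy coordinates. -/
noncomputable def evo (c t : ℝ) : Phase d →L[ℝ] Phase d :=
  (mult (symC c t) ∘L ContinuousLinearMap.fst ℝ _ _ +
    mult (symS c t) ∘L ContinuousLinearMap.snd ℝ _ _).prod
  (mult (symD c t) ∘L ContinuousLinearMap.fst ℝ _ _ +
    mult (symC c t) ∘L ContinuousLinearMap.snd ℝ _ _)

lemma evo_apply (c t : ℝ) (z : Phase d) : evo c t z =
    (mult (symC c t) z.1 + mult (symS c t) z.2, mult (symD c t) z.1 + mult (symC c t) z.2) := rfl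

lemma coef_evo_fst {c : ℝ} (hc : c ≤ 1) (t : ℝ) (z : Phase d) (n : Fin d → ℤ) :
    coef n (evo c t z).1 = symC c t n * coef n z.1 + symS c t n * coef n z.2 := by
  rw [evo_apply, map_add, coef_mult (isSymbol_symC c t), coef_mult (isSymbol_symS hc t)]

lemma coef_evo_snd {c : ℝ} (hc : c ≤ 1) (t : ℝ) (z : Phase d) (n : Fin d → ℤ) :
    coef n (evo c t z).2 = symD c t n * coef n z.1 + symC c t n * coef n z.2 := by
  rw [evo_apply, map_add, coef_mult (isSymbol_symD hc t), coef_mult (isSymbol_symC c t)]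

lemma hasDerivAt_symC {c : ℝ} (t : ℝ) (n : Fin d → ℤ) :
    HasDerivAt (fun t => symC c t n) (-(freq c n ^ 2 * sinOver t (freq c n))) t := by
  have h := ((hasDerivAt_id t).mul_const (freq c n)).cos
  convert! h using 1
  simp only [id, one_mul]
  rw [← mul_sinOver]
  ring

lemma hasDerivAt_symS {c : ℝ} (t : ℝ) (n : Fin d → ℤ) :
    HasDerivAt (fun t => symS c t n) (jap n * symC c t n) t :=
  (hasDerivAt_sinOver t (freq c n)).const_mul _

lemma hasDerivAt_symD {c : ℝ} (t : ℝ) (n : Fin d → ℤ) :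
    HasDerivAt (fun t => symD c t n) (-(freq c n ^ 2 * symC c t n) / jap n) t :=
  (((hasDerivAt_sinOver t (freq c n)).const_mul _).neg).div_const _

lemma norm_coef_add_le {m₁ m₂ K₁ K₂ : ℝ} (h₁ : |m₁| ≤ K₁) (h₂ : |m₂| ≤ K₂) (x y : ℂ) :
    ‖(m₁ : ℂ) * x + m₂ * y‖ ≤ K₁ * ‖x‖ + K₂ * ‖y‖ := by
  refine (norm_add_le _ _).trans (add_le_add ?_ ?_)
  · rw [norm_mul, Complex.norm_real]
    exact mul_le_mul_of_nonneg_right h₁ (norm_nonneg _)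
  · rw [norm_mul, Complex.norm_real]
    exact mul_le_mul_of_nonneg_right h₂ (norm_nonneg _)

lemma summable_dominating (K₁ K₂ : ℝ) (f g : L2 d) :
    Summable fun n => (K₁ * ‖coef n f‖ + K₂ * ‖coef n g‖) ^ 2 := by
  refine Summable.of_nonneg_of_le (fun n => sq_nonneg _) (fun n => ?_)
    (((summable_sq_coef f).mul_left (2 * K₁ ^ 2)).add
      ((summable_sq_coef g).mul_left (2 * K₂ ^ 2)))
  nlinarith [sq_nonneg (K₁ * ‖coef n f‖ - K₂ * ‖coef n g‖)]

lemma continuous_evo {c : ℝ} (hc : c ≤ 1) (z : Phase d) : Continuous fun t => evo c t z := by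
  rw [continuous_iff_continuousAt]
  intro t₀
  have hev : ∀ᶠ t in 𝓝 t₀, |t| < |t₀| + 1 :=
    continuous_abs.continuousAt.eventually_lt_const (by linarith)
  have hev₀ : |t₀| < |t₀| + 1 := by linarith
  refine ContinuousAt.prodMk (f := fun t => (evo c t z).1) (g := fun t => (evo c t z).2) ?_ ?_
  · have hb : ∀ t, |t| < |t₀| + 1 → ∀ n, ‖coef n (evo c t z).1‖ ≤
        1 * ‖coef n z.1‖ + (|t₀| + 2) * ‖coef n z.2‖ := fun t ht n => by
      rw [coef_evo_fst hc]
      exact norm_coef_add_le (abs_symC_le c t n) ((abs_symS_le hc t n).trans (by linarith)) _ _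
    refine tendsto_of_coef _ (summable_dominating 1 (|t₀| + 2) z.1 z.2) (hev.mono hb) (hb _ hev₀)
      fun n => ?_
    simp only [coef_evo_fst hc]
    have h1 := (hasDerivAt_symC (c := c) t₀ n).continuousAt.ofReal
    have h2 := (hasDerivAt_symS (c := c) t₀ n).continuousAt.ofReal
    exact (h1.mul_const _).add (h2.mul_const _)
  · have hb : ∀ t, |t| < |t₀| + 1 → ∀ n, ‖coef n (evo c t z).2‖ ≤
        (1 + |c|) * (|t₀| + 2) * ‖coef n z.1‖ + 1 * ‖coef n z.2‖ := fun t ht n => by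
      rw [coef_evo_snd hc]
      refine norm_coef_add_le ((abs_symD_le hc t n).trans ?_) (abs_symC_le c t n) _ _
      exact mul_le_mul_of_nonneg_left (by linarith) (by positivity)
    refine tendsto_of_coef _ (summable_dominating _ _ z.1 z.2) (hev.mono hb) (hb _ hev₀)
      fun n => ?_
    simp only [coef_evo_snd hc]
    have h1 := (hasDerivAt_symD (c := c) t₀ n).continuousAt.ofReal
    have h2 := (hasDerivAt_symC (c := c) t₀ n).continuousAt.ofReal
    exact (h1.mul_const _).add (h2.mul_const _)

lemma evo_zero {c : ℝ} (hc : c ≤ 1) (z : Phase d) : evo c 0 z = z := by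
  refine Prod.ext (ext_coef fun n => ?_) (ext_coef fun n => ?_)
  · rw [coef_evo_fst hc]; simp [symC, symS, sinOver]
  · rw [coef_evo_snd hc]; simp [symC, symD, sinOver]

lemma hasDerivAt_smoothing_evo_fst {c : ℝ} (hc : c ≤ 1) (z : Phase d) (t : ℝ) :
    HasDerivAt (fun t => smoothing d (evo c t z).1) (evo c t z).2 t := by
  refine hasDerivAt_of_coef (F' := fun t => (evo c t z).2) _
    (summable_dominating ((1 + |c|) * (|t| + 2)) 1 z.1 z.2) (fun n s => ?_) (fun s hs n => ?_)
  · simp only [coef_smoothing, coef_evo_fst hc, coef_evo_snd hc]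
    have h1 := ((hasDerivAt_symC (c := c) s n).ofReal_comp.mul_const (coef n z.1)).add
      ((hasDerivAt_symS (c := c) s n).ofReal_comp.mul_const (coef n z.2))
    convert! h1.const_mul ((jap n : ℂ)⁻¹) using 1
    have := jap_ne_zero n
    simp only [symD]
    push_cast
    field_simp
  · have h3 : |s| ≤ |t| + 1 := by
      rw [Metric.mem_ball, Real.dist_eq] at hs
      linarith [abs_sub_abs_le_abs_sub s t]
    rw [coef_evo_snd hc]
    refine norm_coef_add_le ((abs_symD_le hc s n).trans ?_) (abs_symC_le c s n) _ _
    exact mul_le_mul_of_nonneg_left (by linarith) (by positivity)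

lemma hasDerivAt_smoothing_evo_snd {c : ℝ} (hc : c ≤ 1) (z : Phase d) (t : ℝ) :
    HasDerivAt (fun t => smoothing d (evo c t z).2)
      (-(evo c t z).1 + smoothing d (c • smoothing d (evo c t z).1)) t := by
  refine hasDerivAt_of_coef
    (F' := fun t => -(evo c t z).1 + smoothing d (c • smoothing d (evo c t z).1)) _
    (summable_dominating (1 + |c|) ((1 + |c|) * (|t| + 2)) z.1 z.2) (fun n s => ?_)
    (fun s hs n => ?_)
  · simp only [coef_smoothing, map_add, map_neg, map_smul, coef_evo_fst hc, coef_evo_snd hc,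
      Complex.real_smul]
    have h1 := ((hasDerivAt_symD (c := c) s n).ofReal_comp.mul_const (coef n z.1)).add
      ((hasDerivAt_symC (c := c) s n).ofReal_comp.mul_const (coef n z.2))
    convert! h1.const_mul ((jap n : ℂ)⁻¹) using 1
    have := jap_ne_zero n
    simp only [symS, freq_sq hc]
    push_cast
    field_simp
    ring
  · have h3 : |s| ≤ |t| + 1 := by
      rw [Metric.mem_ball, Real.dist_eq] at hs
      linarith [abs_sub_abs_le_abs_sub s t]
    have h4 : coef n (-(evo c s z).1 + smoothing d (c • smoothing d (evo c s z).1)) =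
        ((-(freq c n ^ 2 / jap n ^ 2 * symC c s n) : ℝ) : ℂ) * coef n z.1
          + ((-(freq c n ^ 2 / jap n ^ 2 * symS c s n) : ℝ) : ℂ) * coef n z.2 := by
      simp only [coef_smoothing, map_add, map_neg, map_smul, coef_evo_fst hc, Complex.real_smul,
        freq_sq hc]
      have := jap_ne_zero n
      push_cast
      field_simp
      ring
    have h5 : |freq c n ^ 2 / jap n ^ 2| ≤ 1 + |c| := by
      have := jap_pos n
      rw [abs_of_nonneg (by positivity), div_le_iff₀ (by positivity)]
      exact freq_sq_le hc n
    rw [h4]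
    refine norm_coef_add_le ?_ ?_ _ _
    · rw [abs_neg, abs_mul, ← mul_one (1 + |c|)]
      exact mul_le_mul h5 (abs_symC_le c s n) (abs_nonneg _) (by positivity)
    · rw [abs_neg, abs_mul]
      exact mul_le_mul h5 ((abs_symS_le hc s n).trans (by linarith)) (abs_nonneg _)
        (by positivity)

lemma isPiecewiseConstant_const {E : Type*} {T : ℝ} (hT : 0 ≤ T) (v : E) :
    IsPiecewiseConstant T fun _ => v :=
  isPiecewiseConstant_iff.2 ⟨1, fun i => if i = 0 then 0 else T, fun i j hij => by
    by_cases hi : i = 0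
    · by_cases hj : j = 0 <;> simp [hi, hj, hT]
    · have hj : j ≠ 0 := by omega
      simp [hi, hj], by simp, by simp, fun _ _ => ⟨v, fun _ _ => rfl⟩⟩

lemma isFlow_evo {c : ℝ} (hc : c ≤ 1) {T : ℝ} (hT : 0 ≤ T) : IsFlow T (evo (d := d) c T) := by
  refine ⟨fun _ => Pi.single 0 c, isPiecewiseConstant_const hT _, fun z₀ => ⟨fun t => evo c t z₀,
    evo_zero hc z₀, rfl, (continuous_evo hc z₀).continuousOn, ∅, finite_empty, fun t _ =>
    ⟨hasDerivAt_smoothing_evo_fst hc z₀ t, ?_⟩⟩⟩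
  have h : pot (Pi.single 0 c : Fin (2 * d + 1) → ℝ) = c • 1 := by
    simp [pot, Fin.ext_iff]
  rw [h, mulL_smul, mulL_one]
  exact hasDerivAt_smoothing_evo_snd hc z₀ t

lemma approxSteer_evo {c : ℝ} (hc : c ≤ 1) {T : ℝ} (hT : 0 ≤ T) (z : Phase d) :
    ApproxSteer T z (evo c T z) :=
  .of_isFlow (evo c T).continuous (isFlow_evo hc hT) z

/-! ### Momentum kicks -/

/-- The perturbation `(w, ẇ) ↦ (0, φ w)` in energy coordinates. -/
noncomputable def pert (φ : C(Torus d, ℝ)) : Phase d →L[ℝ] Phase d :=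
  (0 : Phase d →L[ℝ] L2 d).prod (mulL φ ∘L smoothing d ∘L ContinuousLinearMap.fst ℝ _ _)

lemma pert_apply (φ : C(Torus d, ℝ)) (z : Phase d) :
    pert φ z = (0, mulL φ (smoothing d z.1)) := rfl

lemma pert_smul (r : ℝ) (φ : C(Torus d, ℝ)) : pert (r • φ) = r • pert φ := by
  ext z <;> simp [pert_apply, mulL_smul]

/-- The kick `(w, ẇ) ↦ (w, ẇ + φ w)` in energy coordinates. -/
noncomputable def kick (φ : C(Torus d, ℝ)) (z : Phase d) : Phase d :=
  (z.1, z.2 + mulL φ (smoothing d z.1))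

lemma kick_eq (φ : C(Torus d, ℝ)) (z : Phase d) : kick φ z = z + pert φ z := by
  simp [kick, pert_apply, Prod.ext_iff]

lemma kick_kick (φ ψ : C(Torus d, ℝ)) (z : Phase d) : kick ψ (kick φ z) = kick (φ + ψ) z := by
  simp [kick, mulL_add, add_assoc]

lemma kick_zero (z : Phase d) : kick 0 z = z := by
  simp [kick, mulL]

lemma norm_evo_zero_le (t : ℝ) (z : Phase d) : ‖evo 0 t z‖ ≤ 2 * ‖z‖ := by
  have hS : ∀ n : Fin d → ℤ, |symS 0 t n| ≤ 1 := fun n => by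
    rw [symS_zero]; exact Real.abs_sin_le_one _
  have hD : ∀ n : Fin d → ℤ, |symD 0 t n| ≤ 1 := fun n => by
    rw [symD_zero, abs_neg]; exact Real.abs_sin_le_one _
  have h1 := norm_fst_le z
  have h2 := norm_snd_le z
  rw [evo_apply, Prod.norm_def, max_le_iff]
  constructor
  · refine (norm_add_le _ _).trans ?_
    have h3 := norm_mult_le (isSymbol_symC 0 t) (abs_symC_le 0 t) z.1
    have h4 := norm_mult_le (isSymbol_symS zero_le_one t) hS z.2
    linarith
  · refine (norm_add_le _ _).trans ?_
    have h3 := norm_mult_le (isSymbol_symD zero_le_one t) hD z.1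
    have h4 := norm_mult_le (isSymbol_symC 0 t) (abs_symC_le 0 t) z.2
    linarith

lemma evo_neg_evo (t : ℝ) (z : Phase d) : evo 0 t (evo 0 (-t) z) = z := by
  refine Prod.ext (ext_coef fun n => ?_) (ext_coef fun n => ?_)
  all_goals
    have h1 : ((Real.sin (t * jap n) : ℝ) : ℂ) ^ 2 + ((Real.cos (t * jap n) : ℝ) : ℂ) ^ 2 = 1 := by
      exact_mod_cast Real.sin_sq_add_cos_sq _
    simp only [coef_evo_fst zero_le_one, coef_evo_snd zero_le_one, symC_zero, symS_zero,
      symD_zero, neg_mul,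
      Real.sin_neg, Real.cos_neg, Complex.ofReal_neg]
  · linear_combination coef n z.1 * h1
  · linear_combination coef n z.2 * h1

/-- Joint continuity of the free group. -/
lemma tendsto_evo_zero {ι : Type*} {l : Filter ι} {t : ι → ℝ} {t₀ : ℝ} {Z : ι → Phase d}
    {z : Phase d} (ht : Tendsto t l (𝓝 t₀)) (hZ : Tendsto Z l (𝓝 z)) :
    Tendsto (fun i => evo 0 (t i) (Z i)) l (𝓝 (evo 0 t₀ z)) := by
  have h1 : Tendsto (fun i => evo 0 (t i) z) l (𝓝 (evo 0 t₀ z)) :=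
    ((continuous_evo zero_le_one z).tendsto t₀).comp ht
  have h2 : Tendsto (fun i => evo 0 (t i) (Z i - z)) l (𝓝 0) := by
    have h3 : Tendsto (fun i => 2 * ‖Z i - z‖) l (𝓝 0) := by
      simpa using (tendsto_iff_norm_sub_tendsto_zero.1 hZ).const_mul 2
    exact squeeze_zero_norm (fun i => norm_evo_zero_le _ _) h3
  simpa using h2.add h1

/-- The bounded generator `e^{-tA} P e^{tA}` of the interaction picture, where `e^{tA}` is the free
group `evo 0 t`. -/
noncomputable def interaction (P : Phase d →L[ℝ] Phase d) (t : ℝ) (z : Phase d) : Phase d :=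
  evo 0 (-t) (P (evo 0 t z))

lemma norm_interaction_le (P : Phase d →L[ℝ] Phase d) (t : ℝ) (z : Phase d) :
    ‖interaction P t z‖ ≤ 4 * ‖P‖ * ‖z‖ := by
  calc _ ≤ 2 * ‖P (evo 0 t z)‖ := norm_evo_zero_le _ _
    _ ≤ 2 * (‖P‖ * ‖evo 0 t z‖) := by gcongr; exact P.le_opNorm _
    _ ≤ 2 * (‖P‖ * (2 * ‖z‖)) := by gcongr; exact norm_evo_zero_le _ _
    _ = _ := by ring

lemma interaction_sub (P : Phase d →L[ℝ] Phase d) (t : ℝ) (z z' : Phase d) :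
    interaction P t (z - z') = interaction P t z - interaction P t z' := by
  simp [interaction]

lemma continuous_interaction (P : Phase d →L[ℝ] Phase d) (z : Phase d) :
    Continuous fun t => interaction P t z := by
  rw [continuous_iff_continuousAt]
  intro t
  exact tendsto_evo_zero (continuous_neg.tendsto t)
    ((P.continuous.comp (continuous_evo zero_le_one z)).tendsto t)

lemma lipschitzWith_interaction (P : Phase d →L[ℝ] Phase d) (t : ℝ) :
    LipschitzWith (Real.toNNReal (4 * ‖P‖)) (interaction P t) :=
  LipschitzWith.of_dist_le_mul fun z z' => by
    rw [dist_eq_norm, dist_eq_norm, ← interaction_sub, Real.coe_toNNReal _ (by positivity)]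
    exact norm_interaction_le _ _ _

/-- The interaction equation is an ordinary differential equation with a bounded linear right-hand
side; the smallness of `δ ‖P‖` lets a single Picard iteration cover `[0, δ]`. -/
lemma exists_interaction_solution (P : Phase d →L[ℝ] Phase d) {δ : ℝ} (hδ : 0 ≤ δ)
    (hP : δ * (4 * ‖P‖) ≤ 1 / 2) (z₀ : Phase d) :
    ∃ y : ℝ → Phase d, y 0 = z₀ ∧
      ∀ t ∈ Icc 0 δ, HasDerivWithinAt y (interaction P t (y t)) (Icc 0 δ) t := by
  have h : IsPicardLindelof (interaction P) (⟨0, le_rfl, hδ⟩ : Icc 0 δ) z₀ ‖z₀‖₊ 0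
      (Real.toNNReal (4 * ‖P‖ * (2 * ‖z₀‖))) (Real.toNNReal (4 * ‖P‖)) :=
    { lipschitzOnWith := fun t _ => (lipschitzWith_interaction P t).lipschitzOnWith
      continuousOn := fun z _ => (continuous_interaction P z).continuousOn
      norm_le := fun t _ z hz => by
        rw [Real.coe_toNNReal _ (by positivity)]
        refine (norm_interaction_le P t z).trans ?_
        have : ‖z‖ ≤ 2 * ‖z₀‖ := by
          have h1 := norm_sub_norm_le z z₀
          rw [mem_closedBall_iff_norm, coe_nnnorm] at hz
          linarith
        gcongr
      mul_max_le := by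
        simp only [sub_zero, sub_self, max_eq_left hδ, NNReal.coe_zero, coe_nnnorm]
        rw [Real.coe_toNNReal _ (by positivity)]
        nlinarith [norm_nonneg z₀] }
  exact h.exists_eq_forall_mem_Icc_hasDerivWithinAt₀

/-- Leaving the interaction picture: if `y` is differentiable, `e^{tA} y(t)` is differentiable
after smoothing. -/
lemma hasDerivAt_smoothing_evo_comp {y : ℝ → Phase d} {y' : Phase d} {t : ℝ}
    (hy : HasDerivAt y y' t) :
    HasDerivAt (fun s => smoothing d (evo 0 s (y s)).1)
      ((evo 0 t (y t)).2 + smoothing d (evo 0 t y').1) t ∧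
    HasDerivAt (fun s => smoothing d (evo 0 s (y s)).2)
      (-(evo 0 t (y t)).1 + smoothing d (evo 0 t y').2) t := by
  have h1 := hasDerivAt_smoothing_evo_fst zero_le_one (y t) t
  have h2 := hasDerivAt_smoothing_evo_snd zero_le_one (y t) t
  rw [zero_smul, map_zero, add_zero] at h2
  have hev : Tendsto (fun s : ℝ => s) (𝓝[≠] t) (𝓝 t) :=
    tendsto_nhdsWithin_of_tendsto_nhds tendsto_id
  have h3 := tendsto_evo_zero hev (hasDerivAt_iff_tendsto_slope.1 hy)
  rw [hasDerivAt_iff_tendsto_slope] at h1 h2 ⊢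
  rw [hasDerivAt_iff_tendsto_slope]
  constructor
  · have h4 := ((smoothing d).continuous.tendsto _).comp ((continuous_fst.tendsto _).comp h3)
    refine (h1.add h4).congr fun s => ?_
    simp only [Function.comp_apply, slope_def_module, map_smul, map_sub, Prod.smul_fst,
      Prod.fst_sub, ← smul_add]
    congr 1
    abel
  · have h4 := ((smoothing d).continuous.tendsto _).comp ((continuous_snd.tendsto _).comp h3)
    refine (h2.add h4).congr fun s => ?_
    simp only [Function.comp_apply, slope_def_module, map_smul, map_sub, Prod.smul_snd,
      Prod.snd_sub, ← smul_add]
    congr 1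
    abel

/-- Short-time flow of the system under a constant control. -/
lemma exists_flow_of_small (u : Fin (2 * d + 1) → ℝ) {δ : ℝ} (hδ : 0 ≤ δ)
    (hP : δ * (4 * ‖pert (pot u)‖) ≤ 1 / 2) :
    ∃ y : Phase d → ℝ → Phase d, (∀ z₀, y z₀ 0 = z₀ ∧
      ∀ t ∈ Icc 0 δ, HasDerivWithinAt (y z₀) (interaction (pert (pot u)) t (y z₀ t)) (Icc 0 δ) t) ∧
      Continuous (fun z₀ => evo 0 δ (y z₀ δ)) ∧ IsFlow δ (fun z₀ => evo 0 δ (y z₀ δ)) := by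
  set P := pert (pot u) with hPdef
  choose y hy0 hy using exists_interaction_solution P hδ hP
  have hcont : ∀ z₀, ContinuousOn (y z₀) (Icc 0 δ) := fun z₀ t ht =>
    (hy z₀ t ht).continuousWithinAt
  have hright : ∀ z₀, ∀ t ∈ Ico 0 δ,
      HasDerivWithinAt (y z₀) (interaction P t (y z₀ t)) (Ici t) t := fun z₀ t ht =>
    ((hy z₀ t ⟨ht.1, ht.2.le⟩).mono (Icc_subset_Icc_left ht.1)).mono_of_mem_nhdsWithin
      (Icc_mem_nhdsGE ht.2)
  refine ⟨y, fun z₀ => ⟨hy0 z₀, hy z₀⟩, (evo 0 δ).continuous.comp ?_, fun _ => u,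
    isPiecewiseConstant_const hδ u, fun z₀ => ⟨fun t => evo 0 t (y z₀ t), ?_, rfl, ?_, ∅,
    finite_empty, fun t ht => ?_⟩⟩
  · refine (LipschitzWith.of_dist_le_mul (K := Real.toNNReal
      (Real.exp (Real.toNNReal (4 * ‖P‖) * (δ - 0)))) fun z z' => ?_).continuous
    have := dist_le_of_trajectories_ODE (lipschitzWith_interaction P) (hcont z) (hright z)
      (hcont z') (hright z') (δ := dist z z') (by rw [hy0, hy0]) δ ⟨hδ, le_rfl⟩
    rw [Real.coe_toNNReal _ (Real.exp_pos _).le]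
    exact this.trans_eq (mul_comm _ _)
  · change evo 0 0 (y z₀ 0) = z₀
    rw [hy0, evo_zero zero_le_one]
  · intro t ht
    exact tendsto_evo_zero (tendsto_nhdsWithin_of_tendsto_nhds tendsto_id) (hcont z₀ t ht)
  · have h1 : HasDerivAt (y z₀) (interaction P t (y z₀ t)) t :=
      (hy z₀ t ⟨ht.1.1.le, ht.1.2.le⟩).hasDerivAt (Icc_mem_nhds ht.1.1 ht.1.2)
    have h2 := hasDerivAt_smoothing_evo_comp h1
    rw [interaction, evo_neg_evo, hPdef, pert_apply] at h2
    simpa using h2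

lemma exp_half_le : Real.exp (1 / 2) ≤ 2 := by
  have h1 : Real.exp (1 / 2) ^ 2 = Real.exp 1 := by
    rw [← Real.exp_nat_mul]; norm_num
  nlinarith [Real.exp_one_lt_d9, Real.exp_pos (1 / 2)]

/-- The interaction equation with generator `P / δ` on `[0, δ]` approximately maps `z` to
`e^P z = z + P z`, for `P² = 0`; the error is controlled by the distance `η`, along `z` and `P z`,
from the interaction generator on `[0, δ]` to `P`. -/
lemma norm_interaction_solution_sub_le (P : Phase d →L[ℝ] Phase d) {δ η : ℝ} (hδ : 0 < δ)
    (hP : 4 * ‖P‖ ≤ 1 / 2) {z : Phase d}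
    (hη : ∀ s ∈ Icc 0 δ, ‖interaction P s z - P z‖ ≤ η ∧ ‖interaction P s (P z)‖ ≤ η)
    {y : ℝ → Phase d} (hy0 : y 0 = z)
    (hy : ∀ t ∈ Icc 0 δ, HasDerivWithinAt y (interaction (δ⁻¹ • P) t (y t)) (Icc 0 δ) t) :
    ‖y δ - (z + P z)‖ ≤ 4 * η := by
  have hη0 : 0 ≤ η := (norm_nonneg _).trans (hη 0 ⟨le_rfl, hδ.le⟩).2
  have hsmul : ∀ s v, interaction (δ⁻¹ • P) s v = δ⁻¹ • interaction P s v := fun s v => by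
    simp [interaction]
  have hadd : ∀ s v v', interaction P s (v + v') = interaction P s v + interaction P s v' :=
    fun s v v' => by simp [interaction]
  have hsm : ∀ s (r : ℝ) v, interaction P s (r • v) = r • interaction P s v :=
    fun s r v => by simp [interaction]
  set h : ℝ → Phase d := fun s => y s - (z + (s * δ⁻¹) • P z) with hh
  set h' : ℝ → Phase d := fun s => interaction (δ⁻¹ • P) s (y s) - δ⁻¹ • P z with hh'
  have hd : ∀ t ∈ Icc 0 δ, HasDerivWithinAt h (h' t) (Icc 0 δ) t := fun t ht => by
    have h1 : HasDerivAt (fun s : ℝ => z + (s * δ⁻¹) • P z) (δ⁻¹ • P z) t := by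
      have := (((hasDerivAt_id t).mul_const δ⁻¹).smul_const (P z)).const_add z
      simpa using this
    exact (hy t ht).sub h1.hasDerivWithinAt
  have hbound : ∀ t ∈ Ico 0 δ, ‖h' t‖ ≤ 1 / (2 * δ) * ‖h t‖ + 2 * η / δ := by
    intro t ht
    obtain ⟨h1, h2⟩ := hη t ⟨ht.1, ht.2.le⟩
    have e : h' t = δ⁻¹ • (interaction P t (h t) + (interaction P t z - P z)
        + (t * δ⁻¹) • interaction P t (P z)) := by
      simp only [hh', hh, hsmul, interaction_sub, hadd, hsm]
      rw [← smul_sub]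
      congr 1
      abel
    have h3 : ‖interaction P t (h t)‖ ≤ 1 / 2 * ‖h t‖ :=
      (norm_interaction_le P t (h t)).trans (by gcongr)
    have h4 : ‖(t * δ⁻¹) • interaction P t (P z)‖ ≤ η := by
      rw [norm_smul, Real.norm_of_nonneg (mul_nonneg ht.1 (by positivity))]
      have : t * δ⁻¹ ≤ 1 := by
        rw [← div_eq_mul_inv, div_le_one hδ]; exact ht.2.le
      exact (mul_le_of_le_one_left (norm_nonneg _) this).trans h2
    rw [e, norm_smul, norm_inv, Real.norm_of_nonneg hδ.le]
    have h5 := norm_add₃_le (a := interaction P t (h t)) (b := interaction P t z - P z)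
      (c := (t * δ⁻¹) • interaction P t (P z))
    calc _ ≤ δ⁻¹ * (1 / 2 * ‖h t‖ + 2 * η) := by
            refine mul_le_mul_of_nonneg_left ?_ (by positivity)
            linarith
      _ = _ := by field_simp
  have hgr := norm_le_gronwallBound_of_norm_deriv_right_le (f := h) (f' := h') (δ := 0)
    (K := 1 / (2 * δ)) (ε := 2 * η / δ) (a := 0) (b := δ)
    (fun t ht => (hd t ht).continuousWithinAt)
    (fun t ht => ((hd t ⟨ht.1, ht.2.le⟩).mono (Icc_subset_Icc_left ht.1)).mono_of_mem_nhdsWithin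
      (Icc_mem_nhdsGE ht.2)) (by simp [hh, hy0]) hbound δ ⟨hδ.le, le_rfl⟩
  rw [gronwallBound_of_K_ne_0 (by positivity)] at hgr
  beta_reduce at hgr
  have e1 : h δ = y δ - (z + P z) := by simp [hh, hδ.ne']
  have e2 : 1 / (2 * δ) * (δ - 0) = 1 / 2 := by field_simp; ring
  have e3 : 2 * η / δ / (1 / (2 * δ)) = 4 * η := by field_simp; ring
  rw [e1, e2, e3, zero_mul, zero_add] at hgr
  refine hgr.trans ?_
  nlinarith [exp_half_le]

lemma pert_pert (φ : C(Torus d, ℝ)) (z : Phase d) : pert φ (pert φ z) = 0 := by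
  simp [pert_apply]

lemma pot_smul (r : ℝ) (u : Fin (2 * d + 1) → ℝ) : pot (r • u) = r • pot u := by
  simp [pot, smul_add, Finset.smul_sum, smul_smul]

/-- The control `u / δ` during a time `δ` acts, as `δ → 0`, as the kick by the potential of `u`: the
free evolution has no time to act. -/
lemma reach_kick_of_small (u : Fin (2 * d + 1) → ℝ) (hP : 4 * ‖pert (pot u)‖ ≤ 1 / 2)
    (z : Phase d) : Reach z (kick (pot u) z) := by
  set P := pert (pot u) with hPdef
  have hpd : ∀ δ : ℝ, pert (pot (δ⁻¹ • u)) = δ⁻¹ • P := fun δ => by rw [pot_smul, pert_smul]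
  -- closeness of the interaction generator to `P` near time `0`
  have hosc : ∀ η : ℝ, 0 < η → ∀ᶠ δ in 𝓝[>] (0 : ℝ), ∀ s ∈ Icc 0 δ,
      ‖interaction P s z - P z‖ ≤ η ∧ ‖interaction P s (P z)‖ ≤ η := by
    intro η hη
    have h0 : ∀ v, interaction P 0 v = P v := fun v => by
      rw [interaction, neg_zero, evo_zero zero_le_one, evo_zero zero_le_one]
    have h1 := (continuous_interaction P z).tendsto 0
    have h2 := (continuous_interaction P (P z)).tendsto 0
    rw [h0] at h1
    rw [h0, hPdef, pert_pert, ← hPdef] at h2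
    have h3 := ((tendsto_iff_norm_sub_tendsto_zero.1 h1).eventually_le_const hη).and
      ((tendsto_zero_iff_norm_tendsto_zero.1 h2).eventually_le_const hη)
    obtain ⟨r, hr, hr'⟩ := Metric.eventually_nhds_iff.1 h3
    filter_upwards [Ioo_mem_nhdsGT hr] with δ hδ s hs
    exact hr' (by rw [Real.dist_eq, sub_zero, abs_of_nonneg hs.1]; exact hs.2.trans_lt hδ.2)
  -- flows for the controls `u / δ`
  have hfl : ∀ δ : ℝ, ∃ Z : Phase d, 0 < δ → ApproxSteer δ z (evo 0 δ Z) ∧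
      ∀ η, (∀ s ∈ Icc 0 δ, ‖interaction P s z - P z‖ ≤ η ∧ ‖interaction P s (P z)‖ ≤ η) →
        ‖Z - (z + P z)‖ ≤ 4 * η := by
    intro δ
    by_cases hδ : 0 < δ
    · obtain ⟨y, hy, hc, hf⟩ := exists_flow_of_small (δ⁻¹ • u) hδ.le (by
        rw [hpd, norm_smul, norm_inv, Real.norm_of_nonneg hδ.le]
        calc δ * (4 * (δ⁻¹ * ‖P‖)) = 4 * ‖P‖ := by field_simp
          _ ≤ _ := hP)
      refine ⟨y z δ, fun _ => ⟨.of_isFlow hc hf z, fun η hη => ?_⟩⟩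
      refine norm_interaction_solution_sub_le P hδ hP hη (hy z).1 ?_
      rw [← hpd]
      exact (hy z).2
    · exact ⟨0, fun h => absurd h hδ⟩
  choose Z hZ using hfl
  have hpos : ∀ᶠ δ in 𝓝[>] (0 : ℝ), 0 < δ := self_mem_nhdsWithin
  have hid : Tendsto (fun δ : ℝ => δ) (𝓝[>] 0) (𝓝 0) :=
    tendsto_nhdsWithin_of_tendsto_nhds tendsto_id
  have hlim : Tendsto Z (𝓝[>] 0) (𝓝 (z + P z)) := by
    rw [tendsto_iff_norm_sub_tendsto_zero]
    refine Metric.tendsto_nhds.2 fun ε hε => ?_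
    filter_upwards [hpos, hosc (ε / 8) (by positivity)] with δ hδ h
    rw [Real.dist_eq, sub_zero, abs_of_nonneg (norm_nonneg _)]
    linarith [(hZ δ hδ).2 _ h]
  refine ApproxSteer.of_tendsto (t := fun δ => δ) (Z := fun δ => evo 0 δ (Z δ)) hid
    (hpos.mono fun δ hδ => hδ.le) (hpos.mono fun δ hδ => (hZ δ hδ).1) ?_
  have := tendsto_evo_zero hid hlim
  rwa [evo_zero zero_le_one, ← kick_eq] at this

lemma reach_refl (z : Phase d) : Reach z z := by
  have := approxSteer_evo zero_le_one le_rfl z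
  rwa [evo_zero zero_le_one] at this

/-- A kick by the potential of any control is reached by successive small kicks. -/
lemma reach_kick_pot (u : Fin (2 * d + 1) → ℝ) (z : Phase d) : Reach z (kick (pot u) z) := by
  obtain ⟨N, hN⟩ := exists_nat_gt (8 * ‖pert (pot u)‖)
  have hN0 : (0 : ℝ) < N := lt_of_le_of_lt (by positivity) hN
  set v : Fin (2 * d + 1) → ℝ := (N : ℝ)⁻¹ • u with hv
  have hsmall : 4 * ‖pert (pot v)‖ ≤ 1 / 2 := by
    rw [hv, pot_smul, pert_smul, norm_smul, norm_inv, Real.norm_of_nonneg hN0.le]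
    rw [mul_left_comm, inv_mul_le_iff₀ hN0]
    linarith
  have key : ∀ k : ℕ, Reach z (kick ((k : ℝ) • pot v) z) := by
    intro k
    induction k with
    | zero => simpa [kick_zero] using reach_refl z
    | succ k ih =>
      have := ih.trans (reach_kick_of_small v hsmall _)
      rw [kick_kick] at this
      convert! this using 2
      push_cast
      rw [add_smul, one_smul]
  have := key N
  rwa [hv, pot_smul, smul_smul, mul_inv_cancel₀ hN0.ne', one_smul] at this

/-! ### Saturation: kicks by arbitrary functions -/

/-- Multiplication by `φ` preserves `H^1`. -/
def PreservesH1 (φ : C(Torus d, ℝ)) : Prop :=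
  ∀ a, ∃ a', mulL φ (smoothing d a) = smoothing d a'

lemma PreservesH1.add {φ ψ : C(Torus d, ℝ)} (hφ : PreservesH1 φ) (hψ : PreservesH1 ψ) :
    PreservesH1 (φ + ψ) := fun a => by
  obtain ⟨a', ha'⟩ := hφ a
  obtain ⟨b', hb'⟩ := hψ a
  exact ⟨a' + b', by rw [mulL_add, ha', hb', map_add]⟩

lemma PreservesH1.smul {φ : C(Torus d, ℝ)} (hφ : PreservesH1 φ) (r : ℝ) :
    PreservesH1 (r • φ) := fun a => by
  obtain ⟨a', ha'⟩ := hφ a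
  exact ⟨r • a', by rw [mulL_smul, ha', map_smul]⟩

lemma PreservesH1.mul {φ ψ : C(Torus d, ℝ)} (hφ : PreservesH1 φ) (hψ : PreservesH1 ψ) :
    PreservesH1 (φ * ψ) := fun a => by
  obtain ⟨a', ha'⟩ := hψ a
  obtain ⟨b', hb'⟩ := hφ a'
  exact ⟨b', by rw [mulL_mul, ha', hb']⟩

lemma preservesH1_one : PreservesH1 (1 : C(Torus d, ℝ)) := fun a => ⟨a, mulL_one _⟩

/-- Peetre's inequality. -/
lemma japaneseSq_add_le (k m : Fin d → ℤ) :
    japaneseSq (k + m) ≤ 2 * japaneseSq m * japaneseSq k := by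
  have h : ∑ i, (((k + m) i : ℤ) : ℝ) ^ 2 ≤ 2 * ∑ i, (k i : ℝ) ^ 2 + 2 * ∑ i, (m i : ℝ) ^ 2 := by
    rw [Finset.mul_sum, Finset.mul_sum, ← Finset.sum_add_distrib]
    refine Finset.sum_le_sum fun i _ => ?_
    rw [Pi.add_apply]
    push_cast
    nlinarith [sq_nonneg ((k i : ℝ) - m i)]
  have hk : 0 ≤ ∑ i, (k i : ℝ) ^ 2 := Finset.sum_nonneg fun i _ => sq_nonneg _
  have hm : 0 ≤ ∑ i, (m i : ℝ) ^ 2 := Finset.sum_nonneg fun i _ => sq_nonneg _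
  simp only [japaneseSq] at *
  nlinarith [mul_nonneg hk hm]

/-- Multiplication by a trigonometric mode shifts the Fourier coefficients by `± m`, which changes
`⟨n⟩` by a bounded factor. -/
lemma preservesH1_of_coef {φ : C(Torus d, ℝ)} (m : Fin d → ℤ)
    (h : ∀ (f : L2 d) n, ‖coef n (mulL φ f)‖ ≤ ‖coef (n - m) f‖ + ‖coef (n + m) f‖) :
    PreservesH1 φ := by
  intro a
  have hshift : ∀ (k p : Fin d → ℤ), japaneseSq p = japaneseSq m → ∀ n, n = k + p →
      japaneseSq n * ‖coef k (smoothing d a)‖ ^ 2 ≤ 2 * japaneseSq m * ‖coef k a‖ ^ 2 := by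
    rintro k p hp n rfl
    have h1 := japaneseSq_add_le k p
    rw [hp] at h1
    have h2 : ‖coef k (smoothing d a)‖ ^ 2 = (japaneseSq k)⁻¹ * ‖coef k a‖ ^ 2 := by
      rw [coef_smoothing, norm_mul, norm_inv, Complex.norm_real, Real.norm_of_nonneg (jap_pos k).le,
        mul_pow, inv_pow, jap_sq]
    have h3 : 0 < japaneseSq k := one_pos.trans_le (one_le_japaneseSq k)
    rw [h2, ← mul_assoc]
    refine mul_le_mul_of_nonneg_right ?_ (by positivity)
    rw [← div_eq_mul_inv, div_le_iff₀ h3]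
    exact h1
  obtain ⟨a', ha'⟩ := exists_coef_eq (fun n => (jap n : ℂ) * coef n (mulL φ (smoothing d a)))
    (fun n => by rw [coef_neg, jap_neg, map_mul, Complex.conj_ofReal]) (by
      have s1 : Summable fun n : Fin d → ℤ => ‖coef (n - m) a‖ ^ 2 :=
        (Equiv.subRight m).summable_iff (f := fun n => ‖coef n a‖ ^ 2) |>.2 (summable_sq_coef a)
      have s2 : Summable fun n : Fin d → ℤ => ‖coef (n + m) a‖ ^ 2 :=
        (Equiv.addRight m).summable_iff (f := fun n => ‖coef n a‖ ^ 2) |>.2 (summable_sq_coef a)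
      refine Summable.of_nonneg_of_le (fun n => by positivity) (fun n => ?_)
        ((s1.mul_left (4 * japaneseSq m)).add (s2.mul_left (4 * japaneseSq m)))
      rw [norm_mul, mul_pow, Complex.norm_real, Real.norm_eq_abs, sq_abs, jap_sq]
      have h1 := hshift (n - m) m rfl n (sub_add_cancel n m).symm
      have h2 := hshift (n + m) (-m) (japaneseSq_neg m) n (add_neg_cancel_right n m).symm
      have h3 := pow_le_pow_left₀ (norm_nonneg _) (h (smoothing d a) n) 2
      have h4 := mul_le_mul_of_nonneg_left (h3.trans add_sq_le)
        (zero_le_one.trans (one_le_japaneseSq n))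
      refine h4.trans ?_
      generalize ‖coef (n - m) (smoothing d a)‖ = x at *
      generalize ‖coef (n + m) (smoothing d a)‖ = y at *
      linarith)
  refine ⟨a', ext_coef fun n => ?_⟩
  rw [coef_smoothing, ha', inv_mul_cancel_left₀ (jap_ne_zero n)]

lemma preservesH1_cosMode (m : Fin d → ℤ) : PreservesH1 (cosMode m) :=
  preservesH1_of_coef m fun f n => by
    rw [coef_cosMode, norm_div]
    have h1 := norm_add_le (coef (n - m) f) (coef (n + m) f)
    rw [div_le_iff₀ (by simp), Complex.norm_ofNat]
    linarith [norm_nonneg (coef (n - m) f), norm_nonneg (coef (n + m) f)]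

lemma preservesH1_sinMode (m : Fin d → ℤ) : PreservesH1 (sinMode m) :=
  preservesH1_of_coef m fun f n => by
    rw [coef_sinMode, norm_div]
    have h1 := norm_sub_le (coef (n - m) f) (coef (n + m) f)
    rw [div_le_iff₀ (by simp), norm_mul, Complex.norm_ofNat, Complex.norm_I]
    linarith [norm_nonneg (coef (n - m) f), norm_nonneg (coef (n + m) f)]

lemma norm_smoothing_symC_sub_le {t : ℝ} (ht : 0 ≤ t) (a : L2 d) :
    ‖mult (symC 0 t) (smoothing d a) - smoothing d a‖ ≤ t * ‖a‖ := by
  refine norm_le_of_coef_le ht fun n => ?_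
  rw [map_sub, coef_mult (isSymbol_symC 0 t), coef_smoothing, ← sub_one_mul, ← mul_assoc, norm_mul]
  refine mul_le_mul_of_nonneg_right ?_ (norm_nonneg _)
  have h : ((symC 0 t n : ℝ) : ℂ) - 1 = ((symC 0 t n - 1 : ℝ) : ℂ) := by push_cast; rfl
  rw [h, norm_mul, norm_inv, Complex.norm_real, Complex.norm_real,
    Real.norm_of_nonneg (jap_pos n).le, ← div_eq_mul_inv, div_le_iff₀ (jap_pos n), symC, freq_zero,
    Real.norm_eq_abs]
  have := Real.abs_cos_sub_cos_le (t * jap n) 0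
  rwa [Real.cos_zero, sub_zero, abs_of_nonneg (mul_nonneg ht (jap_pos n).le)] at this

lemma smoothing_mult {m : (Fin d → ℤ) → ℝ} (hm : IsSymbol m) (a : L2 d) :
    smoothing d (mult m a) = mult m (smoothing d a) :=
  ext_coef fun n => by
    rw [coef_smoothing, coef_mult hm, coef_mult hm, coef_smoothing, mul_left_comm]

lemma coef_symS_smoothing (t : ℝ) (a : L2 d) (n : Fin d → ℤ) :
    coef n (mult (symS 0 t) (smoothing d a)) = (sinOver t (jap n) : ℂ) * coef n a := by
  rw [coef_mult (isSymbol_symS zero_le_one t), coef_smoothing, symS, freq_zero]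
  have := jap_ne_zero n
  push_cast
  field_simp

lemma norm_symS_smoothing_le {t : ℝ} (ht : 0 ≤ t) (a : L2 d) :
    ‖mult (symS 0 t) (smoothing d a)‖ ≤ t * ‖a‖ := by
  refine norm_le_of_coef_le ht fun n => ?_
  rw [coef_symS_smoothing, norm_mul, Complex.norm_real, Real.norm_eq_abs]
  refine mul_le_mul_of_nonneg_right ?_ (norm_nonneg _)
  simpa [abs_of_nonneg ht] using abs_sinOver_le t (jap n)

lemma tendsto_inv_smul_symS_smoothing (a : L2 d) :
    Tendsto (fun t : ℝ => t⁻¹ • mult (symS 0 t) (smoothing d a)) (𝓝[>] 0) (𝓝 a) := by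
  have hpos : ∀ᶠ t in 𝓝[>] (0 : ℝ), 0 < t := self_mem_nhdsWithin
  have e : ∀ t : ℝ, 0 < t → ∀ n, coef n (t⁻¹ • mult (symS 0 t) (smoothing d a)) =
      (Real.sinc (t * jap n) : ℂ) * coef n a := fun t ht n => by
    rw [map_smul, coef_symS_smoothing, Complex.real_smul, sinOver]
    have : (t : ℂ) ≠ 0 := by exact_mod_cast ht.ne'
    push_cast
    field_simp
  refine tendsto_of_coef (fun n => ‖coef n a‖) (summable_sq_coef a) ?_ (fun n => le_rfl)
    fun n => ?_
  · filter_upwards [hpos] with t ht n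
    rw [e t ht, norm_mul, Complex.norm_real]
    exact mul_le_of_le_one_left (norm_nonneg _) (Real.abs_sinc_le_one _)
  · have h1 : Tendsto (fun t : ℝ => (Real.sinc (t * jap n) : ℂ) * coef n a) (𝓝[>] 0)
        (𝓝 ((Real.sinc (0 * jap n) : ℂ) * coef n a)) := by
      refine tendsto_nhdsWithin_of_tendsto_nhds (Continuous.tendsto ?_ 0)
      have := Real.continuous_sinc
      fun_prop
    rw [zero_mul, Real.sinc_zero, Complex.ofReal_one, one_mul] at h1
    exact h1.congr' (hpos.mono fun t ht => (e t ht n).symm)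

/-- `φ` is a function by which the state can be kicked in arbitrarily small time. -/
def IsKick (φ : C(Torus d, ℝ)) : Prop := ∀ z, Reach z (kick φ z)

lemma IsKick.add {φ ψ : C(Torus d, ℝ)} (hφ : IsKick φ) (hψ : IsKick ψ) : IsKick (φ + ψ) :=
  fun z => by
    rw [← kick_kick]
    exact (hφ z).trans (hψ _)

/-- The conjugate of the free evolution during a time `s²` by kicks of size `s⁻¹` converges to the
kick by `-φ²`. -/
lemma tendsto_conj_evo {φ : C(Torus d, ℝ)} (hφ : PreservesH1 φ) (z : Phase d) :
    Tendsto (fun s : ℝ => kick (-(s⁻¹ • φ)) (evo 0 (s ^ 2) (kick (s⁻¹ • φ) z))) (𝓝[>] 0)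
      (𝓝 (kick (-(φ * φ)) z)) := by
  obtain ⟨a', ha'⟩ := hφ z.1
  have hpos : ∀ᶠ s in 𝓝[>] (0 : ℝ), 0 < s := self_mem_nhdsWithin
  have hid : Tendsto (fun s : ℝ => s) (𝓝[>] 0) (𝓝 0) :=
    tendsto_nhdsWithin_of_tendsto_nhds tendsto_id
  have hsq : Tendsto (fun s : ℝ => s ^ 2) (𝓝[>] 0) (𝓝 0) := by simpa using hid.pow 2
  have hsq' : Tendsto (fun s : ℝ => s ^ 2) (𝓝[>] 0) (𝓝[>] 0) :=
    tendsto_nhdsWithin_iff.2 ⟨hsq, hpos.mono fun s hs => by simp only [mem_Ioi]; positivity⟩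
  have hev : Tendsto (fun s : ℝ => evo 0 (s ^ 2) z) (𝓝[>] 0) (𝓝 z) := by
    have := ((continuous_evo zero_le_one z).tendsto 0).comp hsq
    rwa [evo_zero zero_le_one] at this
  -- a bound by `t = s²` beats the factor `s⁻¹`
  have hsmall : ∀ (F : ℝ → L2 d) (K : ℝ), (∀ t, 0 ≤ t → ‖F t‖ ≤ t * K) →
      Tendsto (fun s : ℝ => s⁻¹ • F (s ^ 2)) (𝓝[>] 0) (𝓝 0) := by
    intro F K hF
    have h1 : Tendsto (fun s : ℝ => s * K) (𝓝[>] 0) (𝓝 0) := by simpa using hid.mul_const K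
    refine squeeze_zero_norm' ?_ h1
    filter_upwards [hpos] with s hs
    rw [norm_smul, norm_inv, Real.norm_of_nonneg hs.le, inv_mul_le_iff₀ hs]
    exact (hF _ (sq_nonneg s)).trans_eq (by ring)
  have t1 := hsmall (fun t => mult (symS 0 t) (smoothing d a')) ‖a'‖ fun t ht =>
    norm_symS_smoothing_le ht a'
  have t2 := hsmall (fun t => mult (symC 0 t) (smoothing d a') - smoothing d a') ‖a'‖ fun t ht =>
    norm_smoothing_symC_sub_le ht a'
  have t3 := hsmall (fun t => mult (symC 0 t) (smoothing d z.1) - smoothing d z.1) ‖z.1‖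
    fun t ht => norm_smoothing_symC_sub_le ht z.1
  have t4 := hsmall (fun t => mult (symS 0 t) (smoothing d z.2)) ‖z.2‖ fun t ht =>
    norm_symS_smoothing_le ht z.2
  have t5 := (tendsto_inv_smul_symS_smoothing a').comp hsq'
  have hcont : ∀ {F : ℝ → L2 d} {f : L2 d}, Tendsto F (𝓝[>] 0) (𝓝 f) →
      Tendsto (fun s => mulL φ (F s)) (𝓝[>] 0) (𝓝 (mulL φ f)) := fun h =>
    ((mulL φ).continuous.tendsto _).comp h
  have hcontS : ∀ {F : ℝ → L2 d} {f : L2 d}, Tendsto F (𝓝[>] 0) (𝓝 f) →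
      Tendsto (fun s => smoothing d (F s)) (𝓝[>] 0) (𝓝 (smoothing d f)) := fun h =>
    ((smoothing d).continuous.tendsto _).comp h
  have hfst : Tendsto (fun s : ℝ => (evo 0 (s ^ 2) z).1 + s⁻¹ • mult (symS 0 (s ^ 2))
      (smoothing d a')) (𝓝[>] 0) (𝓝 z.1) := by
    simpa using ((continuous_fst.tendsto _).comp hev).add t1
  have hsnd := ((((continuous_snd.tendsto _).comp hev).add t2).sub
    ((hcont t3).add (hcont t4))).sub (hcont (hcontS t5))
  have elim : kick (-(φ * φ)) z =
      (z.1, z.2 + 0 - (mulL φ 0 + mulL φ 0) - mulL φ (smoothing d a')) := by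
    have h1 : mulL (-(φ * φ)) (smoothing d z.1) = -mulL φ (smoothing d a') := by
      rw [← neg_one_smul ℝ (φ * φ), mulL_smul, mulL_mul, ha', neg_one_smul]
    rw [kick, h1]
    simp [sub_eq_add_neg]
  rw [elim]
  refine (hfst.prodMk_nhds hsnd).congr' ?_
  filter_upwards [hpos] with s hs
  have hk : kick (s⁻¹ • φ) z = (z.1, z.2 + s⁻¹ • smoothing d a') := by
    rw [kick, mulL_smul, ha']
  have hne : s ≠ 0 := hs.ne'
  rw [hk, kick]
  refine Prod.ext ?_ ?_
  · simp only [evo_apply, map_add, map_smul, add_assoc]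
  · have h1 : ∀ f, mulL (-(s⁻¹ • φ)) f = -(s⁻¹ • mulL φ f) := fun f => by
      rw [← neg_smul, mulL_smul, neg_smul]
    simp only [evo_apply, h1, map_add, map_sub, map_smul, Function.comp_apply, ha',
      smoothing_mult (isSymbol_symC 0 _), smoothing_mult (isSymbol_symS zero_le_one _)]
    have h2 : ((s : ℝ) ^ 2)⁻¹ = s⁻¹ * s⁻¹ := by rw [sq, mul_inv]
    rw [h2]
    module

/-- The squares enter with one sign only; `sq_mem_kickSpace` recovers the other sign. -/
lemma IsKick.neg_sq {φ : C(Torus d, ℝ)} (hφ : PreservesH1 φ) (h : ∀ r : ℝ, IsKick (r • φ)) :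
    IsKick (-(φ * φ)) := by
  intro z
  have hpos : ∀ᶠ s in 𝓝[>] (0 : ℝ), 0 < s := self_mem_nhdsWithin
  have hsq : Tendsto (fun s : ℝ => s ^ 2) (𝓝[>] 0) (𝓝 0) := by
    simpa using (tendsto_nhdsWithin_of_tendsto_nhds (tendsto_id (x := 𝓝 (0 : ℝ)))).pow 2
  refine ApproxSteer.of_tendsto hsq (Eventually.of_forall fun s => sq_nonneg s)
    (Eventually.of_forall fun s => ?_) (tendsto_conj_evo hφ z)
  refine ((h s⁻¹ z).trans_steer (sq_nonneg s)
    (approxSteer_evo zero_le_one (sq_nonneg s) _)).trans_reach (sq_nonneg s) ?_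
  rw [← neg_smul]
  exact h _ _

/-- The linear space of the functions that preserve `H¹` and all of whose multiples are kicks. -/
def kickSpace (d : ℕ) : Submodule ℝ C(Torus d, ℝ) where
  carrier := {φ | PreservesH1 φ ∧ ∀ r : ℝ, IsKick (r • φ)}
  add_mem' := fun hφ hψ => ⟨hφ.1.add hψ.1, fun r => by
    rw [smul_add]; exact (hφ.2 r).add (hψ.2 r)⟩
  zero_mem' := ⟨fun a => ⟨0, by simp [mulL]⟩, fun r z => by
    rw [smul_zero, kick_zero]; exact reach_refl z⟩
  smul_mem' := fun c φ hφ => ⟨hφ.1.smul c, fun r => by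
    rw [smul_smul]; exact hφ.2 _⟩

lemma neg_sq_isKick {φ : C(Torus d, ℝ)} (hφ : φ ∈ kickSpace d) : IsKick (-(φ * φ)) :=
  .neg_sq hφ.1 hφ.2

/-- If `f² + g² = 1`, both signs of `f²` are available. -/
lemma sq_mem_kickSpace {f g : C(Torus d, ℝ)} (hf : f ∈ kickSpace d) (hg : g ∈ kickSpace d)
    (h1 : (1 : C(Torus d, ℝ)) ∈ kickSpace d) (hfg : f * f + g * g = 1) :
    f * f ∈ kickSpace d := by
  refine ⟨hf.1.mul hf.1, fun r => ?_⟩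
  rcases le_total r 0 with hr | hr
  · have h := neg_sq_isKick ((kickSpace d).smul_mem (Real.sqrt (-r)) hf)
    convert! h using 1
    rw [smul_mul_smul_comm, Real.mul_self_sqrt (by linarith), neg_smul, neg_neg]
  · have h := (h1.2 r).add (neg_sq_isKick ((kickSpace d).smul_mem (Real.sqrt r) hg))
    convert! h using 1
    rw [smul_mul_smul_comm, Real.mul_self_sqrt hr, ← sub_eq_add_neg, ← smul_sub, ← hfg,
      add_sub_cancel_right]

/-- Polarization: `r f g = -(r f / 2 - g)² + (r f / 2)² + g²`. -/
lemma mul_mem_kickSpace {f g : C(Torus d, ℝ)} (hf : f ∈ kickSpace d) (hg : g ∈ kickSpace d)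
    (hff : f * f ∈ kickSpace d) (hgg : g * g ∈ kickSpace d) : f * g ∈ kickSpace d := by
  refine ⟨hf.1.mul hg.1, fun r => ?_⟩
  have h := ((neg_sq_isKick ((kickSpace d).sub_mem ((kickSpace d).smul_mem (r / 2) hf) hg)).add
    (hff.2 ((r / 2) ^ 2))).add (hgg.2 1)
  convert! h using 1
  ext x
  simp
  ring

lemma one_mem_kickSpace : (1 : C(Torus d, ℝ)) ∈ kickSpace d :=
  ⟨preservesH1_one, fun r z => by
    have h : r • (1 : C(Torus d, ℝ)) = pot (Pi.single 0 r) := by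
      simp [pot, Fin.ext_iff]
    rw [h]
    exact reach_kick_pot _ z⟩

lemma sinMode_single_mem (j : Fin d) : sinMode (Pi.single j 1) ∈ kickSpace d :=
  ⟨preservesH1_sinMode _, fun r z => by
    have h : r • sinMode (Pi.single j 1) = pot (Pi.single ⟨2 * j.1 + 1, by omega⟩ r) := by
      rw [pot, Finset.sum_eq_single j]
      · simp [Fin.ext_iff]
      · intro i _ hij
        have hij' : i.1 ≠ j.1 := fun h => hij (Fin.ext h)
        have h2 : 2 * i.1 + 1 ≠ 2 * j.1 := by omega
        simp [Fin.ext_iff, hij', h2]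
      · simp
    rw [h]
    exact reach_kick_pot _ z⟩

lemma cosMode_single_mem (j : Fin d) : cosMode (Pi.single j 1) ∈ kickSpace d :=
  ⟨preservesH1_cosMode _, fun r z => by
    have h : r • cosMode (Pi.single j 1) = pot (Pi.single ⟨2 * j.1 + 2, by omega⟩ r) := by
      rw [pot, Finset.sum_eq_single j]
      · simp [Fin.ext_iff]
      · intro i _ hij
        have hij' : i.1 ≠ j.1 := fun h => hij (Fin.ext h)
        have h2 : 2 * i.1 ≠ 2 * j.1 + 1 := by omega
        simp [Fin.ext_iff, hij', h2]
      · simp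
    rw [h]
    exact reach_kick_pot _ z⟩

lemma modes_mul_mem {m n : Fin d → ℤ} (hm : cosMode m ∈ kickSpace d ∧ sinMode m ∈ kickSpace d)
    (hn : cosMode n ∈ kickSpace d ∧ sinMode n ∈ kickSpace d) :
    cosMode (m + n) ∈ kickSpace d ∧ sinMode (m + n) ∈ kickSpace d := by
  have hc : ∀ {k : Fin d → ℤ}, cosMode k ∈ kickSpace d ∧ sinMode k ∈ kickSpace d →
      cosMode k * cosMode k ∈ kickSpace d := fun {k} hk =>
    sq_mem_kickSpace hk.1 hk.2 one_mem_kickSpace (cosMode_sq_add_sinMode_sq k)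
  have hs : ∀ {k : Fin d → ℤ}, cosMode k ∈ kickSpace d ∧ sinMode k ∈ kickSpace d →
      sinMode k * sinMode k ∈ kickSpace d := fun {k} hk =>
    sq_mem_kickSpace hk.2 hk.1 one_mem_kickSpace
      ((add_comm _ _).trans (cosMode_sq_add_sinMode_sq k))
  rw [cosMode_add, sinMode_add]
  exact ⟨(kickSpace d).sub_mem (mul_mem_kickSpace hm.1 hn.1 (hc hm) (hc hn))
      (mul_mem_kickSpace hm.2 hn.2 (hs hm) (hs hn)),
    (kickSpace d).add_mem (mul_mem_kickSpace hm.1 hn.2 (hc hm) (hs hn))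
      (mul_mem_kickSpace hm.2 hn.1 (hs hm) (hc hn))⟩

/-- All trigonometric modes are kicks: their frequencies form a subgroup of `ℤ^d` that contains the
standard basis. -/
lemma modes_mem (n : Fin d → ℤ) : cosMode n ∈ kickSpace d ∧ sinMode n ∈ kickSpace d := by
  let N : AddSubgroup (Fin d → ℤ) :=
    { carrier := {n | cosMode n ∈ kickSpace d ∧ sinMode n ∈ kickSpace d}
      add_mem' := modes_mul_mem
      zero_mem' := by
        simp only [mem_ofPred_eq, cosMode_zero, sinMode_zero]
        exact ⟨one_mem_kickSpace, (kickSpace d).zero_mem⟩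
      neg_mem' := fun {n} hn => by
        simp only [mem_ofPred_eq, cosMode_neg, sinMode_neg]
        exact ⟨hn.1, (kickSpace d).neg_mem hn.2⟩ }
  change n ∈ N
  have h : n = ∑ i, n i • (Pi.single i 1 : Fin d → ℤ) := by
    simp [← Pi.single_smul, Finset.univ_sum_single]
  rw [h]
  exact N.sum_mem fun i _ => N.zsmul_mem ⟨cosMode_single_mem i, sinMode_single_mem i⟩ _

lemma continuous_mulL (f : L2 d) : Continuous fun φ : C(Torus d, ℝ) => mulL φ f :=
  (((ContinuousLinearMap.mul ℝ ℝ).holderL volume ∞ 2 2).continuous.comp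
    (ContinuousMap.toLp (E := ℝ) ∞ (volume : Measure (Torus d)) ℝ).continuous).clm_apply
    continuous_const

lemma re_im_mem_kickSpace {p : C(Torus d, ℂ)} (hp : p ∈ Submodule.span ℂ (range expMode)) :
    ∃ ψ ∈ kickSpace d, ∃ χ ∈ kickSpace d, ∀ x, ψ x = (p x).re ∧ χ x = (p x).im := by
  induction hp using Submodule.span_induction with
  | mem p hp =>
    obtain ⟨n, rfl⟩ := hp
    exact ⟨cosMode n, (modes_mem n).1, sinMode n, (modes_mem n).2, fun x => ⟨rfl, rfl⟩⟩
  | zero => exact ⟨0, (kickSpace d).zero_mem, 0, (kickSpace d).zero_mem, fun x => by simp⟩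
  | add p q _ _ hp hq =>
    obtain ⟨ψ, hψ, χ, hχ, h1⟩ := hp
    obtain ⟨ψ', hψ', χ', hχ', h2⟩ := hq
    exact ⟨ψ + ψ', (kickSpace d).add_mem hψ hψ', χ + χ', (kickSpace d).add_mem hχ hχ',
      fun x => by simp [h1, h2]⟩
  | smul c p _ hp =>
    obtain ⟨ψ, hψ, χ, hχ, h1⟩ := hp
    exact ⟨c.re • ψ - c.im • χ, (kickSpace d).sub_mem ((kickSpace d).smul_mem _ hψ)
        ((kickSpace d).smul_mem _ hχ), c.re • χ + c.im • ψ,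
      (kickSpace d).add_mem ((kickSpace d).smul_mem _ hχ) ((kickSpace d).smul_mem _ hψ),
      fun x => by simp [h1, Complex.mul_re, Complex.mul_im]⟩

/-- Every continuous function is a kick, by density of the trigonometric polynomials. -/
lemma isKick_continuous (φ : C(Torus d, ℝ)) : IsKick φ := by
  intro z
  have hφ : φ ∈ closure (kickSpace d : Set C(Torus d, ℝ)) := by
    rw [Metric.mem_closure_iff]
    intro ε hε
    let φc : C(Torus d, ℂ) := ⟨fun x => (φ x : ℂ), by fun_prop⟩
    have h1 : φc ∈ (Submodule.span ℂ (range (expMode (d := d)))).topologicalClosure := by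
      rw [span_expMode_closure_eq_top]; trivial
    obtain ⟨p, hp, hpd⟩ := Metric.mem_closure_iff.1 h1 (ε / 2) (by positivity)
    obtain ⟨ψ, hψ, χ, -, hψp⟩ := re_im_mem_kickSpace hp
    refine ⟨ψ, hψ, lt_of_le_of_lt ?_ (half_lt_self hε)⟩
    rw [ContinuousMap.dist_le (by positivity)]
    intro x
    have h2 := (ContinuousMap.dist_apply_le_dist (f := φc) (g := p) x).trans hpd.le
    refine le_trans ?_ h2
    rw [Real.dist_eq, Complex.dist_eq, (hψp x).1]
    exact (Complex.abs_re_le_norm (φc x - p x)).trans_eq' (by simp [φc])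
  obtain ⟨ψ, hψ, hlim⟩ := mem_closure_iff_seq_limit.1 hφ
  refine Reach.of_tendsto (l := atTop) (Z := fun k => kick (ψ k) z)
    (Eventually.of_forall fun k => by simpa using (hψ k).2 1 z) ?_
  exact tendsto_const_nhds.prodMk_nhds (tendsto_const_nhds.add
    (((continuous_mulL _).tendsto φ).comp hlim))

/-- The products `φ w`, `φ` continuous, are dense in the `L²` functions that vanish where `w` does:
divide by `w` and approximate in `L²(w² dx)`. -/
lemma exists_mulL_approx (w g : L2 d) (h : ∀ᵐ x, w x = 0 → g x = 0) {ε : ℝ} (hε : 0 < ε) :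
    ∃ φ : C(Torus d, ℝ), ‖mulL φ w - g‖ ≤ ε := by
  have hwm : Measurable w := (Lp.stronglyMeasurable w).measurable
  have hgm : Measurable g := (Lp.stronglyMeasurable g).measurable
  set μ : Measure (Torus d) := volume.withDensity fun x => ‖w x‖ₑ ^ (2 : ℝ) with hμ
  have key : ∀ q : Torus d → ℝ, Measurable q →
      eLpNorm q 2 μ = eLpNorm (fun x => w x * q x) 2 volume := by
    intro q hq
    rw [eLpNorm_eq_lintegral_rpow_enorm_toReal (by norm_num) (by norm_num),
      eLpNorm_eq_lintegral_rpow_enorm_toReal (by norm_num) (by norm_num), hμ,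
      lintegral_withDensity_eq_lintegral_mul _ (by fun_prop) (by fun_prop)]
    congr 1
    refine lintegral_congr fun x => ?_
    rw [Pi.mul_apply, enorm_mul, ENNReal.mul_rpow_of_nonneg _ _ (by norm_num), ENNReal.toReal_ofNat]
  have hfin : IsFiniteMeasure μ := by
    refine isFiniteMeasure_withDensity ?_
    have h1 := (Lp.memLp w).eLpNorm_lt_top
    rw [eLpNorm_eq_lintegral_rpow_enorm_toReal (by norm_num) (by norm_num)] at h1
    have h2 := (ENNReal.rpow_lt_top_iff_of_pos (by norm_num)).1 h1
    simpa using h2.ne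
  set q : Torus d → ℝ := fun x => g x / w x with hq
  have hqm : Measurable q := hgm.div hwm
  have hwq : (fun x => w x * q x) =ᵐ[volume] g := by
    filter_upwards [h] with x hx
    by_cases hw : w x = 0
    · simp [hw, hx hw]
    · simp only [hq]; field_simp
  have hqL : MemLp q 2 μ := by
    refine ⟨hqm.aestronglyMeasurable, ?_⟩
    rw [key q hqm, eLpNorm_congr_ae hwq]
    exact (Lp.memLp g).eLpNorm_lt_top
  obtain ⟨φ, hφ, -⟩ := hqL.exists_boundedContinuous_eLpNorm_sub_le (by norm_num)
    (ε := ENNReal.ofReal ε) (by simpa using hε)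
  refine ⟨φ.toContinuousMap, ?_⟩
  rw [key _ (hqm.sub φ.continuous.measurable)] at hφ
  rw [norm_sub_rev, ← ENNReal.ofReal_le_ofReal_iff hε.le, ofReal_norm, Lp.enorm_def]
  refine le_of_eq_of_le (eLpNorm_congr_ae ?_) hφ
  filter_upwards [hwq, coeFn_mulL φ.toContinuousMap w, Lp.coeFn_sub g (mulL φ.toContinuousMap w)]
    with x h1 h2 h3
  rw [h3, Pi.sub_apply, h2, ← h1, Pi.sub_apply, mul_sub, mul_comm (w x) (φ x)]
  rfl

/-- In arbitrarily small time, the velocity can be changed at will off the zero set of `w`. -/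
lemma reach_add_snd (z : Phase d) (g : L2 d) (h : ∀ᵐ x, smoothing d z.1 x = 0 → g x = 0) :
    Reach z (z.1, z.2 + g) := by
  choose φ hφ using fun k : ℕ => exists_mulL_approx (smoothing d z.1) g h
    (Nat.one_div_pos_of_nat (α := ℝ) (n := k))
  refine Reach.of_tendsto (l := atTop) (Z := fun k => kick (φ k) z)
    (Eventually.of_forall fun k => isKick_continuous (φ k) z) ?_
  refine tendsto_const_nhds.prodMk_nhds (tendsto_const_nhds.add ?_)
  rw [tendsto_iff_norm_sub_tendsto_zero]
  exact squeeze_zero (fun k => norm_nonneg _) hφ tendsto_one_div_add_atTop_nhds_zero_nat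

/-! ### Controllability from states with `w ≠ 0` almost everywhere -/

/-- For all `s` outside a countable set, the zeros of `a + s b` are, up to a null set, common zeros
of `a` and `b`: the sets `{a + s b = 0, b ≠ 0}` are pairwise disjoint. -/
lemma dense_generic (a b : L2 d) : Dense {s : ℝ | ∀ᵐ x, a x + s * b x = 0 → b x = 0} := by
  have ha : Measurable a := (Lp.stronglyMeasurable a).measurable
  have hb : Measurable b := (Lp.stronglyMeasurable b).measurable
  set A : ℝ → Set (Torus d) := fun s => {x | a x + s * b x = 0} ∩ {x | b x = 0}ᶜ with hA
  have hm : ∀ s, MeasurableSet (A s) := fun s =>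
    ((ha.add (hb.const_mul s)) (measurableSet_singleton 0)).inter
      (hb (measurableSet_singleton 0)).compl
  have hd : Pairwise (Function.onFun Disjoint A) := by
    intro s s' hss'
    refine Set.disjoint_left.2 fun x hx hx' => hss' ?_
    have h1 : (s - s') * b x = 0 := by
      have e1 : a x + s * b x = 0 := hx.1
      have e2 : a x + s' * b x = 0 := hx'.1
      linear_combination e1 - e2
    exact sub_eq_zero.1 ((mul_eq_zero.1 h1).resolve_right hx.2)
  have hc : Set.Countable {s | 0 < volume (A s)} :=
    Measure.countable_meas_pos_of_disjoint_iUnion hm hd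
  refine (hc.dense_compl ℝ).mono fun s hs => ?_
  have h0 : volume (A s) = 0 := by simpa using hs
  filter_upwards [measure_eq_zero_iff_ae_notMem.1 h0] with x hx h1
  by_contra h2
  exact hx ⟨h1, h2⟩

/-- The constant function `1`. -/
noncomputable def oneL (d : ℕ) : L2 d := ContinuousMap.toLp (E := ℝ) 2 volume ℝ 1

lemma coeFn_oneL : ∀ᵐ x, oneL d x = 1 := by
  filter_upwards [ContinuousMap.coeFn_toLp (p := 2) (𝕜 := ℝ) (volume : Measure (Torus d))
    (1 : C(Torus d, ℝ))]
    with x hx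
  exact hx

lemma coef_oneL (n : Fin d → ℤ) : coef n (oneL d) = if n = 0 then 1 else 0 := by
  have h : ∫ x, (oneL d x : ℂ) * expMode (-n) x = ∫ x, expMode (-n) x := by
    refine integral_congr_ae ?_
    filter_upwards [coeFn_oneL (d := d)] with x hx
    rw [hx, Complex.ofReal_one, one_mul]
  rw [coef_eq_integral, h, integral_expMode]
  simp only [neg_eq_zero]
  split_ifs
  · rw [mass, ← Complex.ofReal_pow, inv_mul_cancel₀]
    exact_mod_cast (mass_pos d).ne'
  · simp

lemma jap_zero : jap (0 : Fin d → ℤ) = 1 := by simp [jap, japaneseSq]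

lemma smoothing_symS_oneL (t : ℝ) :
    smoothing d (mult (symS 0 t) (oneL d)) = Real.sin t • oneL d := by
  refine ext_coef fun n => ?_
  rw [coef_smoothing, coef_mult (isSymbol_symS zero_le_one t), map_smul, coef_oneL]
  split_ifs with h
  · subst h
    rw [symS, freq_zero, mul_sinOver, jap_zero]
    simp
  · simp

lemma coeFn_add_smul (f g : L2 d) (s : ℝ) : ∀ᵐ x, (f + s • g : L2 d) x = f x + s * g x := by
  filter_upwards [Lp.coeFn_add f (s • g), Lp.coeFn_smul s g] with x h1 h2
  rw [h1, Pi.add_apply, h2, Pi.smul_apply, smul_eq_mul]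

/-- If `w ≠ 0` a.e., the velocity is free to choose; the velocity `(w₁ - w) / t + s` moves `w` close
to `w₁` in a short time `t`, and a small generic `s` makes the new `w` nonzero a.e. again. -/
lemma reach_of_ae_ne {z : Phase d} (hz : ∀ᵐ x, smoothing d z.1 x ≠ 0) (z₁ : Phase d) :
    Reach z z₁ := by
  have hpos : ∀ᶠ t in 𝓝[>] (0 : ℝ), t ∈ Ioo 0 Real.pi := Ioo_mem_nhdsGT Real.pi_pos
  have hid : Tendsto (fun t : ℝ => t) (𝓝[>] 0) (𝓝 0) :=
    tendsto_nhdsWithin_of_tendsto_nhds tendsto_id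
  -- the state after time `t`, without and with the shift `s`
  set q : ℝ → L2 d := fun t => t⁻¹ • smoothing d (z₁.1 - z.1) with hq
  set A : ℝ → L2 d := fun t => (evo 0 t (z.1, q t)).1 with hA
  set B : ℝ → L2 d := fun t => mult (symS 0 t) (oneL d) with hB
  have hs : ∀ t, ∃ s ∈ Ioo (0 : ℝ) 1, ∀ᵐ x, smoothing d (A t) x + s * smoothing d (B t) x = 0 →
      smoothing d (B t) x = 0 := fun t => by
    obtain ⟨s, hs1, hs2⟩ := (dense_generic (smoothing d (A t)) (smoothing d (B t))).exists_mem_open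
      (isOpen_Ioo (a := (0 : ℝ)) (b := 1)) ⟨1 / 2, by norm_num⟩
    exact ⟨s, hs2, hs1⟩
  choose s hs01 hs using hs
  refine ApproxSteer.of_tendsto (t := fun t => t) (Z := fun t => (A t + s t • B t, z₁.2)) hid
    (hpos.mono fun t ht => ht.1.le) (hpos.mono fun t ht => ?_) ?_
  · have h1 : Reach z (z.1, q t + s t • oneL d) := by
      have := reach_add_snd z (q t + s t • oneL d - z.2) (by
        filter_upwards [hz] with x hx h0
        exact absurd h0 hx)
      rwa [add_sub_cancel] at this
    have h2 := approxSteer_evo zero_le_one ht.1.le (z.1, q t + s t • oneL d)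
    have h3 : (evo 0 t (z.1, q t + s t • oneL d)).1 = A t + s t • B t := by
      simp only [evo_apply, hA, hB, map_add, map_smul, add_assoc]
    refine (h1.trans_steer ht.1.le h2).trans_reach ht.1.le ?_
    have h4 := reach_add_snd (evo 0 t (z.1, q t + s t • oneL d))
      (z₁.2 - (evo 0 t (z.1, q t + s t • oneL d)).2) (by
        have h5 := smoothing_symS_oneL (d := d) t
        have h6 : Real.sin t ≠ 0 := (Real.sin_pos_of_pos_of_lt_pi ht.1 ht.2).ne'
        rw [h3, map_add, map_smul]
        filter_upwards [hs t, coeFn_add_smul (smoothing d (A t)) (smoothing d (B t)) (s t),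
          Lp.coeFn_smul (Real.sin t) (oneL d), coeFn_oneL (d := d)] with x e1 e2 e3 e4 h0
        rw [e2] at h0
        have e5 := e1 h0
        rw [hB, h5, e3, Pi.smul_apply, e4, smul_eq_mul, mul_one] at e5
        exact absurd e5 h6)
    rwa [add_sub_cancel, h3] at h4
  · refine Tendsto.prodMk_nhds ?_ tendsto_const_nhds
    have e : ∀ t, A t = (evo 0 t (z.1, 0)).1 + t⁻¹ • mult (symS 0 t) (smoothing d (z₁.1 - z.1)) :=
      fun t => by simp [hA, hq, evo_apply]
    have h1 : Tendsto (fun t => (evo 0 t (z.1, (0 : L2 d))).1) (𝓝[>] 0) (𝓝 z.1) := by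
      have := (continuous_fst.tendsto _).comp
        (((continuous_evo zero_le_one (z.1, (0 : L2 d))).tendsto 0).comp hid)
      rwa [evo_zero zero_le_one] at this
    have h2 := h1.add (tendsto_inv_smul_symS_smoothing (z₁.1 - z.1))
    have h3 : Tendsto B (𝓝[>] 0) (𝓝 0) := by
      have := (continuous_fst.tendsto _).comp
        (((continuous_evo zero_le_one ((0 : L2 d), oneL d)).tendsto 0).comp hid)
      rw [evo_zero zero_le_one] at this
      simpa [Function.comp_def, evo_apply] using this
    have h4 : Tendsto (fun t => s t • B t) (𝓝[>] 0) (𝓝 0) := by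
      refine squeeze_zero_norm (a := fun t => ‖B t‖) (fun t => ?_) (by simpa using h3.norm)
      rw [norm_smul, Real.norm_of_nonneg (hs01 t).1.le]
      exact mul_le_of_le_one_left (norm_nonneg _) (hs01 t).2.le
    have h5 := h2.add h4
    rw [add_sub_cancel, add_zero] at h5
    exact h5.congr fun t => by rw [e]

lemma minTime_lt_top_of_ae_ne {T : ℝ} (hT : 0 ≤ T) {z z' : Phase d} (h : ApproxSteer T z z')
    (hz' : ∀ᵐ x, smoothing d z'.1 x ≠ 0) : minTime (toState z) < ∞ :=
  minTime_lt_top_of_approxSteer hT fun z₁ => h.trans_reach hT (reach_of_ae_ne hz' z₁)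

/-! ### Reaching a state with `w ≠ 0` almost everywhere -/

/-- Under the constant potential `1` the zero mode grows linearly while the others oscillate, so
that a velocity of nonzero mean eventually dominates. -/
lemma exists_ae_ne_smoothing_symS {g : L2 d} (hg : Summable fun n => ‖coef n g‖ / jap n)
    (h0 : coef 0 g ≠ 0) : ∃ t : ℝ, 0 ≤ t ∧ ∀ᵐ x, smoothing d (mult (symS 1 t) g) x ≠ 0 := by
  set r : ℝ := (mass d)⁻¹ * ∫ x, g x with hr
  have hr0 : coef 0 g = (r : ℂ) := coef_zero_eq_integral g
  have hrne : r ≠ 0 := fun h => h0 (by rw [hr0, h, Complex.ofReal_zero])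
  set K := 2 * ∑' n, ‖coef n g‖ / jap n with hK
  have hK0 : 0 ≤ K := mul_nonneg zero_le_two (tsum_nonneg fun n =>
    div_nonneg (norm_nonneg _) (jap_pos n).le)
  set t : ℝ := (K + 1) / |r| with ht
  have ht0 : 0 ≤ t := by positivity
  refine ⟨t, ht0, ?_⟩
  set f : L2 d := smoothing d (mult (symS 1 t) g) + (-(t * r)) • oneL d with hf
  have hcf : ∀ n, ‖coef n f‖ ≤ 2 * (‖coef n g‖ / jap n) := by
    intro n
    have h1 : coef n (smoothing d (mult (symS 1 t) g)) = (sinOver t (freq 1 n) : ℂ) * coef n g := by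
      rw [coef_smoothing, coef_mult (isSymbol_symS le_rfl t), symS]
      have := jap_ne_zero n
      push_cast
      field_simp
    rw [hf, map_add, map_smul, coef_oneL, h1]
    have hfr := freq_sq le_rfl n
    by_cases hn : n = 0
    · subst hn
      have h2 : freq 1 (0 : Fin d → ℤ) = 0 := by
        rw [jap_zero] at hfr
        exact pow_eq_zero_iff two_ne_zero |>.1 (by linarith)
      have h3 : sinOver t 0 = t := by simp [sinOver]
      rw [h2, h3, hr0]
      have : (t : ℂ) * r + (-(t * r)) • (if (0 : Fin d → ℤ) = 0 then (1 : ℂ) else 0) = 0 := by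
        simp
      rw [this, norm_zero]
      exact mul_nonneg zero_le_two (div_nonneg (norm_nonneg _) (jap_pos _).le)
    · rw [if_neg hn, smul_zero, add_zero, norm_mul, Complex.norm_real, Real.norm_eq_abs]
      have h2 : 1 ≤ freq 1 n := by
        obtain ⟨i, hi⟩ := Function.ne_iff.1 hn
        have h3 : (1 : ℝ) ≤ (n i : ℝ) ^ 2 := by
          have h0 : n i ≠ 0 := hi
          have : 0 < n i ^ 2 := by positivity
          have : 1 ≤ n i ^ 2 := this
          exact_mod_cast this
        have h4 : (n i : ℝ) ^ 2 ≤ ∑ j, (n j : ℝ) ^ 2 :=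
          Finset.single_le_sum (f := fun j => (n j : ℝ) ^ 2) (fun j _ => sq_nonneg _)
            (Finset.mem_univ i)
        rw [freq, Real.one_le_sqrt, japaneseSq]
        linarith
      have h3 : jap n ≤ 2 * freq 1 n := by
        refine le_of_sq_le_sq ?_ (by linarith)
        nlinarith
      have h4 : freq 1 n * |sinOver t (freq 1 n)| ≤ 1 := by
        have := Real.abs_sin_le_one (t * freq 1 n)
        rwa [← mul_sinOver, abs_mul, abs_of_nonneg (freq_nonneg 1 n)] at this
      have h5 : |sinOver t (freq 1 n)| ≤ 2 / jap n := by
        rw [le_div_iff₀ (jap_pos n)]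
        nlinarith [abs_nonneg (sinOver t (freq 1 n))]
      calc _ ≤ 2 / jap n * ‖coef n g‖ := mul_le_mul_of_nonneg_right h5 (norm_nonneg _)
        _ = _ := by ring
  have hsum : Summable fun n => ‖coef n f‖ :=
    Summable.of_nonneg_of_le (fun n => norm_nonneg _) hcf (hg.mul_left 2)
  have hle : ∑' n, ‖coef n f‖ ≤ K := by
    rw [hK, ← tsum_mul_left]
    exact hsum.tsum_le_tsum hcf (hg.mul_left 2)
  filter_upwards [abs_le_tsum_coef f hsum, coeFn_add_smul (smoothing d (mult (symS 1 t) g))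
    (oneL d) (-(t * r)), coeFn_oneL (d := d)] with x h1 h2 h3 h4
  rw [hf, h2, h3, h4, zero_add, mul_one, abs_neg, abs_mul, abs_of_nonneg ht0, ht,
    div_mul_cancel₀ _ (abs_ne_zero.2 hrne)] at h1
  linarith

/-- If some velocity `g` of nonzero mean is compatible with the zero set of `w`, then `w` can be made
nonzero a.e.: add `s g` to the velocity, for a generic `s`. -/
lemma minTime_lt_top_of_bump {z z' : Phase d} (hzz' : Reach z z') {g : L2 d}
    (hz : ∀ᵐ x, smoothing d z'.1 x = 0 → g x = 0)
    (hg : Summable fun n => ‖coef n g‖ / jap n) (h0 : coef 0 g ≠ 0) : minTime (toState z) < ∞ := by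
  obtain ⟨t, ht, hne⟩ := exists_ae_ne_smoothing_symS hg h0
  obtain ⟨s, hs⟩ := (dense_generic (smoothing d (evo 1 t z').1)
    (smoothing d (mult (symS 1 t) g))).nonempty
  have h1 : Reach z' (z'.1, z'.2 + s • g) := reach_add_snd z' (s • g) (by
    filter_upwards [hz, Lp.coeFn_smul s g] with x hx h2 h3
    rw [h2, Pi.smul_apply, hx h3, smul_zero])
  refine minTime_lt_top_of_ae_ne ht ((hzz'.trans h1).trans_steer ht
    (approxSteer_evo le_rfl ht _)) ?_
  have e : (evo 1 t (z'.1, z'.2 + s • g)).1 = (evo 1 t z').1 + s • mult (symS 1 t) g := by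
    simp only [evo_apply, map_add, map_smul, add_assoc]
  rw [e, map_add, map_smul]
  filter_upwards [hs, hne, coeFn_add_smul (smoothing d (evo 1 t z').1)
    (smoothing d (mult (symS 1 t) g)) s] with x h2 h3 h4 h5
  exact h3 (h2 (by rw [← h4, h5]))

/-- From position `0` and a velocity of nonzero mean, waiting under the constant potential `1`
suffices. -/
lemma minTime_lt_top_of_velocity {g : L2 d} (hg : Summable fun n => ‖coef n g‖ / jap n)
    (h0 : coef 0 g ≠ 0) : minTime ((0 : L2 d), g) < ∞ := by
  obtain ⟨t, ht, hne⟩ := exists_ae_ne_smoothing_symS hg h0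
  have := minTime_lt_top_of_ae_ne ht (approxSteer_evo le_rfl ht ((0 : L2 d), g)) (by
    simpa [evo_apply] using hne)
  simpa [toState] using this

/-! ### Summability of Fourier coefficients -/

/-- The product of `d` one-variable summable functions is summable on `ℤ^d`. -/
lemma summable_prod_fin {f : ℤ → ℝ} (hf : Summable f) (hf0 : ∀ k, 0 ≤ f k) (d : ℕ) :
    Summable fun n : Fin d → ℤ => ∏ i, f (n i) := by
  induction d with
  | zero => exact .of_finite
  | succ d ih =>
    rw [← (Fin.consEquiv fun _ : Fin (d + 1) => ℤ).summable_iff]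
    refine (hf.mul_of_nonneg ih hf0 fun n => Finset.prod_nonneg fun i _ => hf0 _).congr ?_
    intro p
    simp [Fin.prod_univ_succ, Fin.consEquiv]

/-- By `⟨n⟩^{-2p} ≤ ∏ i, (1 + n_i²)^{-p/d}`. -/
lemma summable_japaneseSq_rpow (hd : 0 < d) {p : ℝ} (hp : (d : ℝ) / 2 < p) :
    Summable fun n : Fin d → ℤ => japaneseSq n ^ (-p) := by
  have hd' : (0 : ℝ) < d := by exact_mod_cast hd
  set σ : ℝ := p / d with hσ
  have hσ2 : 1 < 2 * σ := by
    rw [hσ]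
    rw [div_lt_iff₀ two_pos] at hp
    rw [← mul_div_assoc, lt_div_iff₀ hd']
    linarith
  have h1 : Summable fun k : ℤ => (1 + (k : ℝ) ^ 2) ^ (-σ) := by
    have h2 : Summable fun k : ℤ => |(k : ℝ)| ^ (-(2 * σ)) :=
      Real.summable_abs_int_rpow (by linarith)
    refine Summable.of_norm_bounded_eventually h2 ?_
    refine (Set.finite_singleton (0 : ℤ)).subset fun k hk => ?_
    by_contra hk0
    refine hk ?_
    change ‖(1 + (k : ℝ) ^ 2) ^ (-σ)‖ ≤ |(k : ℝ)| ^ (-(2 * σ))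
    have hk1 : (0 : ℝ) < |(k : ℝ)| := by
      rw [abs_pos]; exact_mod_cast hk0
    rw [Real.norm_of_nonneg (by positivity), show -(2 * σ) = 2 * -σ by ring,
      Real.rpow_mul hk1.le, Real.rpow_two, sq_abs]
    refine Real.rpow_le_rpow_of_nonpos (by rw [← sq_abs]; exact pow_pos hk1 2) (by linarith)
      (by linarith)
  refine Summable.of_nonneg_of_le (fun n => Real.rpow_nonneg
    (zero_le_one.trans (one_le_japaneseSq n)) _) (fun n => ?_)
    (summable_prod_fin h1 (fun k => by positivity) d)
  have hJ : 0 < japaneseSq n := one_pos.trans_le (one_le_japaneseSq n)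
  have h3 : japaneseSq n ^ (-p) = ∏ _i : Fin d, japaneseSq n ^ (-σ) := by
    rw [Finset.prod_const, Finset.card_univ, Fintype.card_fin, ← Real.rpow_natCast,
      ← Real.rpow_mul hJ.le]
    congr 1
    rw [hσ]
    field_simp
  rw [h3]
  refine Finset.prod_le_prod (fun i _ => by positivity) fun i _ => ?_
  refine Real.rpow_le_rpow_of_nonpos (by positivity) ?_ (by linarith)
  have := Finset.single_le_sum (f := fun j => (n j : ℝ) ^ 2) (fun j _ => sq_nonneg _)
    (Finset.mem_univ i)
  simp only [japaneseSq]
  linarith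

/-- `H^s ⊂ {∑ ⟨n⟩⁻¹ |c_n| < ∞}` for `s > d/2 - 1`. -/
lemma summable_of_memSobolev_div (hd : 0 < d) {s : ℝ} (hs : (d : ℝ) / 2 - 1 < s) {f : L2 d}
    (hf : MemSobolev s f) : Summable fun n => ‖coef n f‖ / jap n := by
  have h1 := summable_of_memSobolev hf
  have h2 := summable_japaneseSq_rpow hd (p := s + 1) (by linarith)
  refine Summable.of_nonneg_of_le (fun n => div_nonneg (norm_nonneg _) (jap_pos n).le) (fun n => ?_)
    (h1.add h2)
  have hJ : 0 < japaneseSq n := one_pos.trans_le (one_le_japaneseSq n)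
  set A := japaneseSq n ^ (s / 2) with hA
  set B := japaneseSq n ^ (-(s + 1) / 2) with hB
  have e1 : japaneseSq n ^ s = A ^ 2 := by
    rw [hA, ← Real.rpow_natCast, ← Real.rpow_mul hJ.le]; congr 1; push_cast; ring
  have e2 : japaneseSq n ^ (-(s + 1)) = B ^ 2 := by
    rw [hB, ← Real.rpow_natCast, ← Real.rpow_mul hJ.le]; congr 1; push_cast; ring
  have e3 : (jap n)⁻¹ = A * B := by
    rw [hA, hB, ← Real.rpow_add hJ, jap, Real.sqrt_eq_rpow, ← Real.rpow_neg hJ.le]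
    congr 1
    ring
  rw [e1, e2, div_eq_mul_inv, e3]
  have hA0 : 0 ≤ A := by positivity
  have hB0 : 0 ≤ B := by positivity
  nlinarith [sq_nonneg (A * ‖coef n f‖ - B), mul_nonneg (mul_nonneg hA0 (norm_nonneg (coef n f))) hB0]

/-- A nonzero `w` has a product `ψ w` of nonzero mean, with `ψ` a trigonometric mode. -/
lemma exists_mode_coef_ne_zero {w : L2 d} (hw : w ≠ 0) :
    ∃ φ : C(Torus d, ℝ), PreservesH1 φ ∧ coef 0 (mulL φ w) ≠ 0 := by
  have h : ∃ n, coef n w ≠ 0 := by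
    by_contra hcon
    push Not at hcon
    exact hw (ext_coef fun n => by rw [hcon n, map_zero])
  obtain ⟨n, hn⟩ := h
  by_contra hcon
  push Not at hcon
  have h1 := hcon (cosMode n) (preservesH1_cosMode n)
  have h2 := hcon (sinMode n) (preservesH1_sinMode n)
  rw [coef_cosMode, div_eq_zero_iff] at h1
  rw [coef_sinMode, div_eq_zero_iff] at h2
  have h1' := h1.resolve_right (by norm_num)
  have h2' := h2.resolve_right (by simp [Complex.I_ne_zero])
  rw [zero_add] at h1' h2'
  exact hn (by linear_combination (1 / 2) * h1' - (1 / 2) * h2')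

/-! ### A bump with summable Fourier coefficients -/

/-- The indicator function of the ball of centre `x` and radius `ρ`. -/
noncomputable def ballL (ρ : ℝ) (x : Torus d) : L2 d :=
  indicatorConstLp 2 (measurableSet_ball (x := x) (ε := ρ)) (measure_ne_top _ _) (1 : ℝ)

lemma coeFn_ballL (ρ : ℝ) (x : Torus d) :
    ∀ᵐ y, ballL ρ x y = (Metric.ball x ρ).indicator (fun _ => (1 : ℝ)) y :=
  indicatorConstLp_coeFn

lemma coef_ballL (ρ : ℝ) (x : Torus d) (n : Fin d → ℤ) :
    coef n (ballL ρ x) = expMode (-n) x * coef n (ballL ρ 0) := by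
  have h : ∀ x : Torus d, ∫ y, (ballL ρ x y : ℂ) * expMode (-n) y =
      ∫ y, (((Metric.ball x ρ).indicator (fun _ => (1 : ℝ)) y : ℝ) : ℂ) * expMode (-n) y := by
    intro x
    refine integral_congr_ae ?_
    filter_upwards [coeFn_ballL ρ x] with y hy
    rw [hy]
  have h2 : ∫ y, (((Metric.ball x ρ).indicator (fun _ => (1 : ℝ)) y : ℝ) : ℂ) * expMode (-n) y =
      expMode (-n) x *
        ∫ y, (((Metric.ball 0 ρ).indicator (fun _ => (1 : ℝ)) y : ℝ) : ℂ) * expMode (-n) y := by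
    rw [← integral_add_right_eq_self _ x, ← integral_const_mul]
    refine integral_congr_ae (.of_forall fun y => ?_)
    have h1 : (Metric.ball x ρ).indicator (fun _ => (1 : ℝ)) (y + x) =
        (Metric.ball 0 ρ).indicator (fun _ => (1 : ℝ)) y := by
      have hiff : y + x ∈ Metric.ball x ρ ↔ y ∈ Metric.ball 0 ρ := by
        simp [Metric.mem_ball, dist_eq_norm]
      by_cases hy : y ∈ Metric.ball 0 ρ
      · rw [indicator_of_mem hy, indicator_of_mem (hiff.2 hy)]
      · rw [indicator_of_notMem hy, indicator_of_notMem (mt hiff.1 hy)]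
    simp only [h1, expMode_add_right]
    ring
  rw [coef_eq_integral, coef_eq_integral, h, h, h2]
  exact mul_left_comm _ _ _

lemma coef_zero_ballL_ne_zero {ρ : ℝ} (hρ : 0 < ρ) (x : Torus d) : coef 0 (ballL ρ x) ≠ 0 := by
  rw [coef_zero_eq_integral, ballL, integral_indicatorConstLp]
  have h1 : 0 < volume (Metric.ball x ρ) := Metric.measure_ball_pos _ _ hρ
  have h2 : volume.real (Metric.ball x ρ) ≠ 0 :=
    (ENNReal.toReal_pos h1.ne' (measure_ne_top _ _)).ne'
  simpa [(mass_pos d).ne'] using h2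

/-- A nonempty open set supports a function with nonzero mean and summable Fourier coefficients:
the convolution of the indicator functions of two balls. -/
lemma exists_bump {U : Set (Torus d)} (hU : IsOpen U) (hne : U.Nonempty) :
    ∃ g : L2 d, (∀ᵐ x, x ∉ U → g x = 0) ∧ (Summable fun n => ‖coef n g‖) ∧ coef 0 g ≠ 0 := by
  obtain ⟨p, hp⟩ := hne
  obtain ⟨r, hr, hball⟩ := Metric.isOpen_iff.1 hU p hp
  set ρ := r / 2 with hρ
  set a : (Fin d → ℤ) → ℂ := fun n =>
    (starRingEnd ℂ) (coef n (ballL ρ 0)) * coef n (ballL ρ p) with ha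
  have hs : Summable fun n => ‖a n‖ := by
    refine Summable.of_nonneg_of_le (fun n => norm_nonneg _) (fun n => ?_)
      ((summable_sq_coef (ballL ρ (0 : Torus d))).add (summable_sq_coef (ballL ρ p)))
    rw [ha, norm_mul, RCLike.norm_conj]
    nlinarith [sq_nonneg (‖coef n (ballL ρ 0)‖ - ‖coef n (ballL ρ p)‖),
      mul_nonneg (norm_nonneg (coef n (ballL ρ 0))) (norm_nonneg (coef n (ballL ρ p)))]
  obtain ⟨g, hg⟩ := exists_coef_eq a (fun n => by simp [ha, coef_neg]) (by
    refine Summable.of_norm_bounded_eventually hs ?_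
    have h1 := hs.tendsto_cofinite_zero.eventually (gt_mem_nhds one_pos)
    filter_upwards [h1] with n hn
    rw [Real.norm_of_nonneg (by positivity), sq]
    exact mul_le_of_le_one_left (norm_nonneg _) hn.le)
  -- `g x` is, up to a constant factor, the integral of `ballL ρ x * ballL ρ p`
  have hs' : Summable fun n => ‖coef n g‖ := by simpa only [hg] using hs
  refine ⟨g, ?_, hs', ?_⟩
  · filter_upwards [ae_eq_tsum_coef g hs'] with x hx hxU
    have h1 : ∀ n, coef n g • expMode n x =
        (starRingEnd ℂ) (coef n (ballL ρ x)) * coef n (ballL ρ p) := fun n => by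
      rw [hg, coef_ballL ρ x, map_mul, expMode_neg, Complex.conj_conj, ha, smul_eq_mul]
      ring
    simp only [h1] at hx
    rw [(hasSum_coef_mul_coef _ _).tsum_eq] at hx
    have h2 : ∫ y, ballL ρ x y * ballL ρ p y = 0 := by
      refine integral_eq_zero_of_ae ?_
      filter_upwards [coeFn_ballL ρ x, coeFn_ballL ρ p] with y h3 h4
      rw [h3, h4]
      by_cases hy : y ∈ Metric.ball x ρ
      · have : y ∉ Metric.ball p ρ := fun hy' => hxU (hball (by
          rw [Metric.mem_ball] at *
          linarith [dist_triangle_left x p y]))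
        simp [this]
      · simp [hy]
    rw [h2, mul_zero] at hx
    exact_mod_cast hx
  · rw [hg, ha]
    have hρ0 : 0 < ρ := by positivity
    exact mul_ne_zero ((map_ne_zero _).2 (coef_zero_ballL_ne_zero hρ0 0))
      (coef_zero_ballL_ne_zero hρ0 p)

/-! ### Squeezing and rotating the state -/

lemma reach_const (r : ℝ) (z : Phase d) : Reach z (z.1, z.2 + r • smoothing d z.1) := by
  have h := isKick_continuous (r • (1 : C(Torus d, ℝ))) z
  rwa [kick, mulL_smul, mulL_one] at h

lemma coef_const_kick (r : ℝ) (f g : L2 d) (n : Fin d → ℤ) :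
    coef n (g + r • smoothing d f) = coef n g + ((r / jap n : ℝ) : ℂ) * coef n f := by
  rw [map_add, map_smul, coef_smoothing, Complex.real_smul]
  push_cast
  ring

/-- Under the potential `-κ²` during a time `θ / κ`, every mode of frequency much smaller than `κ`
is rotated by `θ` at the scale `κ`. -/
lemma tendsto_mul_freq (θ : ℝ) (n : Fin d → ℤ) :
    Tendsto (fun κ : ℝ => θ / κ * freq (-κ ^ 2) n) atTop (𝓝 θ) := by
  have h1 : Tendsto (fun κ : ℝ => θ * Real.sqrt (jap n ^ 2 * (κ⁻¹) ^ 2 + 1)) atTop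
      (𝓝 (θ * Real.sqrt (jap n ^ 2 * 0 ^ 2 + 1))) :=
    ((((tendsto_inv_atTop_zero.pow 2).const_mul _).add_const _).sqrt).const_mul _
  have h2 : θ * Real.sqrt (jap n ^ 2 * 0 ^ 2 + 1) = θ := by simp
  rw [h2] at h1
  refine h1.congr' ?_
  filter_upwards [eventually_gt_atTop 0] with κ hκ
  have h3 : jap n ^ 2 * (κ⁻¹) ^ 2 + 1 = (japaneseSq n - -κ ^ 2) / κ ^ 2 := by
    rw [jap_sq]; field_simp; ring
  rw [h3, Real.sqrt_div' _ (sq_nonneg κ), Real.sqrt_sq hκ.le, freq]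
  ring

/-- `0 ≤ √(⟨n⟩² + κ²) - κ ≤ min (⟨n⟩, ⟨n⟩² / κ)`. -/
lemma freq_sub_le {κ : ℝ} (hκ : 0 < κ) (n : Fin d → ℤ) :
    0 ≤ freq (-κ ^ 2) n - κ ∧ freq (-κ ^ 2) n - κ ≤ jap n ∧
      freq (-κ ^ 2) n - κ ≤ jap n ^ 2 / κ := by
  have h := freq_sq (c := -κ ^ 2) (by nlinarith) n
  have h0 := freq_nonneg (-κ ^ 2) n
  have hj := jap_pos n
  refine ⟨sub_nonneg.2 (le_of_sq_le_sq (by nlinarith) h0), ?_, ?_⟩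
  · have : freq (-κ ^ 2) n ≤ jap n + κ := le_of_sq_le_sq (by nlinarith) (by linarith)
    linarith
  · rw [le_div_iff₀ hκ]
    nlinarith

/-- The high-frequency limit of the oscillator: the potential `-κ²` during a time `θ / κ`, followed
by the kick `κ tan θ` which cancels the large velocity `-κ sin θ w`, has as `κ → ∞` the effect
`(w, ẇ) ↦ (cos θ w, ẇ / cos θ)`. -/
lemma reach_squeeze_cos {θ : ℝ} (hθ0 : 0 < θ) (hθ : θ < Real.pi / 2) (z : Phase d) :
    Reach z (Real.cos θ • z.1, (Real.cos θ)⁻¹ • z.2) := by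
  have hcos : 0 < Real.cos θ := Real.cos_pos_of_mem_Ioo ⟨by linarith, hθ⟩
  set τ := Real.tan θ with hτ
  have hτ0 : 0 ≤ τ := Real.tan_nonneg_of_nonneg_of_le_pi_div_two hθ0.le hθ.le
  have hτc : τ * Real.cos θ = Real.sin θ := Real.tan_mul_cos hcos.ne'
  have hpos : ∀ᶠ κ : ℝ in atTop, 0 < κ := eventually_gt_atTop 0
  have hc : ∀ κ : ℝ, -κ ^ 2 ≤ 1 := fun κ => by nlinarith
  set E : ℝ → Phase d := fun κ => evo (-κ ^ 2) (θ / κ) z with hE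
  set Z : ℝ → Phase d := fun κ => ((E κ).1, (E κ).2 + (κ * τ) • smoothing d (E κ).1) with hZ
  -- the multipliers of the second component
  set m₁ : ℝ → (Fin d → ℤ) → ℝ := fun κ n =>
    symD (-κ ^ 2) (θ / κ) n + κ * τ / jap n * symC (-κ ^ 2) (θ / κ) n with hm₁
  set m₂ : ℝ → (Fin d → ℤ) → ℝ := fun κ n =>
    symC (-κ ^ 2) (θ / κ) n + κ * τ / jap n * symS (-κ ^ 2) (θ / κ) n with hm₂
  have hZ1 : ∀ κ n, coef n (Z κ).1 = symC (-κ ^ 2) (θ / κ) n * coef n z.1 +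
      symS (-κ ^ 2) (θ / κ) n * coef n z.2 := fun κ n => coef_evo_fst (hc κ) _ _ _
  have hZ2 : ∀ κ n, coef n (Z κ).2 = (m₁ κ n : ℂ) * coef n z.1 + (m₂ κ n : ℂ) * coef n z.2 :=
    fun κ n => by
      rw [hZ]
      simp only
      rw [coef_const_kick, hE]
      simp only
      rw [coef_evo_fst (hc κ), coef_evo_snd (hc κ), hm₁, hm₂]
      push_cast
      ring
  have hsin : ∀ {κ : ℝ}, 0 < κ → ∀ n : Fin d → ℤ, |symS (-κ ^ 2) (θ / κ) n| ≤ 1 := by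
    intro κ hκ n
    have h1 : jap n ≤ freq (-κ ^ 2) n := by
      refine le_of_sq_le_sq ?_ (freq_nonneg _ _)
      rw [freq_sq (hc κ)]
      nlinarith
    rw [symS, abs_mul, abs_of_pos (jap_pos n)]
    have := Real.abs_sin_le_one (θ / κ * freq (-κ ^ 2) n)
    rw [← mul_sinOver, abs_mul, abs_of_nonneg (freq_nonneg _ n)] at this
    exact (mul_le_mul_of_nonneg_right h1 (abs_nonneg _)).trans this
  have hsin0 : ∀ n : Fin d → ℤ, Tendsto (fun κ => symS (-κ ^ 2) (θ / κ) n) atTop (𝓝 0) := by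
    intro n
    refine squeeze_zero_norm (a := fun κ => jap n * |θ / κ|) (fun κ => ?_) ?_
    · rw [symS, Real.norm_eq_abs, abs_mul, abs_of_pos (jap_pos n)]
      exact mul_le_mul_of_nonneg_left (abs_sinOver_le _ _) (jap_pos n).le
    · have := ((tendsto_const_nhds (x := θ)).div_atTop tendsto_id).abs.const_mul (jap n)
      simpa using this
  have hcos' : ∀ n : Fin d → ℤ,
      Tendsto (fun κ => symC (-κ ^ 2) (θ / κ) n) atTop (𝓝 (Real.cos θ)) := fun n =>
    (Real.continuous_cos.tendsto θ).comp (tendsto_mul_freq θ n)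
  set C := 1 + θ / Real.cos θ with hC
  have hC0 : 0 ≤ C := by positivity
  have hm₁le : ∀ {κ : ℝ}, 0 < κ → ∀ n, |m₁ κ n| ≤ C * (freq (-κ ^ 2) n - κ) / jap n := by
    intro κ hκ n
    obtain ⟨h0, -, -⟩ := freq_sub_le hκ n
    set ω := freq (-κ ^ 2) n with hω
    have e : m₁ κ n = (-((ω - κ) * Real.sin (θ / κ * ω)) +
        κ * (Real.sin (θ - θ / κ * ω) / Real.cos θ)) / jap n := by
      have h2 : Real.sin (θ - θ / κ * ω) / Real.cos θ =
          τ * Real.cos (θ / κ * ω) - Real.sin (θ / κ * ω) := by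
        rw [div_eq_iff hcos.ne', Real.sin_sub, ← hτc]; ring
      rw [h2, hm₁]
      simp only [symD, symC, ← hω]
      rw [sq, mul_assoc, mul_sinOver]
      ring
    rw [e, abs_div, abs_of_pos (jap_pos n)]
    refine div_le_div_of_nonneg_right ((abs_add_le _ _).trans ?_) (jap_pos n).le
    rw [abs_neg, abs_mul, abs_mul, abs_div, abs_of_nonneg h0, abs_of_pos hκ, abs_of_pos hcos]
    have h3 : |Real.sin (θ - θ / κ * ω)| ≤ θ / κ * (ω - κ) := by
      refine Real.abs_sin_le_abs.trans_eq ?_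
      rw [show θ - θ / κ * ω = -(θ / κ * (ω - κ)) by field_simp; ring, abs_neg,
        abs_of_nonneg (by positivity)]
    calc (ω - κ) * |Real.sin (θ / κ * ω)| + κ * (|Real.sin (θ - θ / κ * ω)| / Real.cos θ)
        ≤ (ω - κ) * 1 + κ * (θ / κ * (ω - κ) / Real.cos θ) := by
          gcongr
          exact Real.abs_sin_le_one _
      _ = C * (ω - κ) := by rw [hC]; field_simp
  have hm₁b : ∀ {κ : ℝ}, 0 < κ → ∀ n, |m₁ κ n| ≤ C := fun hκ n => by
    refine (hm₁le hκ n).trans ?_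
    rw [div_le_iff₀ (jap_pos n)]
    exact mul_le_mul_of_nonneg_left (freq_sub_le hκ n).2.1 hC0
  have hm₁0 : ∀ n, Tendsto (fun κ => m₁ κ n) atTop (𝓝 0) := by
    intro n
    refine squeeze_zero_norm' (a := fun κ => C * (jap n ^ 2 / κ) / jap n) ?_ ?_
    · filter_upwards [hpos] with κ hκ
      refine (hm₁le hκ n).trans ?_
      exact div_le_div_of_nonneg_right
        (mul_le_mul_of_nonneg_left (freq_sub_le hκ n).2.2 hC0) (jap_pos n).le
    · have := (((tendsto_const_nhds (x := jap n ^ 2)).div_atTop tendsto_id).const_mul C).div_const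
        (jap n)
      simpa using this
  have hm₂e : ∀ {κ : ℝ}, 0 < κ → ∀ n, m₂ κ n = Real.cos (θ / κ * freq (-κ ^ 2) n) +
      τ * θ * Real.sinc (θ / κ * freq (-κ ^ 2) n) := fun {κ} hκ n => by
    have := (jap_pos n).ne'
    simp only [hm₂, symC, symS, sinOver]
    field_simp
  have hm₂b : ∀ {κ : ℝ}, 0 < κ → ∀ n, |m₂ κ n| ≤ 1 + τ * θ := fun hκ n => by
    rw [hm₂e hκ]
    refine (abs_add_le _ _).trans (add_le_add (Real.abs_cos_le_one _) ?_)
    rw [abs_mul, abs_of_nonneg (by positivity)]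
    exact mul_le_of_le_one_right (by positivity) (Real.abs_sinc_le_one _)
  have hm₂1 : ∀ n, Tendsto (fun κ => m₂ κ n) atTop (𝓝 (Real.cos θ)⁻¹) := by
    intro n
    have h1 : Tendsto (fun κ => Real.cos (θ / κ * freq (-κ ^ 2) n) +
        τ * θ * Real.sinc (θ / κ * freq (-κ ^ 2) n)) atTop
        (𝓝 (Real.cos θ + τ * θ * Real.sinc θ)) :=
      ((Real.continuous_cos.tendsto θ).comp (tendsto_mul_freq θ n)).add
        (((Real.continuous_sinc.tendsto θ).comp (tendsto_mul_freq θ n)).const_mul _)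
    have h2 : Real.cos θ + τ * θ * Real.sinc θ = (Real.cos θ)⁻¹ := by
      rw [Real.sinc_of_ne_zero hθ0.ne', ← hτc]
      refine eq_inv_of_mul_eq_one_left ?_
      have h3 := Real.sin_sq_add_cos_sq θ
      rw [← hτc] at h3
      field_simp
      linear_combination h3
    rw [h2] at h1
    exact h1.congr' (hpos.mono fun κ hκ => (hm₂e hκ n).symm)
  have hcosle : |Real.cos θ| ≤ 1 := Real.abs_cos_le_one θ
  refine ApproxSteer.of_tendsto (t := fun κ : ℝ => θ / κ) (Z := Z)
    (tendsto_const_nhds.div_atTop tendsto_id) (hpos.mono fun κ hκ => by positivity)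
    (hpos.mono fun κ hκ => ?_) (Tendsto.prodMk_nhds ?_ ?_)
  · have ht : 0 ≤ θ / κ := by positivity
    exact (approxSteer_evo (hc κ) ht z).trans_reach ht (reach_const (κ * τ) _)
  · refine tendsto_of_coef _ (summable_dominating 1 1 z.1 z.2) (hpos.mono fun κ hκ n => ?_)
      (fun n => ?_) fun n => ?_
    · rw [hZ1]
      exact norm_coef_add_le (abs_symC_le _ _ _) (hsin hκ n) _ _
    · rw [map_smul, norm_smul, Real.norm_eq_abs]
      nlinarith [norm_nonneg (coef n z.1), norm_nonneg (coef n z.2)]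
    · refine Tendsto.congr (fun κ => (hZ1 κ n).symm) ?_
      rw [map_smul]
      have := ((hcos' n).ofReal.mul_const (coef n z.1)).add
        ((hsin0 n).ofReal.mul_const (coef n z.2))
      simpa using this
  · have hinv : (Real.cos θ)⁻¹ ≤ 1 + τ * θ :=
      le_of_tendsto (hm₂1 0) (hpos.mono fun κ hκ => (le_abs_self _).trans (hm₂b hκ 0))
    refine tendsto_of_coef _ (summable_dominating C (1 + τ * θ) z.1 z.2)
      (hpos.mono fun κ hκ n => ?_) (fun n => ?_) fun n => ?_
    · rw [hZ2]
      exact norm_coef_add_le (hm₁b hκ n) (hm₂b hκ n) _ _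
    · rw [map_smul, norm_smul, Real.norm_of_nonneg (by positivity)]
      have h1 := mul_le_mul_of_nonneg_right hinv (norm_nonneg (coef n z.2))
      have h2 := mul_nonneg hC0 (norm_nonneg (coef n z.1))
      linarith
    · refine Tendsto.congr (fun κ => (hZ2 κ n).symm) ?_
      rw [map_smul]
      have := ((hm₁0 n).ofReal.mul_const (coef n z.1)).add
        ((hm₂1 n).ofReal.mul_const (coef n z.2))
      simpa using this

/-- The position can be contracted, and the velocity expanded, by any factor. -/
lemma reach_squeeze {r : ℝ} (hr0 : 0 < r) (hr1 : r < 1) (z : Phase d) :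
    Reach z (r • z.1, r⁻¹ • z.2) := by
  have h := reach_squeeze_cos (Real.arccos_pos.2 hr1) (Real.arccos_lt_pi_div_two.2 hr0) z
  rwa [Real.cos_arccos (by linarith) hr1.le] at h

lemma abs_cos_sub_sinc_le (x : ℝ) : |Real.cos x - Real.sinc x| ≤ x ^ 2 := by
  rcases eq_or_ne x 0 with rfl | hx
  · simp
  have hx' : 0 < |x| := abs_pos.2 hx
  have h1 : |Real.cos x - 1| ≤ x ^ 2 / 2 := by
    rw [abs_le]
    constructor <;> nlinarith [Real.one_sub_sq_div_two_le_cos (x := x), Real.cos_le_one x]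
  have h2 : |1 - Real.sinc x| ≤ x ^ 2 / 6 := by
    have e : 1 - Real.sinc x = (x - Real.sin x) / x := by
      rw [Real.sinc_of_ne_zero hx]; field_simp
    rw [e, abs_div, div_le_iff₀ hx']
    refine (Real.abs_sub_sin_le x).trans_eq ?_
    rw [← sq_abs x]
    ring
  calc |Real.cos x - Real.sinc x| = |(Real.cos x - 1) + (1 - Real.sinc x)| := by congr 1; ring
    _ ≤ x ^ 2 / 2 + x ^ 2 / 6 := (abs_add_le _ _).trans (add_le_add h1 h2)
    _ ≤ x ^ 2 := by nlinarith [sq_nonneg x]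

/-- The free evolution during a time `r` from the squeezed state `(r w, ẇ / r)`, followed by the kick
`-1 / r`, acts as `(w, ẇ) ↦ (ẇ, -w)` in the limit `r → 0`. Here `ẇ` is in `H¹`, and a preliminary
kick by the constant `μ` has turned it into `ẇ + μ w`. -/
lemma reach_rotate (a b : L2 d) (μ : ℝ) :
    Reach (a, smoothing d b) (b + μ • a, -smoothing d a) := by
  set e := b + μ • a with he
  have hpos : ∀ᶠ r in 𝓝[>] (0 : ℝ), r ∈ Ioo 0 1 := Ioo_mem_nhdsGT one_pos
  have hid : Tendsto (fun r : ℝ => r) (𝓝[>] 0) (𝓝 0) :=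
    tendsto_nhdsWithin_of_tendsto_nhds tendsto_id
  have hμ : Reach (a, smoothing d b) (a, smoothing d e) := by
    have := reach_const μ (a, smoothing d b)
    rwa [← map_smul, ← map_add] at this
  set E : ℝ → Phase d := fun r => evo 0 r (r • a, r⁻¹ • smoothing d e) with hE
  set Z : ℝ → Phase d := fun r => ((E r).1, (E r).2 + (-r⁻¹) • smoothing d (E r).1) with hZ
  have hZ1 : ∀ {r : ℝ}, 0 < r → ∀ n, coef n (Z r).1 =
      ((r * Real.cos (r * jap n) : ℝ) : ℂ) * coef n a +
        ((Real.sinc (r * jap n) : ℝ) : ℂ) * coef n e := by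
    intro r hr n
    have hr' : (r : ℂ) ≠ 0 := by exact_mod_cast hr.ne'
    have hj := jap_ne_zero n
    simp only [hZ, hE]
    rw [coef_evo_fst zero_le_one, map_smul, map_smul, coef_smoothing, Complex.real_smul,
      Complex.real_smul, symC, symS, freq_zero, sinOver]
    push_cast
    field_simp
  have hZ2 : ∀ {r : ℝ}, 0 < r → ∀ n, coef n (Z r).2 =
      ((-(r * Real.sin (r * jap n)) - Real.cos (r * jap n) / jap n : ℝ) : ℂ) * coef n a +
        (((Real.cos (r * jap n) - Real.sinc (r * jap n)) / (r * jap n) : ℝ) : ℂ) * coef n e := by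
    intro r hr n
    have hr' : (r : ℂ) ≠ 0 := by exact_mod_cast hr.ne'
    have hj := jap_ne_zero n
    simp only [hZ]
    rw [coef_const_kick]
    change _ + _ * coef n (Z r).1 = _
    rw [hZ1 hr]
    simp only [hE]
    rw [coef_evo_snd zero_le_one, map_smul, map_smul, coef_smoothing, Complex.real_smul,
      Complex.real_smul, symD_zero, symC_zero]
    push_cast
    field_simp
    ring
  have hb : ∀ {r : ℝ}, r ∈ Ioo (0 : ℝ) 1 → ∀ n : Fin d → ℤ,
      |(Real.cos (r * jap n) - Real.sinc (r * jap n)) / (r * jap n)| ≤ 2 := by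
    intro r hr n
    have hx : 0 < r * jap n := mul_pos hr.1 (jap_pos n)
    rw [abs_div, abs_of_pos hx, div_le_iff₀ hx]
    by_cases h1 : r * jap n ≤ 1
    · exact (abs_cos_sub_sinc_le _).trans (by nlinarith)
    · refine (abs_sub _ _).trans ?_
      linarith [Real.abs_cos_le_one (r * jap n), Real.abs_sinc_le_one (r * jap n)]
  have hlim : ∀ {f : ℝ → ℝ} (n : Fin d → ℤ), Continuous f →
      Tendsto (fun r : ℝ => f (r * jap n)) (𝓝[>] 0) (𝓝 (f 0)) := by
    intro f n hf
    refine tendsto_nhdsWithin_of_tendsto_nhds ?_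
    have : Continuous fun r : ℝ => f (r * jap n) := by fun_prop
    simpa using this.tendsto 0
  refine hμ.trans (ApproxSteer.of_tendsto (t := fun r : ℝ => r) (Z := Z) hid
    (hpos.mono fun r hr => hr.1.le) (hpos.mono fun r hr => ?_) (Tendsto.prodMk_nhds ?_ ?_))
  · exact ((reach_squeeze hr.1 hr.2 (a, smoothing d e)).trans_steer hr.1.le
      (approxSteer_evo zero_le_one hr.1.le _)).trans_reach hr.1.le (reach_const (-r⁻¹) _)
  · refine tendsto_of_coef _ (summable_dominating 1 1 a e) (hpos.mono fun r hr n => ?_)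
      (fun n => ?_) fun n => ?_
    · rw [hZ1 hr.1]
      refine norm_coef_add_le ?_ (Real.abs_sinc_le_one _) _ _
      rw [abs_mul, abs_of_pos hr.1]
      exact mul_le_one₀ hr.2.le (abs_nonneg _) (Real.abs_cos_le_one _)
    · linarith [norm_nonneg (coef n a)]
    · refine Tendsto.congr' (hpos.mono fun r hr => (hZ1 hr.1 n).symm) ?_
      have := ((hid.mul (hlim n Real.continuous_cos)).ofReal.mul_const (coef n a)).add
        ((hlim n Real.continuous_sinc).ofReal.mul_const (coef n e))
      simpa using this
  · refine tendsto_of_coef _ (summable_dominating 2 2 a e) (hpos.mono fun r hr n => ?_)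
      (fun n => ?_) fun n => ?_
    · rw [hZ2 hr.1]
      refine norm_coef_add_le ((abs_sub _ _).trans ?_) (hb hr n) _ _
      have h1 : |-(r * Real.sin (r * jap n))| ≤ 1 := by
        rw [abs_neg, abs_mul, abs_of_pos hr.1]
        exact mul_le_one₀ hr.2.le (abs_nonneg _) (Real.abs_sin_le_one _)
      have h2 : |Real.cos (r * jap n) / jap n| ≤ 1 := by
        rw [abs_div, abs_of_pos (jap_pos n), div_le_one (jap_pos n)]
        exact (Real.abs_cos_le_one _).trans (one_le_jap n)
      linarith
    · have h1 := norm_nonneg (coef n a)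
      have h2 := norm_nonneg (coef n e)
      have h3 : ‖coef n (-smoothing d a)‖ ≤ 1 * ‖coef n a‖ := by
        rw [map_neg, norm_neg, coef_smoothing, norm_mul, norm_inv, Complex.norm_real,
          Real.norm_of_nonneg (jap_pos n).le]
        exact mul_le_mul_of_nonneg_right (inv_le_one_of_one_le₀ (one_le_jap n)) h1
      linarith
    · refine Tendsto.congr' (hpos.mono fun r hr => (hZ2 hr.1 n).symm) ?_
      have h1 : Tendsto (fun r : ℝ => (Real.cos (r * jap n) - Real.sinc (r * jap n)) / (r * jap n))
          (𝓝[>] 0) (𝓝 0) := by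
        refine squeeze_zero_norm' (a := fun r => r * jap n) ?_ ?_
        · filter_upwards [hpos] with r hr
          have hx : 0 < r * jap n := mul_pos hr.1 (jap_pos n)
          rw [Real.norm_eq_abs, abs_div, abs_of_pos hx, div_le_iff₀ hx, ← sq]
          exact abs_cos_sub_sinc_le _
        · simpa using hid.mul_const (jap n)
      have h2 := ((hid.mul (hlim n Real.continuous_sin)).neg.sub
        ((hlim n Real.continuous_cos).div_const (jap n))).ofReal.mul_const (coef n a)
      have h3 := h2.add (h1.ofReal.mul_const (coef n e))
      rw [map_neg, coef_smoothing]
      simpa using h3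

/-! ### Initial states of the three kinds -/

lemma coef_zero_ne_zero_of_nonneg {v : L2 d} (hv : v ≠ 0) (h : ∀ᵐ x, 0 ≤ v x) : coef 0 v ≠ 0 := by
  have hi : Integrable v := (Lp.memLp v).integrable (by norm_num)
  have h1 : ∫ x, v x ≠ 0 := fun h0 => hv (by
    rw [integral_eq_zero_iff_of_nonneg_ae h hi] at h0
    exact Lp.ext (h0.trans (Lp.coeFn_zero _ _ _).symm))
  rw [coef_zero_eq_integral]
  exact_mod_cast mul_ne_zero (inv_ne_zero (mass_pos d).ne') h1

lemma coef_zero_ne_zero_of_sign {v : L2 d} (hv : v ≠ 0)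
    (h : (∀ᵐ x, 0 ≤ v x) ∨ (∀ᵐ x, v x ≤ 0)) : coef 0 v ≠ 0 := by
  rcases h with h | h
  · exact coef_zero_ne_zero_of_nonneg hv h
  · have := coef_zero_ne_zero_of_nonneg (neg_ne_zero.2 hv) (by
      filter_upwards [h, Lp.coeFn_neg v] with x h1 h2
      rw [h2, Pi.neg_apply]
      linarith)
    rwa [map_neg, neg_ne_zero] at this

/-- A velocity of nonzero mean compatible with the zero set of `w`: a product `φ w ∈ H¹` if `d = 3`,
where `1 > d/2 - 1`, and a bump off the zero set if that set is closed. -/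
lemma minTime_lt_top_of_reach (hd : 0 < d) {z z' : Phase d} (h : Reach z z')
    (hw : smoothing d z'.1 ≠ 0)
    (hc : d = 3 ∨ ∃ Z : Set (Torus d), IsClosed Z ∧ ∀ᵐ x, smoothing d z'.1 x = 0 ↔ x ∈ Z) :
    minTime (toState z) < ∞ := by
  rcases hc with hd3 | ⟨Z, hZ, hwZ⟩
  · obtain ⟨φ, hφ, hne⟩ := exists_mode_coef_ne_zero hw
    obtain ⟨b, hb⟩ := hφ z'.1
    refine minTime_lt_top_of_bump h (g := mulL φ (smoothing d z'.1)) ?_ ?_ hne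
    · filter_upwards [coeFn_mulL φ (smoothing d z'.1)] with x h1 h2
      rw [h1, h2, mul_zero]
    · rw [hb]
      exact summable_of_memSobolev_div hd (s := 1) (by subst hd3; norm_num) (memSobolev_smoothing b)
  · have hne : (Zᶜ : Set (Torus d)).Nonempty := by
      by_contra hcon
      rw [not_nonempty_iff_eq_empty, compl_empty_iff] at hcon
      refine hw (Lp.ext ?_)
      filter_upwards [hwZ, Lp.coeFn_zero ℝ 2 (volume : Measure (Torus d))] with x h1 h2
      rw [h2, Pi.zero_apply, h1, hcon]
      trivial
    obtain ⟨g, hgZ, hgs, hg0⟩ := exists_bump hZ.isOpen_compl hne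
    refine minTime_lt_top_of_bump h (g := g) ?_ ?_ hg0
    · filter_upwards [hwZ, hgZ] with x h1 h2 h3
      exact h2 (notMem_compl_iff.2 (h1.1 h3))
    · exact Summable.of_nonneg_of_le (fun n => div_nonneg (norm_nonneg _) (jap_pos n).le)
        (fun n => div_le_self (norm_nonneg _) (one_le_jap n)) hgs

lemma HasClosedZeroSet.exists_isClosed {E : Type*} [Zero E] {f : Torus d → E}
    (h : HasClosedZeroSet f) : ∃ Z : Set (Torus d), IsClosed Z ∧ ∀ᵐ x, f x = 0 ↔ x ∈ Z := by
  obtain ⟨g, hg, hc⟩ := h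
  refine ⟨_, hc, ?_⟩
  filter_upwards [hg] with x hx
  rw [mem_preimage, mem_singleton_iff, hx]

lemma eq_zero_of_pairFun {W : L2 d × L2 d} (h : ∀ᵐ x, pairFun W x = 0) : W = 0 := by
  refine Prod.ext (Lp.ext ?_) (Lp.ext ?_)
  · filter_upwards [h, Lp.coeFn_zero ℝ 2 (volume : Measure (Torus d))] with x h1 h2
    exact (congrArg Prod.fst h1).trans h2.symm
  · filter_upwards [h, Lp.coeFn_zero ℝ 2 (volume : Measure (Torus d))] with x h1 h2
    exact (congrArg Prod.snd h1).trans h2.symm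

lemma minTime_lt_top_of_sameZeros (hd : 0 < d) {z z' : Phase d} (h : Reach z z')
    (hz : toState z ≠ 0) (hzero : ∀ᵐ x, smoothing d z'.1 x = 0 ↔ pairFun (toState z) x = 0)
    (hc : d = 3 ∨ HasClosedZeroSet (pairFun (toState z))) : minTime (toState z) < ∞ := by
  refine minTime_lt_top_of_reach hd h (fun h0 => hz (eq_zero_of_pairFun ?_))
    (hc.imp_right fun hc => ?_)
  · rw [h0] at hzero
    filter_upwards [hzero, Lp.coeFn_zero ℝ 2 (volume : Measure (Torus d))] with x h1 h2
    exact h1.1 h2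
  · obtain ⟨Z, hZ, hZ'⟩ := hc.exists_isClosed
    refine ⟨Z, hZ, ?_⟩
    filter_upwards [hzero, hZ'] with x h1 h2
    exact h1.trans h2

/-- For generic `μ` the position `ẇ + μ w` of the rotated state vanishes only where both `w` and
`ẇ` do. -/
lemma exists_reach_sameZeros (a b : L2 d) : ∃ z' : Phase d, Reach (a, smoothing d b) z' ∧
    ∀ᵐ x, smoothing d z'.1 x = 0 ↔ pairFun (toState (a, smoothing d b)) x = 0 := by
  obtain ⟨μ, hμ⟩ := (dense_generic (smoothing d b) (smoothing d a)).nonempty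
  refine ⟨_, reach_rotate a b μ, ?_⟩
  rw [map_add, map_smul]
  filter_upwards [hμ, coeFn_add_smul (smoothing d b) (smoothing d a) μ] with x h1 h2
  rw [h2]
  simp only [pairFun, toState, Prod.mk_eq_zero]
  constructor
  · intro h3
    have h4 := h1 h3
    rw [h4, mul_zero, add_zero] at h3
    exact ⟨h4, h3⟩
  · rintro ⟨h3, h4⟩
    rw [h3, h4, mul_zero, add_zero]

end KleinGordon

theorem theorem4 (d : ℕ) (hd : 3 ≤ d) :
    (∀ v : KleinGordon.L2 d, v ≠ 0 →
      (∃ s : ℝ, (d : ℝ) / 2 - 1 < s ∧ KleinGordon.MemSobolev s v) →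
      ((∀ᵐ x, 0 ≤ v x) ∨ (∀ᵐ x, v x ≤ 0)) →
      KleinGordon.minTime ((0 : KleinGordon.L2 d), v) < ∞) ∧
    (∀ W₀ : KleinGordon.L2 d × KleinGordon.L2 d, W₀ ≠ 0 →
      KleinGordon.MemSobolev 1 W₀.1 →
      KleinGordon.SameZeroSet W₀.1 (KleinGordon.pairFun W₀) →
      (d = 3 ∨ KleinGordon.HasClosedZeroSet (KleinGordon.pairFun W₀)) →
      KleinGordon.minTime W₀ < ∞) ∧
    (∀ W₀ : KleinGordon.L2 d × KleinGordon.L2 d, W₀ ≠ 0 →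
      KleinGordon.MemSobolev 1 W₀.1 → KleinGordon.MemSobolev 1 W₀.2 →
      (d = 3 ∨ KleinGordon.HasClosedZeroSet (KleinGordon.pairFun W₀)) →
      KleinGordon.minTime W₀ < ∞) := by
  open KleinGordon in
  have hd0 : 0 < d := by omega
  refine ⟨fun v hv ⟨s, hs, hvs⟩ hsign => ?_, fun W₀ hW hW1 hsame hc => ?_,
    fun W₀ hW hW1 hW2 hc => ?_⟩
  · exact minTime_lt_top_of_velocity (summable_of_memSobolev_div hd0 hs hvs)
      (coef_zero_ne_zero_of_sign hv hsign)
  · obtain ⟨z, rfl⟩ := exists_toState_eq hW1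
    refine minTime_lt_top_of_sameZeros hd0 (reach_refl z) hW ?_ hc
    filter_upwards [hsame.1, hsame.2] with x h1 h2
    exact ⟨h2, h1⟩
  · obtain ⟨z, rfl⟩ := exists_toState_eq hW1
    obtain ⟨a, v⟩ := z
    obtain ⟨b, rfl⟩ : ∃ b, smoothing d b = v := exists_smoothing_eq hW2
    obtain ⟨z', h, hz'⟩ := exists_reach_sameZeros a b
    exact minTime_lt_top_of_sameZeros hd0 h hW hz' hc
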